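/- Let $\sigma$ be arc-length measure on the unit circle $S^1\subset\mathbb{R}^2$, and for $t\in\mathbb{R}$ let $R_t$ be the rotation of $\mathbb{R}^2$ by $t$ radians about the origin and $X=d/d\theta$ the vector field on $S^1$ that generates these rotations. Let $\mathcal{H}^0=L^2(S^1)$ with $\|f\|_{\mathcal{H}^0}=\|f\|_{L^2(S^1)}$. For $s>0$ write $s=k+\alpha$ with an integer $k\ge 0$ and $\alpha\in(0,1]$ (so $k=\lfloor s\rfloor$ if $s\notin\mathbb{Z}$), and let $\mathcal{H}^s=\mathcal{H}^s(S^1)$ be the set of complex-valued $f\in L^2(S^1)$ whose weak derivatives $X^mf$, $0\le m\le k$, lie in $L^2(S^1)$ and for which $$\|f\|_{\mathcal{H}^s}=\|f\|_{L^2(S^1)}+\sum_{m=0}^{k}\ \sup_{0<|t|\le 1}\frac{\|(X^mf)\circ R_t-X^mf\|_{L^2(S^1)}}{|t|^{\alpha}}$$ is finite. For $f_1,\dots,f_5\in L^2(S^1)$ let $f_1\sigma\ast\cdots\ast f_5\sigma$ be the convolution of the complex measures $f_i\sigma$ on $\mathbb{R}^2$. Its restriction to $S^1$ is the function $F\in L^2(S^1)$,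 unique up to $\sigma$-null sets, such that $$\frac{(f_1\sigma\ast\cdots\ast f_5\sigma)(B(x,r))}{\pi r^2}\longrightarrow F(x)\qquad\text{in } L^2(S^1,d\sigma(x))\ \text{ as } r\to0^+,$$ provided that this limit exists. **Lemma.** Let $s\ge 0$. There is a constant $C<\infty$, depending only on $s$, such that for all $f_1,\dots,f_5\in\mathcal{H}^s$ the restriction of $f_1\sigma\ast\cdots\ast f_5\sigma$ to $S^1$ exists, belongs to $\mathcal{H}^s$, and satisfies $$\left\|f_1\sigma\ast f_2\sigma\ast f_3\sigma\ast f_4\sigma\ast f_5\sigma\right\|_{\mathcal{H}^s}\le C\prod_{i=1}^5\|f_i\|_{\mathcal{H}^s}.$$ -/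

import Mathlib

open MeasureTheory Filter
open scoped Topology ENNReal NNReal ContDiff

noncomputable section

namespace CircleConv

instance : MeasurableSpace Circle := borel Circle

instance : BorelSpace Circle := ⟨rfl⟩

/-- Arc-length measure `σ` on the unit circle `S¹ ⊆ ℂ = ℝ²` (total mass `2π`). -/
def arc : Measure Circle :=
  Measure.map Circle.exp (volume.restrict (Set.Ioc (-Real.pi) Real.pi))

instance : IsFiniteMeasure arc := by
  unfold arc
  infer_instance

/-- The action on functions of the rotation `exp(tX)` by `t` radians, where `X = d/dθ` is the
vector field on `S¹` generating rotations. -/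
def rot (t : ℝ) (f : Circle → ℂ) : Circle → ℂ := fun x => f (Circle.exp t * x)

/-- The classical derivative `X φ` along the rotation field `X = d/dθ`. -/
def angDeriv (φ : Circle → ℂ) : Circle → ℂ := fun x => deriv (fun t : ℝ => rot t φ x) 0

/-- `g` is the weak derivative `X f`, tested against all smooth functions on `S¹`
(those whose composition with `t ↦ e^{it}` is smooth on `ℝ`). -/
def HasWeakDeriv (f g : Circle → ℂ) : Prop :=
  ∀ φ : Circle → ℂ, ContDiff ℝ ∞ (fun t : ℝ => φ (Circle.exp t)) →
    ∫ x, f x * angDeriv φ x ∂arc = -∫ x, g x * φ x ∂arc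

/-- `D 0, …, D k` are the weak derivatives `f, X f, …, X^k f`, and all of them are in `L²(S¹)`. -/
structure IsDerivSeq (f : Circle → ℂ) (k : ℕ) (D : ℕ → Circle → ℂ) : Prop where
  zero : D 0 =ᵐ[arc] f
  memLp : ∀ m ≤ k, MemLp (D m) 2 arc
  succ : ∀ m < k, HasWeakDeriv (D m) (D (m + 1))

/-- The `L²`-Hölder seminorm `sup_{0 < |t| ≤ 1} ‖exp(tX) g - g‖_{L²} / |t|^α`. -/
def holderSeminorm (α : ℝ) (g : Circle → ℂ) : ℝ≥0∞ :=
  ⨆ (t : ℝ) (_ : 0 < |t| ∧ |t| ≤ 1),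
    eLpNorm (rot t g - g) 2 arc / ENNReal.ofReal (|t| ^ α)

/-- The integer `k ≥ 0` with `s = k + α`, `α ∈ (0, 1]` (and `k = 0` for `s = 0`).
It is `⌊s⌋` if `s` is not an integer. -/
def order (s : ℝ) : ℕ := ⌈s⌉₊ - 1

/-- The norm of `𝓗^s(S¹)`, `s ≥ 0`, with values in `[0, ∞]`: it is `‖f‖_{L²}` for `s = 0`, and
`‖f‖_{L²} + ∑_{m ≤ k} sup_{0 < |t| ≤ 1} ‖exp(tX) X^m f - X^m f‖_{L²} / |t|^α` for `s = k + α > 0`.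
Weak derivatives are unique almost everywhere, so the infimum runs over one value; it is `∞` if
the derivatives `X^m f`, `m ≤ k`, do not all exist in `L²`. -/
def hNorm (s : ℝ) (f : Circle → ℂ) : ℝ≥0∞ :=
  ⨅ (D : ℕ → Circle → ℂ) (_ : IsDerivSeq f (order s) D),
    eLpNorm f 2 arc +
      if s = 0 then 0
      else ∑ m ∈ Finset.range (order s + 1), holderSeminorm (s - order s) (D m)

/-- Membership in `𝓗^s(S¹)`. -/
def MemH (s : ℝ) (f : Circle → ℂ) : Prop := hNorm s f < ⊤

/-- The convolution `f₁σ ∗ ⋯ ∗ f₅σ`, a complex measure on `ℂ = ℝ²`: the image of the product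
measure `f₁σ ⊗ ⋯ ⊗ f₅σ` under addition. -/
def conv5 (f : Fin 5 → Circle → ℂ) : ComplexMeasure ℂ :=
  ((Measure.pi fun _ : Fin 5 => arc).withDensityᵥ fun x => ∏ i, f i (x i)).map
    fun x => ∑ i, (x i : ℂ)

/-- `F ∈ L²(S¹)` is the restriction to `S¹` of (the density of) the complex measure `μ` on `ℂ`:
the mean densities `μ(B(x, r)) / |B(x, r)|`, `x ∈ S¹`, converge to `F` in `L²(S¹)` as `r → 0+`. -/
def IsRestriction (μ : ComplexMeasure ℂ) (F : Circle → ℂ) : Prop :=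
  MemLp F 2 arc ∧
    Tendsto
      (fun r : ℝ => eLpNorm
        (fun x : Circle => μ (Metric.ball (x : ℂ) r) / ((Real.pi * r ^ 2 : ℝ) : ℂ) - F x) 2 arc)
      (𝓝[>] 0) (𝓝 0)

end CircleConv

end

noncomputable section

namespace CircleConv

/-! The case `s = 0` is an `L²` bound that rests on two facts. Among five unit vectors some three
have a sum `S` with `|S|² ≥ 3/2`, since the mean of `|S|²` over the ten triples is at least `3/2`
(`exists_wt_ge`). The density of `σ ∗ σ ∗ σ` is singular on the unit circle, but only
logarithmically, and the weight `||z|² - 1|` makes it bounded (`lintegral_wt_mul_indicator_le`). So,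
paying a factor 2 for the weight of a good triple, the pairing of the fivefold convolution with a
function `g` on the circle becomes a form in two triples of points: the good triple, and the other
two points together with `-x`. Its kernel forces the two triple sums to cancel up to `r` and has
both marginals of size `r²`, so Cauchy–Schwarz bounds it by the product of the six `L²` norms
(`lintegral_sixfold_le`). Summing over all splittings of the five variables and using duality gives
an `L²(S¹)` bound for the mean densities over discs of radius `r`, uniform in `r ≤ 1`
(`eLpNorm_mean_le`).

Convergence as `r → 0` follows from this bound and a density argument. For bounded factors, wherever
two of the first three points are transversal, that pair is integrated first: its convolution has a
bounded density, Lebesgue differentiation applies to it, and dominated convergence does the rest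
(`cauchyMean_of_transversal`). What remains is the set where the first three points are pairwise
nearly parallel. Each splitting into three and two variables puts two of these points into one
block, so the uniform bound is small there (`nearParallel₅_split`). General `L²` factors are
approximated by simple functions one at a time (`cauchyMean_tensor`).

For `s > 0` the restriction is a bounded multilinear operator on `L²(S¹)` that commutes with
rotations (`restrL`, `rotL_restrL`). Weak derivatives are derivatives along the rotation group in
`L²`, so a Leibniz rule holds (`isGen_leibniz`), and Hölder differences are estimated one factor at
a time (`norm_rotL_restrL_sub_le`). The norm of `𝓗^s` does not contain the `L²` norms of the
derivatives; they are recovered from the seminorms by averaging along the group (`IsGen.norm_le`).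
-/

/-! ### Arc length on the circle. -/

instance : Fact (0 < 2 * Real.pi) := ⟨Real.two_pi_pos⟩

/-- This identification brings in the Haar measure of the additive circle: rotation invariance here,
and Fourier series further on. -/
theorem arc_eq_map_toCircle :
    arc = Measure.map (AddCircle.toCircle (T := 2 * Real.pi)) volume := by
  have h := AddCircle.measurePreserving_mk (2 * Real.pi) (-Real.pi)
  have e : -Real.pi + 2 * Real.pi = Real.pi := by ring
  rw [e] at h
  rw [arc, ← h.map_eq, Measure.map_map AddCircle.continuous_toCircle.measurable h.measurable]
  congr 1
  ext x
  simp only [Function.comp_apply]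
  rw [AddCircle.toCircle_apply_mk, div_self Real.two_pi_pos.ne', one_mul]

theorem measurable_exp : Measurable (Circle.exp : ℝ → Circle) :=
  Circle.exp.continuous.measurable

theorem measurePreserving_mul_left (u : Circle) :
    MeasurePreserving (fun x : Circle => u * x) arc arc := by
  refine ⟨by fun_prop, ?_⟩
  obtain ⟨t, rfl⟩ := Circle.exp_surjective u
  rw [arc_eq_map_toCircle,
    Measure.map_map (by fun_prop) AddCircle.continuous_toCircle.measurable]
  have : (fun x : Circle => Circle.exp t * x) ∘ (AddCircle.toCircle (T := 2 * Real.pi)) =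
      AddCircle.toCircle ∘ (fun x : AddCircle (2 * Real.pi) => (t : AddCircle (2 * Real.pi)) + x) := by
    ext x
    simp only [Function.comp_apply]
    rw [AddCircle.toCircle_add, AddCircle.toCircle_apply_mk, div_self Real.two_pi_pos.ne', one_mul]
  rw [this, ← Measure.map_map AddCircle.continuous_toCircle.measurable (by fun_prop),
    map_add_left_eq_self]

theorem lintegral_arc {f : Circle → ℝ≥0∞} (hf : Measurable f) :
    ∫⁻ x, f x ∂arc = ∫⁻ t in Set.Ioc (-Real.pi) Real.pi, f (Circle.exp t) := by
  rw [arc, lintegral_map hf measurable_exp]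

theorem lintegral_arc_mul_left (u : Circle) {f : Circle → ℝ≥0∞} (hf : Measurable f) :
    ∫⁻ x, f (u * x) ∂arc = ∫⁻ x, f x ∂arc :=
  (measurePreserving_mul_left u).lintegral_comp hf

theorem coe_neg_one_mul (x : Circle) : ((-1 * x : Circle) : ℂ) = -x := by
  simp

theorem arc_univ : arc Set.univ = ENNReal.ofReal (2 * Real.pi) := by
  rw [arc, Measure.map_apply measurable_exp MeasurableSet.univ, Set.preimage_univ,
    Measure.restrict_apply_univ, Real.volume_Ioc]
  congr 1
  ring

theorem norm_exp_sub_one_ge {t : ℝ} (ht : |t| ≤ Real.pi) :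
    2 / Real.pi * |t| ≤ ‖(Circle.exp t : ℂ) - 1‖ := by
  rw [Circle.coe_exp, mul_comm (t : ℂ) Complex.I, Complex.norm_exp_I_mul_ofReal_sub_one,
    Real.norm_eq_abs, abs_mul, abs_two]
  have h := Real.mul_abs_le_abs_sin (x := t / 2) (by rw [abs_div, abs_two]; linarith)
  rw [abs_div, abs_two] at h
  linarith

/-- A disc of radius `R` meets the circle in a set of length at most `2πR`. -/
theorem arc_ball_le (p : ℂ) (R : ℝ) :
    arc {x : Circle | ‖(x : ℂ) - p‖ < R} ≤ ENNReal.ofReal (2 * Real.pi * R) := by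
  by_cases hne : ∃ u : Circle, ‖(u : ℂ) - p‖ < R
  · obtain ⟨u, hu⟩ := hne
    have hR : 0 < R := (norm_nonneg _).trans_lt hu
    -- The disc may be centred anywhere, so it is enlarged to radius `2R` about a point `u` of the
    -- circle, and `u` is rotated to 1. There `|t|` is at most `π/2` times the chord length.
    have hm : MeasurableSet {x : Circle | ‖(x : ℂ) - 1‖ < 2 * R} :=
      measurableSet_lt (by fun_prop) (by fun_prop)
    calc arc {x : Circle | ‖(x : ℂ) - p‖ < R}
        ≤ arc ((fun x : Circle => u⁻¹ * x) ⁻¹' {x : Circle | ‖(x : ℂ) - 1‖ < 2 * R}) := by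
          refine measure_mono fun x hx => ?_
          simp only [Set.mem_ofPred_eq, Set.mem_preimage] at hx ⊢
          have : ((u⁻¹ * x : Circle) : ℂ) - 1 = (u⁻¹ : Circle) * ((x : ℂ) - u) := by
            rw [mul_sub]
            norm_cast
            simp
          rw [this, norm_mul, Circle.norm_coe, one_mul]
          calc ‖(x : ℂ) - u‖ = ‖((x : ℂ) - p) - (u - p)‖ := by ring_nf
            _ ≤ _ := norm_sub_le _ _
            _ < 2 * R := by linarith
      _ = arc {x : Circle | ‖(x : ℂ) - 1‖ < 2 * R} :=
          (measurePreserving_mul_left _).measure_preimage hm.nullMeasurableSet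
      _ ≤ volume (Set.Ioo (-(Real.pi * R)) (Real.pi * R)) := by
          rw [arc, Measure.map_apply measurable_exp hm,
            Measure.restrict_apply (measurable_exp hm)]
          refine measure_mono fun t ht => ?_
          obtain ⟨ht1, ht2⟩ := ht
          have ht1' : ‖(Circle.exp t : ℂ) - 1‖ < 2 * R := ht1
          have h := (norm_exp_sub_one_ge (abs_le.2 ⟨ht2.1.le, ht2.2⟩)).trans_lt ht1'
          have : |t| < Real.pi * R := by
            rw [div_mul_eq_mul_div, div_lt_iff₀ Real.pi_pos] at h
            linarith
          exact ⟨(abs_lt.1 this).1, (abs_lt.1 this).2⟩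
      _ = _ := by
          rw [Real.volume_Ioo]
          congr 1
          ring
  · push Not at hne
    have : {x : Circle | ‖(x : ℂ) - p‖ < R} = ∅ := by
      ext x
      simpa using hne x
    rw [this]
    simp

/-! ### The twofold convolution and its Jacobian. -/

/-- `|sin|` of the angle between two points of the circle. -/
def absSin (a b : Circle) : ℝ := |((a : ℂ) * (starRingEnd ℂ) b).im|

theorem measurable_absSin : Measurable fun p : Circle × Circle => absSin p.1 p.2 := by
  unfold absSin
  fun_prop

@[fun_prop]
theorem Measurable.absSin {α : Type*} [MeasurableSpace α] {f g : α → Circle} (hf : Measurable f)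
    (hg : Measurable g) : Measurable fun x => absSin (f x) (g x) :=
  measurable_absSin.comp (hf.prodMk hg)

theorem absSin_comm (a b : Circle) : absSin a b = absSin b a := by
  simp only [absSin, Complex.mul_im, Complex.conj_im, Complex.conj_re]
  rw [abs_eq_abs]
  right
  ring

theorem absSin_nonneg (a b : Circle) : 0 ≤ absSin a b := abs_nonneg _

/-- For unit vectors `conj(a + b) · ab = a + b`, so a nonzero sum determines the product. Both pairs
are then the roots of the same quadratic. -/
theorem add_eq_add_circle {a b c d : Circle} (h : (a : ℂ) + b = c + d) (h0 : (a : ℂ) + b ≠ 0) :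
    (a = c ∧ b = d) ∨ (a = d ∧ b = c) := by
  have conj_mul : ∀ x : Circle, (starRingEnd ℂ) (x : ℂ) * x = 1 := fun x => by
    rw [← Complex.normSq_eq_conj_mul_self]
    simp
  have key : ∀ x y : Circle, (starRingEnd ℂ) ((x : ℂ) + y) * (x * y) = x + y := fun x y => by
    rw [map_add]
    linear_combination (y : ℂ) * conj_mul x + (x : ℂ) * conj_mul y
  have hprod : (a : ℂ) * b = c * d := by
    have h1 := key a b
    have h2 := key c d
    rw [← h] at h2
    exact mul_left_cancel₀ ((map_ne_zero _).2 h0) (h1.trans h2.symm)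
  have hroot : ((a : ℂ) - c) * (a - d) = 0 := by
    linear_combination (a : ℂ) * h - hprod
  rcases mul_eq_zero.1 hroot with h1 | h1
  · left
    have h2 : (a : ℂ) = c := sub_eq_zero.1 h1
    refine ⟨Circle.ext h2, Circle.ext ?_⟩
    linear_combination h - h2
  · right
    have h2 : (a : ℂ) = d := sub_eq_zero.1 h1
    refine ⟨Circle.ext h2, Circle.ext ?_⟩
    linear_combination h - h2

/-- The map `(s, t) ↦ e^{is} + e^{it}` in real coordinates. -/
def sumMap (p : ℝ × ℝ) : ℝ × ℝ :=
  (Real.cos p.1 + Real.cos p.2, Real.sin p.1 + Real.sin p.2)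

def fderivSumMap (p : ℝ × ℝ) : ℝ × ℝ →L[ℝ] ℝ × ℝ :=
  (Matrix.toLin (.finTwoProd ℝ) (.finTwoProd ℝ)
    !![-Real.sin p.1, -Real.sin p.2; Real.cos p.1, Real.cos p.2]).toContinuousLinearMap

theorem hasFDerivAt_sumMap (p : ℝ × ℝ) : HasFDerivAt sumMap (fderivSumMap p) p := by
  unfold fderivSumMap
  rw [Matrix.toLin_finTwoProd_toContinuousLinearMap]
  exact HasFDerivAt.prodMk (𝕜 := ℝ)
    (((Real.hasDerivAt_cos p.1).comp_hasFDerivAt p hasFDerivAt_fst).add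
      ((Real.hasDerivAt_cos p.2).comp_hasFDerivAt p hasFDerivAt_snd))
    (((Real.hasDerivAt_sin p.1).comp_hasFDerivAt p hasFDerivAt_fst).add
      ((Real.hasDerivAt_sin p.2).comp_hasFDerivAt p hasFDerivAt_snd))

theorem det_fderivSumMap (p : ℝ × ℝ) : (fderivSumMap p).det = -Real.sin (p.1 - p.2) := by
  unfold fderivSumMap
  simp only [LinearMap.det_toContinuousLinearMap, LinearMap.det_toLin, Matrix.det_fin_two_of,
    Real.sin_sub]
  ring

theorem im_exp_mul_conj_exp (s t : ℝ) :
    ((Circle.exp s : ℂ) * (starRingEnd ℂ) (Circle.exp t)).im = Real.sin (s - t) := by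
  rw [← Circle.coe_inv_eq_conj, ← Circle.exp_neg, ← Circle.coe_mul, ← Circle.exp_add,
    Circle.coe_exp, ← sub_eq_add_neg, Complex.exp_ofReal_mul_I_im]

theorem exp_add_exp_eq (p : ℝ × ℝ) :
    (Circle.exp p.1 : ℂ) + Circle.exp p.2 = Complex.measurableEquivRealProd.symm (sumMap p) := by
  apply Complex.ext <;>
  simp [sumMap, Circle.coe_exp, Complex.exp_ofReal_mul_I_im, Complex.exp_ofReal_mul_I_re]

/-- The only ambiguity in a nonzero sum is the exchange of the two points, which reverses the sign
of `sin (s - t)`. A zero sum is excluded because the sine vanishes there. -/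
theorem injOn_sumMap {σ : ℝ} :
    Set.InjOn sumMap {p | p ∈ Set.Ioc (-Real.pi) Real.pi ×ˢ Set.Ioc (-Real.pi) Real.pi ∧
      0 < σ * Real.sin (p.1 - p.2)} := by
  rintro p ⟨hp, hps⟩ q ⟨hq, hqs⟩ hpq
  have h : (Circle.exp p.1 : ℂ) + Circle.exp p.2 = Circle.exp q.1 + Circle.exp q.2 := by
    rw [exp_add_exp_eq, exp_add_exp_eq, hpq]
  have h0 : (Circle.exp p.1 : ℂ) + Circle.exp p.2 ≠ 0 := by
    intro h0
    have h1 : (Circle.exp p.1 : ℂ) = -Circle.exp p.2 := eq_neg_of_add_eq_zero_left h0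
    rw [← im_exp_mul_conj_exp, h1, neg_mul, Complex.mul_conj] at hps
    simp at hps
  have inj : ∀ s ∈ Set.Ioc (-Real.pi) Real.pi, ∀ t ∈ Set.Ioc (-Real.pi) Real.pi,
      Circle.exp s = Circle.exp t → s = t := fun s hs t ht e => by
    rw [← Circle.arg_exp hs.1 hs.2, e, Circle.arg_exp ht.1 ht.2]
  rcases add_eq_add_circle h h0 with ⟨h1, h2⟩ | ⟨h1, h2⟩
  · exact Prod.ext (inj _ hp.1 _ hq.1 h1) (inj _ hp.2 _ hq.2 h2)
  · have h1' := inj _ hp.1 _ hq.2 h1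
    have h2' := inj _ hp.2 _ hq.1 h2
    rw [h1', h2', ← neg_sub, Real.sin_neg] at hps
    nlinarith

theorem measurableSet_angle (σ : ℝ) :
    MeasurableSet {p : ℝ × ℝ | p ∈ Set.Ioc (-Real.pi) Real.pi ×ˢ Set.Ioc (-Real.pi) Real.pi ∧
      0 < σ * Real.sin (p.1 - p.2)} := by
  have h : Measurable fun p : ℝ × ℝ => σ * Real.sin (p.1 - p.2) := by fun_prop
  exact (measurableSet_Ioc.prod measurableSet_Ioc).inter (measurableSet_lt measurable_const h)

/-- Change of variables: `|sin (s - t)|` is the Jacobian of `sumMap`, and the image lies in `N`. -/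
theorem lintegral_absSin_aux {N : Set (ℝ × ℝ)} (hN : MeasurableSet N) (σ : ℝ) :
    ∫⁻ p in {p | p ∈ Set.Ioc (-Real.pi) Real.pi ×ˢ Set.Ioc (-Real.pi) Real.pi ∧
      0 < σ * Real.sin (p.1 - p.2)} ∩ sumMap ⁻¹' N, ENNReal.ofReal |Real.sin (p.1 - p.2)|
      ≤ volume N := by
  have hc : Measurable sumMap := by unfold sumMap; fun_prop
  have hm : MeasurableSet ({p : ℝ × ℝ | p ∈ Set.Ioc (-Real.pi) Real.pi ×ˢ
      Set.Ioc (-Real.pi) Real.pi ∧ 0 < σ * Real.sin (p.1 - p.2)} ∩ sumMap ⁻¹' N) :=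
    measurableSet_angle σ |>.inter (hc hN)
  have h := lintegral_image_eq_lintegral_abs_det_fderiv_mul volume hm
    (fun p _ => (hasFDerivAt_sumMap p).hasFDerivWithinAt)
    ((injOn_sumMap (σ := σ)).mono Set.inter_subset_left) (fun _ => 1)
  simp only [det_fderivSumMap, abs_neg, mul_one, lintegral_const, one_mul,
    Measure.restrict_apply_univ] at h
  rw [← h]
  refine measure_mono ?_
  rintro _ ⟨p, hp, rfl⟩
  exact hp.2

/-- The image of `|sin(s - t)| ds dt` under `(s, t) ↦ e^{is} + e^{it}` is at most twice Lebesgue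
measure. -/
theorem lintegral_absSin_mul_indicator_le {N : Set ℂ} (hN : MeasurableSet N) :
    ∫⁻ a, ∫⁻ b, ENNReal.ofReal (absSin a b) * N.indicator 1 ((a : ℂ) + b) ∂arc ∂arc
      ≤ 2 * volume N := by
  set I := Set.Ioc (-Real.pi) Real.pi
  set N' : Set (ℝ × ℝ) := Complex.measurableEquivRealProd.symm ⁻¹' N
  have hN' : MeasurableSet N' := Complex.measurableEquivRealProd.symm.measurable hN
  have hvol : volume N' = volume N :=
    Complex.volume_preserving_equiv_real_prod.symm.measure_preimage hN.nullMeasurableSet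
  have hind : Measurable (N.indicator (1 : ℂ → ℝ≥0∞)) := measurable_one.indicator hN
  have hf : Measurable fun q : Circle × Circle =>
      ENNReal.ofReal (absSin q.1 q.2) * N.indicator 1 ((q.1 : ℂ) + q.2) := by
    refine (by fun_prop : Measurable _).mul (hind.comp (by fun_prop))
  have hR : MeasurableSet (I ×ˢ I) := measurableSet_Ioc.prod measurableSet_Ioc
  have hQ : ∀ σ : ℝ, MeasurableSet ({p : ℝ × ℝ | p ∈ I ×ˢ I ∧ 0 < σ * Real.sin (p.1 - p.2)} ∩
      sumMap ⁻¹' N') := fun σ =>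
    (measurableSet_angle σ).inter ((by unfold sumMap; fun_prop : Measurable sumMap) hN')
  calc ∫⁻ a, ∫⁻ b, ENNReal.ofReal (absSin a b) * N.indicator 1 ((a : ℂ) + b) ∂arc ∂arc
      = ∫⁻ s in I, ∫⁻ t in I, ENNReal.ofReal (absSin (Circle.exp s) (Circle.exp t)) *
          N.indicator 1 ((Circle.exp s : ℂ) + Circle.exp t) := by
        rw [lintegral_arc (Measurable.lintegral_prod_right' hf)]
        refine lintegral_congr fun s => ?_
        exact lintegral_arc (hf.comp (measurable_const.prodMk measurable_id))
    _ = ∫⁻ p in I ×ˢ I, ENNReal.ofReal (absSin (Circle.exp p.1) (Circle.exp p.2)) *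
          N.indicator 1 ((Circle.exp p.1 : ℂ) + Circle.exp p.2) := by
        rw [Measure.volume_eq_prod, ← Measure.prod_restrict, lintegral_prod]
        exact (hf.comp ((measurable_exp.comp measurable_fst).prodMk
          (measurable_exp.comp measurable_snd))).aemeasurable
    -- The two signs of the sine give two regions of injectivity, hence the factor 2; the integrand
    -- vanishes where the sine does.
    _ ≤ ∫⁻ p in ({p | p ∈ I ×ˢ I ∧ 0 < 1 * Real.sin (p.1 - p.2)} ∩ sumMap ⁻¹' N') ∪
          ({p | p ∈ I ×ˢ I ∧ 0 < (-1) * Real.sin (p.1 - p.2)} ∩ sumMap ⁻¹' N'),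
          ENNReal.ofReal |Real.sin (p.1 - p.2)| := by
        rw [← lintegral_indicator hR, ← lintegral_indicator ((hQ 1).union (hQ (-1)))]
        refine lintegral_mono fun p => ?_
        by_cases hp : p ∈ I ×ˢ I
        · rw [Set.indicator_of_mem hp]
          simp only [absSin, im_exp_mul_conj_exp]
          by_cases hpN : (Circle.exp p.1 : ℂ) + Circle.exp p.2 ∈ N
          · have hpN' : p ∈ sumMap ⁻¹' N' := by
              change Complex.measurableEquivRealProd.symm (sumMap p) ∈ N
              rwa [← exp_add_exp_eq]
            rw [Set.indicator_of_mem hpN, Pi.one_apply, mul_one]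
            rcases lt_trichotomy (Real.sin (p.1 - p.2)) 0 with h | h | h
            · rw [Set.indicator_of_mem]
              exact Or.inr ⟨⟨hp, by linarith⟩, hpN'⟩
            · simp [h]
            · rw [Set.indicator_of_mem]
              exact Or.inl ⟨⟨hp, by linarith⟩, hpN'⟩
          · rw [Set.indicator_of_notMem hpN, mul_zero]
            exact zero_le
        · simp [Set.indicator_of_notMem hp]
    _ ≤ _ := lintegral_union_le _ _ _
    _ ≤ volume N' + volume N' :=
        add_le_add (lintegral_absSin_aux hN' 1) (lintegral_absSin_aux hN' (-1))
    _ = 2 * volume N := by rw [hvol, two_mul]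

/-- For unit vectors `a² - b² = ab (a b̄ - b ā) = ab · 2i Im (a b̄)`. -/
theorem absSin_eq (a b : Circle) : absSin a b = ‖(a : ℂ) - b‖ * ‖(a : ℂ) + b‖ / 2 := by
  have conj_mul : ∀ x : Circle, (starRingEnd ℂ) (x : ℂ) * x = 1 := fun x => by
    rw [← Complex.normSq_eq_conj_mul_self]
    simp
  have h : ((a : ℂ) - b) * (a + b) =
      a * b * (((2 * ((a : ℂ) * (starRingEnd ℂ) b).im : ℝ) : ℂ) * Complex.I) := by
    rw [← Complex.sub_conj, map_mul, Complex.conj_conj]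
    linear_combination -(a : ℂ) ^ 2 * conj_mul b + (b : ℂ) ^ 2 * conj_mul a
  rw [← norm_mul, h]
  simp only [norm_mul, Circle.norm_coe, Complex.norm_I, Complex.norm_real, Real.norm_eq_abs,
    abs_two, absSin]
  ring

instance : NullSingletonClass arc := by
  refine ⟨fun u => ?_⟩
  have h : ∀ R : ℝ, 0 < R → arc {u} ≤ ENNReal.ofReal (2 * Real.pi * R) := fun R hR =>
    (measure_mono (by rintro x rfl; simpa using hR)).trans (arc_ball_le u R)
  have h2 : Tendsto (fun R : ℝ => ENNReal.ofReal (2 * Real.pi * R)) (𝓝[>] 0) (𝓝 0) := by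
    have : Tendsto (fun R : ℝ => ENNReal.ofReal (2 * Real.pi * R)) (𝓝 0)
        (𝓝 (ENNReal.ofReal (2 * Real.pi * 0))) :=
      (ENNReal.continuous_ofReal.comp (by fun_prop)).tendsto _
    rw [mul_zero, ENNReal.ofReal_zero] at this
    exact this.mono_left nhdsWithin_le_nhds
  exact le_antisymm (ge_of_tendsto h2 (by
    filter_upwards [self_mem_nhdsWithin] with R hR using h R hR)) zero_le

theorem ae_absSin_ne_zero (a : Circle) : ∀ᵐ b ∂arc, absSin a b ≠ 0 := by
  have : {b | absSin a b = 0} ⊆ {a, -1 * a} := by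
    intro b hb
    have hb' : absSin a b = 0 := hb
    rw [absSin_eq, div_eq_zero_iff, mul_eq_zero, norm_eq_zero, norm_eq_zero] at hb'
    rcases hb' with (h | h) | h
    · exact Or.inl (Circle.ext (sub_eq_zero.1 h).symm)
    · refine Or.inr (Circle.ext ?_)
      rw [coe_neg_one_mul]
      linear_combination h
    · norm_num at h
  rw [ae_iff]
  simp only [not_not]
  exact measure_mono_null this ((Set.toFinite _).measure_zero _)

/-- Transversal pairs have a convolution of density at most `2/ε`: there the indicator is at most
the Jacobian divided by `ε`. -/
theorem lintegral_indicator_add_of_le {N : Set ℂ} (hN : MeasurableSet N) {ε : ℝ} (hε : 0 < ε) :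
    ∫⁻ a, ∫⁻ b, {p : Circle × Circle | ε ≤ absSin p.1 p.2}.indicator 1 (a, b) *
      N.indicator 1 ((a : ℂ) + b) ∂arc ∂arc ≤ ENNReal.ofReal (2 / ε) * volume N := by
  have hle : ∀ a b : Circle, {p : Circle × Circle | ε ≤ absSin p.1 p.2}.indicator 1 (a, b) ≤
      ENNReal.ofReal (1 / ε) * ENNReal.ofReal (absSin a b) := fun a b => by
    by_cases h : ε ≤ absSin a b
    · rw [Set.indicator_of_mem (by exact h), Pi.one_apply, ← ENNReal.ofReal_mul (by positivity),
        ← ENNReal.ofReal_one]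
      apply ENNReal.ofReal_le_ofReal
      rw [one_div, inv_mul_eq_div, le_div_iff₀ hε]
      linarith
    · rw [Set.indicator_of_notMem (by exact h)]
      exact zero_le
  calc _ ≤ ∫⁻ a, ∫⁻ b, ENNReal.ofReal (1 / ε) * (ENNReal.ofReal (absSin a b) *
        N.indicator 1 ((a : ℂ) + b)) ∂arc ∂arc := by
        refine lintegral_mono fun a => lintegral_mono fun b => ?_
        simp only []
        rw [← mul_assoc]
        exact mul_le_mul_left (hle a b) _
    _ = ENNReal.ofReal (1 / ε) * ∫⁻ a, ∫⁻ b, (ENNReal.ofReal (absSin a b) *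
        N.indicator 1 ((a : ℂ) + b)) ∂arc ∂arc := by
        rw [← lintegral_const_mul' _ _ ENNReal.ofReal_ne_top]
        refine lintegral_congr fun a => ?_
        rw [← lintegral_const_mul' _ _ ENNReal.ofReal_ne_top]
    _ ≤ ENNReal.ofReal (1 / ε) * (2 * volume N) :=
        mul_le_mul_right (lintegral_absSin_mul_indicator_le hN) _
    _ = _ := by
        rw [← mul_assoc, show (2 : ℝ≥0∞) = ENNReal.ofReal 2 by simp,
          ← ENNReal.ofReal_mul (by positivity)]
        congr 2
        ring

/-- The convolution square of arc length is absolutely continuous. -/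
theorem ae_add_notMem {N : Set ℂ} (hN : volume N = 0) :
    ∀ᵐ p ∂(arc.prod arc), (p.1 : ℂ) + p.2 ∉ N := by
  set M := toMeasurable volume N
  have hM : MeasurableSet M := measurableSet_toMeasurable _ _
  have hM0 : volume M = 0 := by rw [measure_toMeasurable, hN]
  have h := lintegral_absSin_mul_indicator_le hM
  rw [hM0, mul_zero] at h
  have hind : Measurable (M.indicator (1 : ℂ → ℝ≥0∞)) := measurable_one.indicator hM
  have hf : Measurable fun q : Circle × Circle =>
      ENNReal.ofReal (absSin q.1 q.2) * M.indicator 1 ((q.1 : ℂ) + q.2) :=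
    (by fun_prop : Measurable _).mul (hind.comp (by fun_prop))
  rw [← lintegral_prod (fun q : Circle × Circle =>
      ENNReal.ofReal (absSin q.1 q.2) * M.indicator 1 ((q.1 : ℂ) + q.2)) hf.aemeasurable,
    nonpos_iff_eq_zero, lintegral_eq_zero_iff hf] at h
  have h1 : ∀ᵐ p ∂(arc.prod arc), absSin p.1 p.2 ≠ 0 := by
    have hm : MeasurableSet {p : Circle × Circle | absSin p.1 p.2 ≠ 0} :=
      measurable_absSin (measurableSet_singleton (0 : ℝ)).compl
    rw [Measure.ae_prod_iff_ae_ae hm]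
    exact Eventually.of_forall ae_absSin_ne_zero
  filter_upwards [h, h1] with p hp hp1 hpN
  have hpM : (p.1 : ℂ) + p.2 ∈ M := subset_toMeasurable _ _ hpN
  simp only [Pi.zero_apply, mul_eq_zero, Set.indicator_of_mem hpM, Pi.one_apply, one_ne_zero,
    or_false, ENNReal.ofReal_eq_zero] at hp
  exact hp1 (le_antisymm hp (absSin_nonneg _ _))

/-! ### Geometry of three unit vectors. -/

/-- The weight that cancels the logarithmic singularity of the threefold convolution of arc
length on the unit circle. -/
def wt (z : ℂ) : ℝ := |‖z‖ ^ 2 - 1|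

theorem wt_nonneg (z : ℂ) : 0 ≤ wt z := abs_nonneg _

@[fun_prop]
theorem measurable_wt : Measurable wt := by
  unfold wt
  fun_prop

theorem conj_coe_mul_self (x : Circle) : (starRingEnd ℂ) (x : ℂ) * x = 1 := by
  rw [← Complex.normSq_eq_conj_mul_self]
  simp

/-- Since `conj a = 1/a` on the circle, `|S|² - 1 = (a+b+c)(1/a+1/b+1/c) - 1 =
(a+b)(b+c)(c+a)/(abc)`. -/
theorem wt_add_add (a b c : Circle) :
    wt ((a : ℂ) + b + c) = ‖(a : ℂ) + b‖ * ‖(b : ℂ) + c‖ * ‖(a : ℂ) + c‖ := by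
  have h : ((a : ℂ) + b) * (b + c) * (a + c) =
      a * b * c * (((‖(a : ℂ) + b + c‖ ^ 2 - 1 : ℝ)) : ℂ) := by
    push_cast
    rw [← Complex.conj_mul']
    simp only [map_add]
    linear_combination (-(a : ℂ) - b - c) * (b * c * conj_coe_mul_self a +
      a * c * conj_coe_mul_self b + a * b * conj_coe_mul_self c)
  rw [← norm_mul, ← norm_mul, h]
  rw [norm_mul, norm_mul, norm_mul, Circle.norm_coe, Circle.norm_coe, Circle.norm_coe,
    Complex.norm_real, Real.norm_eq_abs, wt, one_mul, one_mul, one_mul]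

/-- The defect `9 - |S|²` from the maximal value measures how far apart the three points are. It
governs the second degeneracy, where the points merge near `S/3`. -/
theorem sum_sq_norm_sub (a b c : Circle) :
    ‖(a : ℂ) - b‖ ^ 2 + ‖(b : ℂ) - c‖ ^ 2 + ‖(a : ℂ) - c‖ ^ 2 =
      9 - ‖(a : ℂ) + b + c‖ ^ 2 := by
  have ha := Circle.normSq_coe a
  have hb := Circle.normSq_coe b
  have hc := Circle.normSq_coe c
  simp only [← Complex.normSq_eq_norm_sq, Complex.normSq_apply, Complex.sub_re, Complex.sub_im,
    Complex.add_re, Complex.add_im] at *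
  linear_combination 3 * ha + 3 * hb + 3 * hc

theorem norm_three_mul_sub_sq_le (a b c : Circle) :
    ‖3 * (a : ℂ) - (a + b + c)‖ ^ 2 ≤ 2 * (9 - ‖(a : ℂ) + b + c‖ ^ 2) := by
  rw [← sum_sq_norm_sub]
  have h : ‖3 * (a : ℂ) - (a + b + c)‖ ≤ ‖(a : ℂ) - b‖ + ‖(a : ℂ) - c‖ := by
    rw [show 3 * (a : ℂ) - (a + b + c) = (a - b) + (a - c) by ring]
    exact norm_add_le _ _
  nlinarith [norm_nonneg (3 * (a : ℂ) - (a + b + c)), sq_nonneg (‖(a : ℂ) - b‖ - ‖(a : ℂ) - c‖),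
    sq_nonneg ‖(b : ℂ) - c‖, norm_nonneg ((a : ℂ) - b), norm_nonneg ((a : ℂ) - c)]

theorem norm_add_coe_le (a b : Circle) : ‖(a : ℂ) + b‖ ≤ 2 := by
  refine (norm_add_le _ _).trans ?_
  rw [Circle.norm_coe, Circle.norm_coe]
  norm_num

theorem norm_add_add_coe_le (a b c : Circle) : ‖(a : ℂ) + b + c‖ ≤ 3 := by
  refine (norm_add_le _ _).trans ?_
  have := norm_add_coe_le a b
  rw [Circle.norm_coe]
  linarith

/-- The weight contains the factor `|a + b|`, so it controls antipodal pairs; a lower bound on `|a -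
b|` supplies the other factor of `absSin a b`. The remaining two factors of the weight are at most 2
each. -/
theorem wt_mul_le_of_le_norm_sub {a b c : Circle} {m : ℝ} (h : m ≤ ‖(a : ℂ) - b‖) :
    wt ((a : ℂ) + b + c) * m ≤ 8 * absSin a b := by
  rw [wt_add_add, absSin_eq]
  have h1 := norm_add_coe_le b c
  have h2 := norm_add_coe_le a c
  have h3 : ‖(b : ℂ) + c‖ * ‖(a : ℂ) + c‖ ≤ 2 * 2 := by gcongr
  have h4 : ‖(b : ℂ) + c‖ * ‖(a : ℂ) + c‖ * m ≤ 4 * ‖(a : ℂ) - b‖ := by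
    calc _ ≤ ‖(b : ℂ) + c‖ * ‖(a : ℂ) + c‖ * ‖(a : ℂ) - b‖ := by gcongr
      _ ≤ _ := by
        have := mul_le_mul_of_nonneg_right h3 (norm_nonneg ((a : ℂ) - b))
        linarith
  have := mul_le_mul_of_nonneg_left h4 (norm_nonneg ((a : ℂ) + b))
  nlinarith

/-- Two of three unit vectors with sum `S` are transversal, quantitatively. -/
theorem wt_mul_sqrt_le {a b c : Circle} {q : ℝ} (hq : q ≤ 2 * (9 - ‖(a : ℂ) + b + c‖ ^ 2)) :
    wt ((a : ℂ) + b + c) * √q ≤ 24 * (absSin b c + absSin a c + absSin a b) := by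
  rcases le_or_gt q 0 with h0 | h0
  · rw [Real.sqrt_eq_zero_of_nonpos h0, mul_zero]
    have := absSin_nonneg a b
    have := absSin_nonneg b c
    have := absSin_nonneg a c
    positivity
  -- The three squared differences add up to at least `q/2`, so one of them is at least `q/6 ≥
  -- (√q/3)²`. The constant 24 is `3 · 8`.
  have key : ∀ t : ℝ, 0 ≤ t → q / 6 ≤ t ^ 2 → √q / 3 ≤ t := fun t ht h => by
    refine abs_le_of_sq_le_sq' ?_ ht |>.2
    rw [div_pow, Real.sq_sqrt h0.le]
    linarith
  have hsum := sum_sq_norm_sub a b c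
  have hab := absSin_nonneg a b
  have hbc := absSin_nonneg b c
  have hac := absSin_nonneg a c
  by_cases h1 : q / 6 ≤ ‖(a : ℂ) - b‖ ^ 2
  · have := wt_mul_le_of_le_norm_sub (c := c) (key _ (norm_nonneg _) h1)
    linarith
  by_cases h2 : q / 6 ≤ ‖(b : ℂ) - c‖ ^ 2
  · have := wt_mul_le_of_le_norm_sub (c := a) (key _ (norm_nonneg _) h2)
    rw [show (b : ℂ) + c + a = a + b + c by ring] at this
    linarith
  have h3 : q / 6 ≤ ‖(a : ℂ) - c‖ ^ 2 := by linarith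
  have := wt_mul_le_of_le_norm_sub (c := b) (key _ (norm_nonneg _) h3)
  rw [show (a : ℂ) + c + b = a + b + c by ring] at this
  linarith

theorem abs_norm_sq_sub_le {x S : ℂ} {r : ℝ} (hr1 : r ≤ 1) (hS : ‖S‖ ≤ 3)
    (h : ‖S - x‖ < r) : |‖S‖ ^ 2 - ‖x‖ ^ 2| ≤ 7 * r := by
  have h1 : |‖S‖ - ‖x‖| ≤ r := (abs_norm_sub_norm_le S x).trans h.le
  have h2 : ‖x‖ ≤ 4 := by linarith [(abs_le.1 h1).1]
  rw [sq_sub_sq, abs_mul, abs_of_nonneg (add_nonneg (norm_nonneg S) (norm_nonneg x))]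
  exact mul_le_mul (by linarith) h1 (abs_nonneg _) (by norm_num)

theorem wt_le_eight {S : ℂ} (hS : ‖S‖ ≤ 3) : wt S ≤ 8 := by
  rw [wt, abs_le]
  constructor <;> nlinarith [norm_nonneg S]

/-- If `S` is near `x` and `9 - |S|²` is small, each of the three points lies near `x/3`, because
`3a - S = (a - b) + (a - c)`. -/
theorem norm_sub_third_lt {a b c : Circle} {x : ℂ} {r q R : ℝ}
    (hx : ‖(a : ℂ) + b + c - x‖ < r) (hq : 2 * (9 - ‖(a : ℂ) + b + c‖ ^ 2) ≤ q ^ 2) (hq0 : 0 ≤ q)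
    (hR : q + r ≤ 3 * R) : ‖(a : ℂ) - x / 3‖ < R := by
  have h1 : ‖3 * (a : ℂ) - (a + b + c)‖ ≤ q :=
    abs_le_of_sq_le_sq' ((norm_three_mul_sub_sq_le a b c).trans hq) hq0 |>.2
  have h2 : ‖3 * ((a : ℂ) - x / 3)‖ < 3 * R := by
    calc ‖3 * ((a : ℂ) - x / 3)‖ = ‖(3 * (a : ℂ) - (a + b + c)) + (a + b + c - x)‖ := by ring_nf
      _ ≤ _ := norm_add_le _ _
      _ < q + r := by linarith
      _ ≤ _ := hR
  rw [norm_mul, Complex.norm_ofNat] at h2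
  linarith

/-! ### Bounded density of the weighted threefold convolution. -/

theorem lintegral_perm_213 {h : Circle → Circle → Circle → ℝ≥0∞}
    (hh : Measurable fun p : Circle × Circle × Circle => h p.1 p.2.1 p.2.2) :
    ∫⁻ a, ∫⁻ b, ∫⁻ c, h b a c ∂arc ∂arc ∂arc = ∫⁻ a, ∫⁻ b, ∫⁻ c, h a b c ∂arc ∂arc ∂arc := by
  rw [lintegral_lintegral_swap]
  refine (Measurable.lintegral_prod_right'
    (f := fun q : (Circle × Circle) × Circle => h q.1.2 q.1.1 q.2) ?_).aemeasurable
  exact hh.comp (by fun_prop : Measurable fun q : (Circle × Circle) × Circle =>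
    (q.1.2, q.1.1, q.2))

theorem lintegral_perm_312 {h : Circle → Circle → Circle → ℝ≥0∞}
    (hh : Measurable fun p : Circle × Circle × Circle => h p.1 p.2.1 p.2.2) :
    ∫⁻ a, ∫⁻ b, ∫⁻ c, h c a b ∂arc ∂arc ∂arc = ∫⁻ a, ∫⁻ b, ∫⁻ c, h a b c ∂arc ∂arc ∂arc := by
  rw [← lintegral_perm_213 hh]
  refine lintegral_congr fun a => lintegral_lintegral_swap ?_
  exact (hh.comp (by fun_prop : Measurable fun q : Circle × Circle =>
    (q.2, a, q.1))).aemeasurable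

theorem lintegral_arc_one_ball_le (p : ℂ) (R : ℝ) :
    ∫⁻ a, {u : Circle | ‖(u : ℂ) - p‖ < R}.indicator 1 a ∂arc
      ≤ ENNReal.ofReal (2 * Real.pi * R) := by
  rw [lintegral_indicator_one (measurableSet_lt (by fun_prop) (by fun_prop))]
  exact arc_ball_le p R

theorem volume_ball_eq (x : ℂ) {r : ℝ} (hr : 0 ≤ r) :
    volume (Metric.ball x r) = ENNReal.ofReal (Real.pi * r ^ 2) := by
  rw [Complex.volume_ball, ENNReal.ofReal_mul Real.pi_pos.le, ENNReal.ofReal_pow hr, mul_comm]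
  congr 1
  exact (ENNReal.ofReal_eq_coe_nnreal Real.pi_pos.le).symm

theorem ball_indicator_add (x y : ℂ) (z : ℂ) (r : ℝ) :
    (Metric.ball x r).indicator (1 : ℂ → ℝ≥0∞) (y + z) =
      (Metric.ball (x - y) r).indicator 1 z := by
  have : y + z ∈ Metric.ball x r ↔ z ∈ Metric.ball (x - y) r := by
    rw [mem_ball_iff_norm, mem_ball_iff_norm]
    ring_nf
  by_cases h : y + z ∈ Metric.ball x r
  · rw [Set.indicator_of_mem h, Set.indicator_of_mem (this.1 h)]
    rfl
  · rw [Set.indicator_of_notMem h, Set.indicator_of_notMem (this.not.1 h)]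

theorem ball_indicator_coe (x : ℂ) (u : Circle) (r : ℝ) :
    (Metric.ball x r).indicator (1 : ℂ → ℝ≥0∞) u =
      {u : Circle | ‖(u : ℂ) - x‖ < r}.indicator 1 u := by
  by_cases h : ‖(u : ℂ) - x‖ < r
  · rw [Set.indicator_of_mem (by rwa [mem_ball_iff_norm]), Set.indicator_of_mem (by exact h)]
    rfl
  · rw [Set.indicator_of_notMem (by rwa [mem_ball_iff_norm]), Set.indicator_of_notMem (by exact h)]

/-- The integrand of the localized transversal part of the threefold convolution. -/
def locAbsSin (x : ℂ) (r R : ℝ) (a b c : Circle) : ℝ≥0∞ :=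
  {u : Circle | ‖(u : ℂ) - x / 3‖ < R}.indicator 1 a *
    (ENNReal.ofReal (absSin b c) * (Metric.ball x r).indicator 1 ((a : ℂ) + b + c))

theorem measurable_ball_indicator (x : ℂ) (r : ℝ) :
    Measurable ((Metric.ball x r).indicator (1 : ℂ → ℝ≥0∞)) :=
  measurable_one.indicator Metric.isOpen_ball.measurableSet

theorem measurable_arc_indicator (p : ℂ) (R : ℝ) :
    Measurable ({u : Circle | ‖(u : ℂ) - p‖ < R}.indicator (1 : Circle → ℝ≥0∞)) :=
  measurable_one.indicator (measurableSet_lt (by fun_prop) (by fun_prop))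

theorem measurable_locAbsSin (x : ℂ) (r R : ℝ) :
    Measurable fun p : Circle × Circle × Circle => locAbsSin x r R p.1 p.2.1 p.2.2 := by
  unfold locAbsSin
  exact ((measurable_arc_indicator _ _).comp measurable_fst).mul
    ((by fun_prop : Measurable _).mul ((measurable_ball_indicator x r).comp (by fun_prop)))

/-- For fixed `a` the pair `(b, c)`, weighted by its Jacobian, contributes at most `2πr²`; the point
`a` is confined to a set of length `2πR`. -/
theorem lintegral_locAbsSin_le (x : ℂ) {r R : ℝ} (hr : 0 ≤ r) (hR : 0 ≤ R) :
    ∫⁻ a, ∫⁻ b, ∫⁻ c, locAbsSin x r R a b c ∂arc ∂arc ∂arc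
      ≤ ENNReal.ofReal (4 * Real.pi ^ 2 * R * r ^ 2) := by
  have h1 : ∀ a : Circle, ∫⁻ b, ∫⁻ c, locAbsSin x r R a b c ∂arc ∂arc ≤
      {u : Circle | ‖(u : ℂ) - x / 3‖ < R}.indicator 1 a *
        ENNReal.ofReal (2 * (Real.pi * r ^ 2)) := fun a => by
    have hne : ({u : Circle | ‖(u : ℂ) - x / 3‖ < R}.indicator 1 a : ℝ≥0∞) ≠ ⊤ :=
      ((Set.indicator_le_self' (fun _ _ => zero_le) a).trans_lt
        (by simp : (1 : Circle → ℝ≥0∞) a < ⊤)).ne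
    unfold locAbsSin
    calc _ = {u : Circle | ‖(u : ℂ) - x / 3‖ < R}.indicator 1 a *
          ∫⁻ b, ∫⁻ c, ENNReal.ofReal (absSin b c) *
            (Metric.ball (x - a) r).indicator 1 ((b : ℂ) + c) ∂arc ∂arc := by
          rw [← lintegral_const_mul' _ _ hne]
          refine lintegral_congr fun b => ?_
          rw [← lintegral_const_mul' _ _ hne]
          refine lintegral_congr fun c => ?_
          rw [add_assoc, ball_indicator_add]
      _ ≤ _ := by
          refine mul_le_mul_right ((lintegral_absSin_mul_indicator_le
            Metric.isOpen_ball.measurableSet).trans_eq ?_) _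
          rw [volume_ball_eq _ hr, ENNReal.ofReal_mul zero_le_two]
          simp
  calc _ ≤ ∫⁻ a, {u : Circle | ‖(u : ℂ) - x / 3‖ < R}.indicator 1 a *
        ENNReal.ofReal (2 * (Real.pi * r ^ 2)) ∂arc := lintegral_mono h1
    _ ≤ ENNReal.ofReal (2 * Real.pi * R) * ENNReal.ofReal (2 * (Real.pi * r ^ 2)) := by
        rw [lintegral_mul_const' _ _ ENNReal.ofReal_ne_top]
        exact mul_le_mul_left (lintegral_arc_one_ball_le _ _) _
    _ = _ := by
        rw [← ENNReal.ofReal_mul (by positivity)]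
        congr 1
        ring

/-- No transversality is used: each of `a`, `b` contributes `2πR`, and `c` lies in a disc of radius
`r` once they are fixed. -/
theorem lintegral_loc_le (x : ℂ) {r R : ℝ} (hR : 0 ≤ R) :
    ∫⁻ a, ∫⁻ b, ∫⁻ c, {u : Circle | ‖(u : ℂ) - x / 3‖ < R}.indicator 1 a *
      ({u : Circle | ‖(u : ℂ) - x / 3‖ < R}.indicator 1 b *
        (Metric.ball x r).indicator 1 ((a : ℂ) + b + c)) ∂arc ∂arc ∂arc
      ≤ ENNReal.ofReal (8 * Real.pi ^ 3 * R ^ 2 * r) := by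
  have hne : ∀ a, ({u : Circle | ‖(u : ℂ) - x / 3‖ < R}.indicator 1 a : ℝ≥0∞) ≠ ⊤ := fun a =>
      ((Set.indicator_le_self' (fun _ _ => zero_le) a).trans_lt
        (by simp : (1 : Circle → ℝ≥0∞) a < ⊤)).ne
  have hball : ∀ a b : Circle, ∫⁻ c : Circle, (Metric.ball x r).indicator 1 ((a : ℂ) + b + c) ∂arc
      ≤ ENNReal.ofReal (2 * Real.pi * r) := fun a b => by
    refine le_of_eq_of_le (lintegral_congr fun c => ?_)
      (lintegral_arc_one_ball_le (x - (a + b)) r)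
    rw [ball_indicator_add]
    exact ball_indicator_coe _ _ _
  calc _ ≤ ∫⁻ a, {u : Circle | ‖(u : ℂ) - x / 3‖ < R}.indicator 1 a *
        ∫⁻ b, {u : Circle | ‖(u : ℂ) - x / 3‖ < R}.indicator 1 b *
          ENNReal.ofReal (2 * Real.pi * r) ∂arc ∂arc := by
        refine lintegral_mono fun a => ?_
        simp only []
        rw [← lintegral_const_mul' _ _ (hne a)]
        refine lintegral_mono fun b => ?_
        simp only []
        rw [lintegral_const_mul' _ _ (hne a), lintegral_const_mul' _ _ (hne b)]
        gcongr
        exact hball a b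
    _ ≤ ENNReal.ofReal (2 * Real.pi * R) * (ENNReal.ofReal (2 * Real.pi * R) *
          ENNReal.ofReal (2 * Real.pi * r)) := by
        rw [lintegral_mul_const' _ _ ENNReal.ofReal_ne_top, lintegral_mul_const'
          _ _ (ENNReal.mul_ne_top ((lintegral_arc_one_ball_le _ _).trans_lt
            ENNReal.ofReal_lt_top).ne ENNReal.ofReal_ne_top)]
        gcongr
        · exact lintegral_arc_one_ball_le _ _
        · exact lintegral_arc_one_ball_le _ _
    _ = _ := by
        rw [← ENNReal.ofReal_mul (by positivity), ← ENNReal.ofReal_mul (by positivity)]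
        congr 1
        ring

theorem indicator_ball_eq_one {x z : ℂ} {r : ℝ} (h : ‖z - x‖ < r) :
    (Metric.ball x r).indicator (1 : ℂ → ℝ≥0∞) z = 1 := by
  rw [Set.indicator_of_mem (mem_ball_iff_norm.2 h)]
  rfl

theorem indicator_arc_eq_one {p : ℂ} {u : Circle} {R : ℝ} (h : ‖(u : ℂ) - p‖ < R) :
    {u : Circle | ‖(u : ℂ) - p‖ < R}.indicator (1 : Circle → ℝ≥0∞) u = 1 := by
  rw [Set.indicator_of_mem (by exact h)]
  rfl

theorem measurable_iterated {h : Circle → Circle → Circle → ℝ≥0∞}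
    (hh : Measurable fun p : Circle × Circle × Circle => h p.1 p.2.1 p.2.2) :
    (Measurable fun a => ∫⁻ b, ∫⁻ c, h a b c ∂arc ∂arc) ∧
      ∀ a, Measurable fun b => ∫⁻ c, h a b c ∂arc := by
  have h2 : Measurable fun q : Circle × Circle => ∫⁻ c, h q.1 q.2 c ∂arc :=
    Measurable.lintegral_prod_right' (f := fun q : (Circle × Circle) × Circle =>
      h q.1.1 q.1.2 q.2) (hh.comp (by fun_prop : Measurable fun q : (Circle × Circle) × Circle =>
        (q.1.1, q.1.2, q.2)))
  exact ⟨h2.lintegral_prod_right', fun a => h2.comp (by fun_prop : Measurable fun b => (a, b))⟩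

theorem lintegral_add₃ {g h : Circle → Circle → Circle → ℝ≥0∞}
    (hh : Measurable fun p : Circle × Circle × Circle => h p.1 p.2.1 p.2.2) :
    ∫⁻ a, ∫⁻ b, ∫⁻ c, (g a b c + h a b c) ∂arc ∂arc ∂arc =
      ∫⁻ a, ∫⁻ b, ∫⁻ c, g a b c ∂arc ∂arc ∂arc + ∫⁻ a, ∫⁻ b, ∫⁻ c, h a b c ∂arc ∂arc ∂arc := by
  obtain ⟨h1, h2⟩ := measurable_iterated hh
  rw [← lintegral_add_right _ h1]
  refine lintegral_congr fun a => ?_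
  rw [← lintegral_add_right _ (h2 a)]
  refine lintegral_congr fun b => ?_
  rw [lintegral_add_right]
  exact hh.comp (by fun_prop : Measurable fun c => (a, b, c))

theorem lintegral_const_mul₃ {g : Circle → Circle → Circle → ℝ≥0∞} {K : ℝ≥0∞} (hK : K ≠ ⊤) :
    ∫⁻ a, ∫⁻ b, ∫⁻ c, K * g a b c ∂arc ∂arc ∂arc =
      K * ∫⁻ a, ∫⁻ b, ∫⁻ c, g a b c ∂arc ∂arc ∂arc := by
  rw [← lintegral_const_mul' _ _ hK]
  refine lintegral_congr fun a => ?_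
  rw [← lintegral_const_mul' _ _ hK]
  refine lintegral_congr fun b => ?_
  rw [← lintegral_const_mul' _ _ hK]

theorem ofReal_wt_mul_le_locAbsSin {x : ℂ} {r q : ℝ} (hr : 0 < r) (hr1 : r ≤ 1)
    (hq : 14 * r ≤ q) (hqx : q = 9 - ‖x‖ ^ 2) (a b c : Circle) :
    ENNReal.ofReal (wt ((a : ℂ) + b + c)) *
      (Metric.ball x r).indicator 1 ((a : ℂ) + b + c) ≤ ENNReal.ofReal (24 / √q) *
        (locAbsSin x r (√q) a b c + locAbsSin x r (√q) b a c + locAbsSin x r (√q) c a b) := by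
  have hq0 : 0 < q := by linarith
  have hrq : r ≤ √q := Real.le_sqrt_of_sq_le (by nlinarith)
  by_cases hx : ‖(a : ℂ) + b + c - x‖ < r
  -- Replacing `|x|²` by `|S|²` costs `7r ≤ q/2`. Hence `q ≤ 2(9 - |S|²) ≤ 3q ≤ (2√q)²`, which gives
  -- both the transversality and the localization to radius `√q`.
  · have hS := abs_le.1 (abs_norm_sq_sub_le hr1 (norm_add_add_coe_le a b c) hx)
    have hloc : 2 * (9 - ‖(a : ℂ) + b + c‖ ^ 2) ≤ (2 * √q) ^ 2 := by
      rw [mul_pow, Real.sq_sqrt hq0.le]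
      linarith [hS.1]
    have e1 : (b : ℂ) + a + c = a + b + c := by ring
    have e2 : (c : ℂ) + a + b = a + b + c := by ring
    have ha := norm_sub_third_lt hx hloc (by positivity) (R := √q) (by linarith)
    have hb := norm_sub_third_lt (a := b) (b := a) (c := c) (by rwa [e1]) (by rwa [e1])
      (by positivity) (R := √q) (by linarith)
    have hc := norm_sub_third_lt (a := c) (b := a) (c := b) (by rwa [e2]) (by rwa [e2])
      (by positivity) (R := √q) (by linarith)
    unfold locAbsSin
    rw [e1, e2, indicator_ball_eq_one hx, indicator_arc_eq_one ha, indicator_arc_eq_one hb,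
      indicator_arc_eq_one hc]
    simp only [mul_one, one_mul]
    rw [← ENNReal.ofReal_add (absSin_nonneg _ _) (absSin_nonneg _ _),
      ← ENNReal.ofReal_add (add_nonneg (absSin_nonneg _ _) (absSin_nonneg _ _))
        (absSin_nonneg _ _), ← ENNReal.ofReal_mul (by positivity)]
    apply ENNReal.ofReal_le_ofReal
    rw [div_mul_eq_mul_div, le_div_iff₀ (Real.sqrt_pos.2 hq0)]
    exact wt_mul_sqrt_le (by linarith [hS.2])
  · rw [Set.indicator_of_notMem (by rwa [mem_ball_iff_norm]), mul_zero]
    exact zero_le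

theorem lintegral_const_mul_cyclic {h : Circle → Circle → Circle → ℝ≥0∞}
    (hh : Measurable fun p : Circle × Circle × Circle => h p.1 p.2.1 p.2.2) {K : ℝ≥0∞}
    (hK : K ≠ ⊤) :
    ∫⁻ a, ∫⁻ b, ∫⁻ c, K * (h a b c + h b a c + h c a b) ∂arc ∂arc ∂arc =
      K * (3 * ∫⁻ a, ∫⁻ b, ∫⁻ c, h a b c ∂arc ∂arc ∂arc) := by
  have hm2 : Measurable fun p : Circle × Circle × Circle => h p.2.1 p.1 p.2.2 :=
    hh.comp (by fun_prop : Measurable fun p : Circle × Circle × Circle => (p.2.1, p.1, p.2.2))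
  have hm3 : Measurable fun p : Circle × Circle × Circle => h p.2.2 p.1 p.2.1 :=
    hh.comp (by fun_prop : Measurable fun p : Circle × Circle × Circle => (p.2.2, p.1, p.2.1))
  rw [lintegral_const_mul₃ hK, lintegral_add₃ (g := fun a b c => h a b c + h b a c)
    (h := fun a b c => h c a b) hm3, lintegral_add₃ (g := fun a b c => h a b c)
    (h := fun a b c => h b a c) hm2, lintegral_perm_213 hh, lintegral_perm_312 hh]
  ring

/-- Away from `|x| = 3` the weight is at most `24/√q` times a sum of Jacobians, with `q = 9 - |x|²`.
This loss is cancelled by the length, of order `√q`, of the arc to which the third point is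
confined. -/
theorem lintegral_wt_mul_indicator_le_of_le (x : ℂ) {r : ℝ} (hr : 0 < r) (hr1 : r ≤ 1)
    (hq : 14 * r ≤ 9 - ‖x‖ ^ 2) :
    ∫⁻ a, ∫⁻ b, ∫⁻ c, ENNReal.ofReal (wt ((a : ℂ) + b + c)) *
      (Metric.ball x r).indicator 1 ((a : ℂ) + b + c) ∂arc ∂arc ∂arc
      ≤ ENNReal.ofReal (576 * Real.pi ^ 3 * r ^ 2) := by
  obtain ⟨q, hqx⟩ : ∃ q, q = 9 - ‖x‖ ^ 2 := ⟨_, rfl⟩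
  rw [← hqx] at hq
  have hq0 : 0 < q := by linarith
  have hpi : 24 / √q * (3 * (4 * Real.pi ^ 2 * √q * r ^ 2)) ≤ 576 * Real.pi ^ 3 * r ^ 2 := by
    have h0 := (Real.sqrt_pos.2 hq0).ne'
    have h1 : 24 / √q * (3 * (4 * Real.pi ^ 2 * √q * r ^ 2)) = 288 * Real.pi ^ 2 * r ^ 2 := by
      field_simp
      ring
    rw [h1]
    have := Real.pi_gt_three
    have h2 : Real.pi ^ 2 ≤ Real.pi ^ 3 := pow_le_pow_right₀ (by linarith) (by norm_num)
    have h3 : 288 * Real.pi ^ 2 ≤ 576 * Real.pi ^ 3 := by nlinarith [sq_nonneg Real.pi]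
    exact mul_le_mul_of_nonneg_right h3 (sq_nonneg r)
  refine (lintegral_mono fun a => lintegral_mono fun b => lintegral_mono fun c =>
    ofReal_wt_mul_le_locAbsSin hr hr1 hq hqx a b c).trans ?_
  rw [lintegral_const_mul_cyclic (measurable_locAbsSin x r (√q)) ENNReal.ofReal_ne_top]
  refine (mul_le_mul_right (mul_le_mul_right
    (lintegral_locAbsSin_le x hr.le (Real.sqrt_nonneg q)) 3) _).trans ?_
  rw [show (3 : ℝ≥0∞) = ENNReal.ofReal 3 by simp, ← ENNReal.ofReal_mul (by norm_num),
    ← ENNReal.ofReal_mul (by positivity)]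
  exact ENNReal.ofReal_le_ofReal hpi

/-- Near or beyond `|x| = 3` all three points are within `3√r` of `x/3`, so two of them contribute
`O(r)` together and the third another `O(r)`. The weight is merely bounded by 8. -/
theorem lintegral_wt_mul_indicator_le_of_gt (x : ℂ) {r : ℝ} (hr : 0 < r) (hr1 : r ≤ 1)
    (hq : 9 - ‖x‖ ^ 2 < 14 * r) :
    ∫⁻ a, ∫⁻ b, ∫⁻ c, ENNReal.ofReal (wt ((a : ℂ) + b + c)) *
      (Metric.ball x r).indicator 1 ((a : ℂ) + b + c) ∂arc ∂arc ∂arc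
      ≤ ENNReal.ofReal (576 * Real.pi ^ 3 * r ^ 2) := by
  have hrs : r ≤ √r := Real.le_sqrt_of_sq_le (by nlinarith)
  have hpt : ∀ a b c : Circle, ENNReal.ofReal (wt ((a : ℂ) + b + c)) *
      (Metric.ball x r).indicator 1 ((a : ℂ) + b + c) ≤ ENNReal.ofReal 8 *
      ({u : Circle | ‖(u : ℂ) - x / 3‖ < 3 * √r}.indicator 1 a *
      ({u : Circle | ‖(u : ℂ) - x / 3‖ < 3 * √r}.indicator 1 b *
      (Metric.ball x r).indicator 1 ((a : ℂ) + b + c))) := by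
    intro a b c
    by_cases hx : ‖(a : ℂ) + b + c - x‖ < r
    · have hS := abs_le.1 (abs_norm_sq_sub_le hr1 (norm_add_add_coe_le a b c) hx)
      -- Here `9 - |S|² ≤ 14r + 7r`, and `42 ≤ 49`; then `7√r + r ≤ 9√r` permits the radius `3√r`.
      have hloc : 2 * (9 - ‖(a : ℂ) + b + c‖ ^ 2) ≤ (7 * √r) ^ 2 := by
        rw [mul_pow, Real.sq_sqrt hr.le]
        linarith [hS.1]
      have e1 : (b : ℂ) + a + c = a + b + c := by ring
      have ha := norm_sub_third_lt hx hloc (by positivity) (R := 3 * √r) (by linarith)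
      have hb := norm_sub_third_lt (a := b) (b := a) (c := c) (by rwa [e1]) (by rwa [e1])
        (by positivity) (R := 3 * √r) (by linarith)
      rw [indicator_ball_eq_one hx, indicator_arc_eq_one ha, indicator_arc_eq_one hb]
      simp only [mul_one]
      exact ENNReal.ofReal_le_ofReal (wt_le_eight (norm_add_add_coe_le a b c))
    · rw [Set.indicator_of_notMem (by rwa [mem_ball_iff_norm]), mul_zero]
      exact zero_le
  calc _ ≤ _ :=
        lintegral_mono fun a => lintegral_mono fun b => lintegral_mono fun c => hpt a b c
    _ ≤ ENNReal.ofReal 8 * ENNReal.ofReal (8 * Real.pi ^ 3 * (3 * √r) ^ 2 * r) := by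
        rw [lintegral_const_mul₃ ENNReal.ofReal_ne_top]
        exact mul_le_mul_right (lintegral_loc_le x (by positivity)) _
    _ = _ := by
        rw [← ENNReal.ofReal_mul (by positivity), mul_pow, Real.sq_sqrt hr.le]
        congr 1
        ring

/-- The weighted threefold convolution of arc length has bounded density. -/
theorem lintegral_wt_mul_indicator_le (x : ℂ) {r : ℝ} (hr : 0 < r) (hr1 : r ≤ 1) :
    ∫⁻ a, ∫⁻ b, ∫⁻ c, ENNReal.ofReal (wt ((a : ℂ) + b + c)) *
      (Metric.ball x r).indicator 1 ((a : ℂ) + b + c) ∂arc ∂arc ∂arc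
      ≤ ENNReal.ofReal (576 * Real.pi ^ 3 * r ^ 2) := by
  rcases le_or_gt (14 * r) (9 - ‖x‖ ^ 2) with hq | hq
  · exact lintegral_wt_mul_indicator_le_of_le x hr hr1 hq
  · exact lintegral_wt_mul_indicator_le_of_gt x hr hr1 hq

/-! ### Kernel estimate for two triples of points. -/

/-- Three-fold products of arc length. -/
def arc3 : Measure (Circle × Circle × Circle) := arc.prod (arc.prod arc)

instance : IsFiniteMeasure arc3 := by
  unfold arc3
  infer_instance

def sum3 (p : Circle × Circle × Circle) : ℂ := (p.1 : ℂ) + p.2.1 + p.2.2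

@[fun_prop]
theorem measurable_sum3 : Measurable sum3 := by
  unfold sum3
  fun_prop

theorem lintegral_arc3 {f : Circle × Circle × Circle → ℝ≥0∞} (hf : Measurable f) :
    ∫⁻ p, f p ∂arc3 = ∫⁻ a, ∫⁻ b, ∫⁻ c, f (a, b, c) ∂arc ∂arc ∂arc := by
  rw [arc3, lintegral_prod _ hf.aemeasurable]
  refine lintegral_congr fun a => ?_
  rw [lintegral_prod]
  exact (hf.comp (by fun_prop : Measurable fun q : Circle × Circle => (a, q))).aemeasurable

theorem measurable_ball_sum3 (x : ℂ) (r : ℝ) :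
    Measurable fun p => (Metric.ball x r).indicator (1 : ℂ → ℝ≥0∞) (sum3 p) :=
  (measurable_ball_indicator x r).comp measurable_sum3

theorem measurable_wt_ball_sum3 (x : ℂ) (r : ℝ) :
    Measurable fun p => ENNReal.ofReal (wt (sum3 p)) *
      (Metric.ball x r).indicator (1 : ℂ → ℝ≥0∞) (sum3 p) :=
  (by fun_prop : Measurable fun p => ENNReal.ofReal (wt (sum3 p))).mul (measurable_ball_sum3 x r)

theorem lintegral_arc3_ball_le (x : ℂ) {r : ℝ} (hr : 0 < r) :
    ∫⁻ p, (Metric.ball x r).indicator 1 (sum3 p) ∂arc3 ≤ ENNReal.ofReal (8 * Real.pi ^ 3 * r) := by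
  rw [lintegral_arc3 (measurable_ball_sum3 x r)]
  have hball : ∀ a b : Circle, ∫⁻ c : Circle, (Metric.ball x r).indicator 1 (sum3 (a, b, c)) ∂arc
      ≤ ENNReal.ofReal (2 * Real.pi * r) := fun a b => by
    refine le_of_eq_of_le (lintegral_congr fun c => ?_)
      (lintegral_arc_one_ball_le (x - (a + b)) r)
    rw [sum3, ball_indicator_add]
    exact ball_indicator_coe _ _ _
  calc _ ≤ ∫⁻ _ : Circle, ∫⁻ _ : Circle, ENNReal.ofReal (2 * Real.pi * r) ∂arc ∂arc :=
        lintegral_mono fun a => lintegral_mono fun b => hball a b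
    _ = _ := by
        rw [lintegral_const, lintegral_const, arc_univ, ← ENNReal.ofReal_mul (by positivity),
          ← ENNReal.ofReal_mul (by positivity)]
        congr 1
        ring

theorem lintegral_arc3_wt_le (x : ℂ) {r : ℝ} (hr : 0 < r) (hr1 : r ≤ 1) :
    ∫⁻ p, ENNReal.ofReal (wt (sum3 p)) * (Metric.ball x r).indicator 1 (sum3 p) ∂arc3
      ≤ ENNReal.ofReal (632 * Real.pi ^ 3 * r ^ 2) := by
  rw [lintegral_arc3 (measurable_wt_ball_sum3 x r)]
  refine (lintegral_wt_mul_indicator_le x hr hr1).trans (ENNReal.ofReal_le_ofReal ?_)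
  gcongr
  norm_num

/-- Moving the weight from the triple sum to the centre `x` costs `7r` times the unweighted mass
`8π³r` of the disc, whence `632 = 576 + 56`. With the weight at the centre this bounds the other
marginal of the kernel. -/
theorem wt_mul_lintegral_arc3_le (x : ℂ) {r : ℝ} (hr : 0 < r) (hr1 : r ≤ 1) :
    ENNReal.ofReal (wt x) * ∫⁻ p, (Metric.ball x r).indicator 1 (sum3 p) ∂arc3
      ≤ ENNReal.ofReal (632 * Real.pi ^ 3 * r ^ 2) := by
  have hpt : ∀ p, ENNReal.ofReal (wt x) * (Metric.ball x r).indicator 1 (sum3 p) ≤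
      ENNReal.ofReal (wt (sum3 p)) * (Metric.ball x r).indicator 1 (sum3 p) +
        ENNReal.ofReal (7 * r) * (Metric.ball x r).indicator 1 (sum3 p) := fun p => by
    by_cases hx : ‖sum3 p - x‖ < r
    · rw [indicator_ball_eq_one hx, mul_one, mul_one, mul_one,
        ← ENNReal.ofReal_add (wt_nonneg _) (by positivity)]
      apply ENNReal.ofReal_le_ofReal
      have h := abs_norm_sq_sub_le hr1 (norm_add_add_coe_le p.1 p.2.1 p.2.2) hx
      change |‖sum3 p‖ ^ 2 - ‖x‖ ^ 2| ≤ 7 * r at h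
      unfold wt
      rw [abs_sub_comm] at h
      calc |‖x‖ ^ 2 - 1| = |(‖sum3 p‖ ^ 2 - 1) + (‖x‖ ^ 2 - ‖sum3 p‖ ^ 2)| := by ring_nf
        _ ≤ _ := abs_add_le _ _
        _ ≤ _ := by gcongr
    · rw [Set.indicator_of_notMem (by rwa [mem_ball_iff_norm]), mul_zero]
      exact zero_le
  have hm := measurable_ball_sum3 x r
  calc _ = ∫⁻ p, ENNReal.ofReal (wt x) * (Metric.ball x r).indicator 1 (sum3 p) ∂arc3 := by
        rw [lintegral_const_mul' _ _ ENNReal.ofReal_ne_top]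
    _ ≤ _ := lintegral_mono hpt
    _ = ∫⁻ p, ENNReal.ofReal (wt (sum3 p)) * (Metric.ball x r).indicator 1 (sum3 p) ∂arc3 +
        ENNReal.ofReal (7 * r) * ∫⁻ p, (Metric.ball x r).indicator 1 (sum3 p) ∂arc3 := by
        rw [lintegral_add_right _ (hm.const_mul _), lintegral_const_mul' _ _ ENNReal.ofReal_ne_top]
    _ ≤ ENNReal.ofReal (576 * Real.pi ^ 3 * r ^ 2) +
        ENNReal.ofReal (7 * r) * ENNReal.ofReal (8 * Real.pi ^ 3 * r) := by
        gcongr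
        · rw [lintegral_arc3 (measurable_wt_ball_sum3 x r)]
          exact lintegral_wt_mul_indicator_le x hr hr1
        · exact lintegral_arc3_ball_le x hr
    _ = _ := by
        rw [← ENNReal.ofReal_mul (by positivity), ← ENNReal.ofReal_add (by positivity)
          (by positivity)]
        congr 1
        ring

/-- The `L²` norm of a nonnegative function. -/
def l2 {α : Type*} [MeasurableSpace α] (μ : Measure α) (f : α → ℝ≥0∞) : ℝ≥0∞ :=
  (∫⁻ a, f a ^ 2 ∂μ) ^ (2⁻¹ : ℝ)

theorem l2_sq {α : Type*} [MeasurableSpace α] (μ : Measure α) (f : α → ℝ≥0∞) :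
    l2 μ f ^ 2 = ∫⁻ a, f a ^ 2 ∂μ := by
  rw [l2, ← ENNReal.rpow_natCast, ← ENNReal.rpow_mul]
  norm_num

theorem eLpNorm_two_eq_l2 {α E : Type*} [MeasurableSpace α] [ENorm E] (μ : Measure α)
    (f : α → E) : eLpNorm f 2 μ = l2 μ (fun a => ‖f a‖ₑ) := by
  rw [eLpNorm_eq_lintegral_rpow_enorm_toReal (by norm_num) (by norm_num), l2]
  simp

theorem l2_mono {α : Type*} [MeasurableSpace α] {μ : Measure α} {f g : α → ℝ≥0∞}
    (h : ∀ a, f a ≤ g a) : l2 μ f ≤ l2 μ g := by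
  unfold l2
  gcongr with a
  exact h a

/-- Cauchy–Schwarz with respect to a nonnegative kernel. -/
theorem lintegral_kernel_le {α β : Type*} [MeasurableSpace α] [MeasurableSpace β] {μ : Measure α}
    {ν : Measure β} [SFinite μ] [SFinite ν] {G₁ : α → ℝ≥0∞} {G₂ : β → ℝ≥0∞}
    {k : α × β → ℝ≥0∞} {M : ℝ≥0∞} (h₁ : Measurable G₁) (h₂ : Measurable G₂) (hk : Measurable k)
    (hM₁ : ∀ p, ∫⁻ q, k (p, q) ∂ν ≤ M) (hM₂ : ∀ q, ∫⁻ p, k (p, q) ∂μ ≤ M) :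
    ∫⁻ p, ∫⁻ q, G₁ p * G₂ q * k (p, q) ∂ν ∂μ ≤ M * (l2 μ G₁ * l2 ν G₂) := by
  have sq : ∀ x y : ℝ≥0∞, (x * y ^ (2⁻¹ : ℝ)) ^ (2 : ℝ) = x ^ 2 * y := fun x y => by
    rw [ENNReal.mul_rpow_of_nonneg _ _ zero_le_two, ← ENNReal.rpow_mul]
    norm_num
  have hf : AEMeasurable (fun z : α × β => G₁ z.1 * k z ^ (2⁻¹ : ℝ)) (μ.prod ν) := by fun_prop
  have hg : AEMeasurable (fun z : α × β => G₂ z.2 * k z ^ (2⁻¹ : ℝ)) (μ.prod ν) := by fun_prop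
  have hcs := ENNReal.lintegral_mul_le_Lp_mul_Lq (μ.prod ν) Real.HolderConjugate.two_two hf hg
  have hA : ∫⁻ z, G₁ z.1 ^ 2 * k z ∂(μ.prod ν) ≤ M * ∫⁻ p, G₁ p ^ 2 ∂μ := by
    rw [lintegral_prod _ (by fun_prop), ← lintegral_const_mul _ (by fun_prop)]
    refine lintegral_mono fun p => ?_
    simp only []
    rw [lintegral_const_mul (f := fun q => k (p, q)) _ (by fun_prop), mul_comm]
    exact mul_le_mul_left (hM₁ p) _
  have hB : ∫⁻ z, G₂ z.2 ^ 2 * k z ∂(μ.prod ν) ≤ M * ∫⁻ q, G₂ q ^ 2 ∂ν := by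
    rw [lintegral_prod_symm _ (by fun_prop), ← lintegral_const_mul _ (by fun_prop)]
    refine lintegral_mono fun q => ?_
    simp only []
    rw [lintegral_const_mul (f := fun p => k (p, q)) _ (by fun_prop), mul_comm]
    exact mul_le_mul_left (hM₂ q) _
  calc ∫⁻ p, ∫⁻ q, G₁ p * G₂ q * k (p, q) ∂ν ∂μ
      = ∫⁻ z, ((fun z : α × β => G₁ z.1 * k z ^ (2⁻¹ : ℝ)) *
          fun z : α × β => G₂ z.2 * k z ^ (2⁻¹ : ℝ)) z ∂(μ.prod ν) := by
        rw [lintegral_prod _ (by fun_prop)]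
        refine lintegral_congr fun p => lintegral_congr fun q => ?_
        have : k (p, q) = k (p, q) ^ (2⁻¹ : ℝ) * k (p, q) ^ (2⁻¹ : ℝ) := by
          rw [← ENNReal.rpow_add_of_nonneg _ _ (by norm_num) (by norm_num)]
          norm_num
        simp only [Pi.mul_apply]
        conv_lhs => rw [this]
        ring
    _ ≤ _ := hcs
    _ ≤ (M * ∫⁻ p, G₁ p ^ 2 ∂μ) ^ (2⁻¹ : ℝ) * (M * ∫⁻ q, G₂ q ^ 2 ∂ν) ^ (2⁻¹ : ℝ) := by
        simp only [sq, one_div]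
        gcongr
    _ = _ := by
        rw [ENNReal.mul_rpow_of_nonneg _ _ (by norm_num), ENNReal.mul_rpow_of_nonneg _ _
          (by norm_num), l2, l2]
        have : M = M ^ (2⁻¹ : ℝ) * M ^ (2⁻¹ : ℝ) := by
          rw [← ENNReal.rpow_add_of_nonneg _ _ (by norm_num) (by norm_num)]
          norm_num
        conv_rhs => rw [this]
        ring

theorem wt_neg (z : ℂ) : wt (-z) = wt z := by simp [wt]

/-- For fixed `q` the weight is integrated with `p`; for fixed `p` it is a constant which, as `wt`
is even, is the weight at the centre `-sum3 p`. So a weight on one triple controls both marginals.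
-/
theorem lintegral_sixfold_le {G₁ G₂ : Circle × Circle × Circle → ℝ≥0∞} (h₁ : Measurable G₁)
    (h₂ : Measurable G₂) {r : ℝ} (hr : 0 < r) (hr1 : r ≤ 1) :
    ∫⁻ p, ∫⁻ q, G₁ p * G₂ q * (ENNReal.ofReal (wt (sum3 p)) *
      (Metric.ball 0 r).indicator 1 (sum3 p + sum3 q)) ∂arc3 ∂arc3 ≤
      ENNReal.ofReal (632 * Real.pi ^ 3 * r ^ 2) * (l2 arc3 G₁ * l2 arc3 G₂) := by
  refine lintegral_kernel_le (k := fun z => ENNReal.ofReal (wt (sum3 z.1)) *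
      (Metric.ball 0 r).indicator 1 (sum3 z.1 + sum3 z.2)) h₁ h₂ ?_ ?_ ?_
  · exact (by fun_prop : Measurable fun z : (Circle × Circle × Circle) × _ =>
      ENNReal.ofReal (wt (sum3 z.1))).mul ((measurable_ball_indicator 0 r).comp (by fun_prop))
  · intro p
    simp only []
    rw [lintegral_const_mul' _ _ ENNReal.ofReal_ne_top, ← wt_neg]
    simp only [ball_indicator_add, zero_sub]
    exact wt_mul_lintegral_arc3_le _ hr hr1
  · intro q
    have : ∀ p, (Metric.ball 0 r).indicator (1 : ℂ → ℝ≥0∞) (sum3 p + sum3 q) =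
        (Metric.ball (-sum3 q) r).indicator 1 (sum3 p) := fun p => by
      rw [add_comm, ball_indicator_add, zero_sub]
    simp only [this]
    exact lintegral_arc3_wt_le _ hr hr1

/-! ### Splittings of five variables and the uniform `L²` bound. -/

/-- Among five unit vectors, some three have a sum off the unit circle. -/
theorem exists_wt_ge (v : Fin 5 → Circle) :
    ∃ τ : Equiv.Perm (Fin 5), 1 / 2 ≤ wt ((v (τ 0) : ℂ) + v (τ 1) + v (τ 2)) := by
  -- The squared norms of the ten triple sums add up to `15 + 3 |v₀ + ⋯ + v₄|² ≥ 15`.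
  have hex : ∃ i j k : Fin 5, i ≠ j ∧ i ≠ k ∧ j ≠ k ∧ 3 / 2 ≤ ‖(v i : ℂ) + v j + v k‖ ^ 2 := by
    by_contra! h
    have h012 := h 0 1 2 (by decide) (by decide) (by decide)
    have h013 := h 0 1 3 (by decide) (by decide) (by decide)
    have h014 := h 0 1 4 (by decide) (by decide) (by decide)
    have h023 := h 0 2 3 (by decide) (by decide) (by decide)
    have h024 := h 0 2 4 (by decide) (by decide) (by decide)
    have h034 := h 0 3 4 (by decide) (by decide) (by decide)
    have h123 := h 1 2 3 (by decide) (by decide) (by decide)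
    have h124 := h 1 2 4 (by decide) (by decide) (by decide)
    have h134 := h 1 3 4 (by decide) (by decide) (by decide)
    have h234 := h 2 3 4 (by decide) (by decide) (by decide)
    have n0 := Circle.normSq_coe (v 0)
    have n1 := Circle.normSq_coe (v 1)
    have n2 := Circle.normSq_coe (v 2)
    have n3 := Circle.normSq_coe (v 3)
    have n4 := Circle.normSq_coe (v 4)
    have hY := Complex.normSq_nonneg ((v 0 : ℂ) + v 1 + v 2 + v 3 + v 4)
    simp only [← Complex.normSq_eq_norm_sq, Complex.normSq_apply, Complex.add_re,
      Complex.add_im] at *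
    linarith
  obtain ⟨i, j, k, hij, hik, hjk, hw⟩ := hex
  have hτ : ∃ τ : Equiv.Perm (Fin 5), τ 0 = i ∧ τ 1 = j ∧ τ 2 = k := by
    let f : Fin 3 ↪ Fin 5 := ⟨![i, j, k], by
      intro a b hab
      fin_cases a <;> fin_cases b <;> simp_all [eq_comm]⟩
    let e : Fin 3 ↪ Fin 5 := ⟨![0, 1, 2], by decide⟩
    obtain ⟨τ, hτ⟩ := (Equiv.Perm.isMultiplyPretransitive (Fin 5) 3).exists_smul_eq e f
    exact ⟨τ, DFunLike.congr_fun hτ 0, DFunLike.congr_fun hτ 1, DFunLike.congr_fun hτ 2⟩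
  obtain ⟨τ, h0, h1, h2⟩ := hτ
  refine ⟨τ, ?_⟩
  rw [h0, h1, h2, wt]
  exact (by linarith : (1 : ℝ) / 2 ≤ _ - 1).trans (le_abs_self _)

/-- The product measure on the five-dimensional torus. -/
abbrev pi5 : Measure (Fin 5 → Circle) := Measure.pi fun _ => arc

/-- The point of the torus with prescribed coordinates, in the order given by `τ`. -/
def join (τ : Equiv.Perm (Fin 5)) (z : (Circle × Circle × Circle) × (Circle × Circle)) :
    Fin 5 → Circle :=
  fun i => (![z.1.1, z.1.2.1, z.1.2.2, z.2.1, z.2.2] : Fin 5 → Circle) (τ.symm i)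

theorem measurable_join (τ : Equiv.Perm (Fin 5)) : Measurable (join τ) := by
  refine measurable_pi_lambda _ fun i => ?_
  unfold join
  generalize τ.symm i = j
  fin_cases j <;> simp <;> fun_prop

theorem join_apply (τ : Equiv.Perm (Fin 5)) (z : (Circle × Circle × Circle) × (Circle × Circle)) (i : Fin 5) :
    join τ z (τ i) = (![z.1.1, z.1.2.1, z.1.2.2, z.2.1, z.2.2] : Fin 5 → Circle) i := by
  simp [join]

theorem sum_join (τ : Equiv.Perm (Fin 5)) (z : (Circle × Circle × Circle) × (Circle × Circle)) :
    ∑ i, (join τ z i : ℂ) = sum3 z.1 + (z.2.1 + z.2.2) := by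
  rw [← Equiv.sum_comp τ]
  simp only [join_apply, Fin.sum_univ_five]
  simp [sum3]
  ring

theorem measurePreserving_join (τ : Equiv.Perm (Fin 5)) :
    MeasurePreserving (join τ) (arc3.prod (arc.prod arc)) pi5 := by
  refine ⟨measurable_join τ, (Measure.pi_eq fun s hs => ?_).symm⟩
  rw [Measure.map_apply (measurable_join τ) (MeasurableSet.univ_pi hs)]
  have : join τ ⁻¹' Set.univ.pi s =
      (s (τ 0) ×ˢ s (τ 1) ×ˢ s (τ 2)) ×ˢ (s (τ 3) ×ˢ s (τ 4)) := by
    ext z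
    simp only [Set.mem_preimage, Set.mem_pi, Set.mem_univ, true_imp_iff]
    rw [← τ.forall_congr_right]
    simp only [join_apply, Fin.forall_fin_succ, Set.mem_prod]
    simp
    tauto
  rw [this, Measure.prod_prod, arc3, Measure.prod_prod, Measure.prod_prod, Measure.prod_prod,
    ← Equiv.prod_comp τ, Fin.prod_univ_five]
  ring

theorem lintegral_pi5 (τ : Equiv.Perm (Fin 5)) {Φ : (Fin 5 → Circle) → ℝ≥0∞} (hΦ : Measurable Φ) :
    ∫⁻ w, Φ w ∂pi5 = ∫⁻ p, ∫⁻ d, ∫⁻ e, Φ (join τ (p, d, e)) ∂arc ∂arc ∂arc3 := by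
  have hj := measurable_join τ
  rw [← (measurePreserving_join τ).lintegral_comp hΦ, lintegral_prod _ (by fun_prop)]
  refine lintegral_congr fun p => ?_
  rw [lintegral_prod _ (by fun_prop)]

/-- The mass that the push-forward of `H` under addition puts into the disc of radius `r` about
`x`. -/
def ballMass (r : ℝ) (H : (Fin 5 → Circle) → ℝ≥0∞) (x : Circle) : ℝ≥0∞ :=
  ∫⁻ w, H w * (Metric.ball (x : ℂ) r).indicator 1 (∑ i, (w i : ℂ)) ∂pi5

theorem measurableSet_ball_circle {α : Type*} [MeasurableSpace α] {f g : α → ℂ} (hf : Measurable f)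
    (hg : Measurable g) (r : ℝ) : MeasurableSet {a | f a ∈ Metric.ball (g a) r} := by
  simp only [mem_ball_iff_norm]
  exact measurableSet_lt (by fun_prop) measurable_const

theorem measurable_ball_indicator₂ {α : Type*} [MeasurableSpace α] {f g : α → ℂ}
    (hf : Measurable f) (hg : Measurable g) (r : ℝ) :
    Measurable fun a => (Metric.ball (g a) r).indicator (1 : ℂ → ℝ≥0∞) (f a) := by
  have : (fun a => (Metric.ball (g a) r).indicator (1 : ℂ → ℝ≥0∞) (f a)) =
      {a | f a ∈ Metric.ball (g a) r}.indicator 1 := by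
    ext a
    by_cases h : f a ∈ Metric.ball (g a) r
    · rw [Set.indicator_of_mem h, Set.indicator_of_mem (by exact h)]
      rfl
    · rw [Set.indicator_of_notMem h, Set.indicator_of_notMem (by exact h)]
  rw [this]
  exact measurable_one.indicator (measurableSet_ball_circle hf hg r)

theorem measurable_sum5 : Measurable fun w : Fin 5 → Circle => ∑ i, (w i : ℂ) := by
  fun_prop

theorem measurable_ballMass {r : ℝ} {H : (Fin 5 → Circle) → ℝ≥0∞} (hH : Measurable H) :
    Measurable (ballMass r H) := by
  unfold ballMass
  refine Measurable.lintegral_prod_right' (f := fun z : Circle × (Fin 5 → Circle) =>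
    H z.2 * (Metric.ball (z.1 : ℂ) r).indicator 1 (∑ i, (z.2 i : ℂ))) ?_
  exact (by fun_prop : Measurable fun z : Circle × (Fin 5 → Circle) => H z.2).mul
    (measurable_ball_indicator₂ (by fun_prop) (by fun_prop) r)

theorem lintegral_arc_neg {f : Circle → ℝ≥0∞} (hf : Measurable f) :
    ∫⁻ x, f (-1 * x) ∂arc = ∫⁻ x, f x ∂arc :=
  lintegral_arc_mul_left (-1) hf

/-- The contribution of one splitting of the five variables to the six-linear form. -/
theorem lintegral_split_le (τ : Equiv.Perm (Fin 5)) {G₁ : Circle × Circle × Circle → ℝ≥0∞}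
    {G₂ : Circle × Circle → ℝ≥0∞} {g : Circle → ℝ≥0∞} (h₁ : Measurable G₁) (h₂ : Measurable G₂)
    (hg : Measurable g) {r : ℝ} (hr : 0 < r) (hr1 : r ≤ 1) :
    ∫⁻ w, ∫⁻ x, G₁ (w (τ 0), w (τ 1), w (τ 2)) * (G₂ (w (τ 3), w (τ 4)) * g x) *
      (ENNReal.ofReal (wt ((w (τ 0) : ℂ) + w (τ 1) + w (τ 2))) *
        (Metric.ball (x : ℂ) r).indicator 1 (∑ i, (w i : ℂ))) ∂arc ∂pi5 ≤
      ENNReal.ofReal (632 * Real.pi ^ 3 * r ^ 2) *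
        (l2 arc3 G₁ * l2 (arc.prod arc) G₂ * l2 arc g) := by
  -- The point `x` enters the second triple as `-x`, so that the disc condition says that the two
  -- triple sums nearly cancel.
  set G₃ : Circle × Circle × Circle → ℝ≥0∞ := fun q => G₂ (q.1, q.2.1) * g (-1 * q.2.2)
  have h₃ : Measurable G₃ := by
    have : Measurable fun q : Circle × Circle × Circle => G₂ (q.1, q.2.1) :=
      h₂.comp (by fun_prop)
    exact this.mul (hg.comp (by fun_prop))
  have hl2 : l2 arc3 G₃ = l2 (arc.prod arc) G₂ * l2 arc g := by
    unfold l2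
    rw [← ENNReal.mul_rpow_of_nonneg _ _ (by norm_num), lintegral_arc3 (by fun_prop),
      lintegral_prod _ (by fun_prop), ← lintegral_mul_const _ (by fun_prop)]
    congr 1
    refine lintegral_congr fun d => ?_
    rw [← lintegral_mul_const _ (by fun_prop)]
    refine lintegral_congr fun e => ?_
    simp only [G₃, mul_pow]
    rw [lintegral_const_mul (f := fun x : Circle => g (-1 * x) ^ 2) _ (by fun_prop)]
    congr 1
    exact lintegral_arc_neg (f := fun x => g x ^ 2) (by fun_prop)
  have hmeas : Measurable fun z : (Fin 5 → Circle) × Circle =>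
      G₁ (z.1 (τ 0), z.1 (τ 1), z.1 (τ 2)) * (G₂ (z.1 (τ 3), z.1 (τ 4)) * g z.2) *
      (ENNReal.ofReal (wt ((z.1 (τ 0) : ℂ) + z.1 (τ 1) + z.1 (τ 2))) *
        (Metric.ball (z.2 : ℂ) r).indicator 1 (∑ i, (z.1 i : ℂ))) := by
    refine Measurable.mul (by fun_prop) (Measurable.mul (by fun_prop) ?_)
    exact measurable_ball_indicator₂ (by fun_prop) (by fun_prop) r
  rw [mul_assoc (l2 arc3 G₁), ← hl2]
  refine le_of_eq_of_le ?_ (lintegral_sixfold_le h₁ h₃ hr hr1)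
  rw [lintegral_pi5 τ hmeas.lintegral_prod_right']
  refine lintegral_congr fun p => ?_
  have hk : Measurable fun q => G₁ p * G₃ q * (ENNReal.ofReal (wt (sum3 p)) *
      (Metric.ball 0 r).indicator 1 (sum3 p + sum3 q)) :=
    Measurable.mul (by fun_prop) (Measurable.mul (by fun_prop)
      ((measurable_ball_indicator 0 r).comp (by fun_prop)))
  rw [lintegral_arc3 hk]
  refine lintegral_congr fun d => lintegral_congr fun e => ?_
  refine Eq.trans (lintegral_congr fun x => ?_) (lintegral_arc_neg
    (hk.comp (by fun_prop : Measurable fun x : Circle => (d, e, x))))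
  simp only []
  rw [sum_join]
  simp only [join_apply, G₃, sum3]
  simp only [Matrix.cons_val]
  have hx : -1 * (-1 * x) = x := by
    apply Circle.ext
    rw [coe_neg_one_mul, coe_neg_one_mul, neg_neg]
  rw [hx, coe_neg_one_mul]
  have h0 : (Metric.ball 0 r).indicator (1 : ℂ → ℝ≥0∞)
      ((p.1 : ℂ) + p.2.1 + p.2.2 + (d + e + -x)) =
      (Metric.ball (x : ℂ) r).indicator 1 (p.1 + p.2.1 + p.2.2 + (d + e)) := by
    rw [show (p.1 : ℂ) + p.2.1 + p.2.2 + (d + e + -x) =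
      -x + (p.1 + p.2.1 + p.2.2 + (d + e)) by ring, ball_indicator_add (0 : ℂ), zero_sub, neg_neg]
  rw [h0]

theorem card_perm_mul_two : (∑ _τ : Equiv.Perm (Fin 5), (2 : ℝ≥0∞)) = 240 := by
  rw [Finset.sum_const, Finset.card_univ, Fintype.card_perm, Fintype.card_fin]
  norm_num [Nat.factorial]

/-- The dual form of the uniform `L²` bound: a function that is dominated along every splitting
of the variables by a product. -/
theorem lintegral_mul_ballMass_le {H : (Fin 5 → Circle) → ℝ≥0∞} {B : ℝ≥0∞} (hH : Measurable H)
    (hB : ∀ τ : Equiv.Perm (Fin 5), ∃ (G₁ : Circle × Circle × Circle → ℝ≥0∞)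
      (G₂ : Circle × Circle → ℝ≥0∞), Measurable G₁ ∧ Measurable G₂ ∧
        (∀ w, H w ≤ G₁ (w (τ 0), w (τ 1), w (τ 2)) * G₂ (w (τ 3), w (τ 4))) ∧
        l2 arc3 G₁ * l2 (arc.prod arc) G₂ ≤ B)
    {g : Circle → ℝ≥0∞} (hg : Measurable g) {r : ℝ} (hr : 0 < r) (hr1 : r ≤ 1) :
    ∫⁻ x, g x * ballMass r H x ∂arc ≤
      240 * ENNReal.ofReal (632 * Real.pi ^ 3 * r ^ 2) * B * l2 arc g := by
  choose G₁ G₂ h₁ h₂ hle hb using hB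
  have hmeas : ∀ τ : Equiv.Perm (Fin 5), Measurable fun z : (Fin 5 → Circle) × Circle =>
      G₁ τ (z.1 (τ 0), z.1 (τ 1), z.1 (τ 2)) * (G₂ τ (z.1 (τ 3), z.1 (τ 4)) * g z.2) *
      (ENNReal.ofReal (wt ((z.1 (τ 0) : ℂ) + z.1 (τ 1) + z.1 (τ 2))) *
        (Metric.ball (z.2 : ℂ) r).indicator 1 (∑ i, (z.1 i : ℂ))) := fun τ => by
    have := h₁ τ
    have := h₂ τ
    refine Measurable.mul (by fun_prop) (Measurable.mul (by fun_prop) ?_)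
    exact measurable_ball_indicator₂ (by fun_prop) (by fun_prop) r
  have hmeas0 : Measurable fun z : Circle × (Fin 5 → Circle) =>
      g z.1 * (H z.2 * (Metric.ball (z.1 : ℂ) r).indicator 1 (∑ i, (z.2 i : ℂ))) := by
    refine Measurable.mul (by fun_prop) (Measurable.mul (by fun_prop) ?_)
    exact measurable_ball_indicator₂ (by fun_prop) (by fun_prop) r
  have hpt : ∀ (w : Fin 5 → Circle) (x : Circle),
      g x * (H w * (Metric.ball (x : ℂ) r).indicator 1 (∑ i, (w i : ℂ))) ≤
      ∑ τ : Equiv.Perm (Fin 5), 2 * (G₁ τ (w (τ 0), w (τ 1), w (τ 2)) *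
        (G₂ τ (w (τ 3), w (τ 4)) * g x) *
      (ENNReal.ofReal (wt ((w (τ 0) : ℂ) + w (τ 1) + w (τ 2))) *
        (Metric.ball (x : ℂ) r).indicator 1 (∑ i, (w i : ℂ)))) := fun w x => by
    -- The good splitting depends on `w`; bounding by the sum over all 120 permutations avoids
    -- choosing it measurably. The factor 2 compensates a weight of at least `1/2`.
    obtain ⟨τ, hτ⟩ := exists_wt_ge w
    refine le_trans ?_ (Finset.single_le_sum (fun _ _ => zero_le) (Finset.mem_univ τ))
    have h1 : 1 ≤ 2 * ENNReal.ofReal (wt ((w (τ 0) : ℂ) + w (τ 1) + w (τ 2))) := by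
      rw [show (2 : ℝ≥0∞) = ENNReal.ofReal 2 by simp, ← ENNReal.ofReal_mul zero_le_two,
        ENNReal.one_le_ofReal]
      linarith
    calc _ ≤ g x * (G₁ τ (w (τ 0), w (τ 1), w (τ 2)) * G₂ τ (w (τ 3), w (τ 4)) *
          (Metric.ball (x : ℂ) r).indicator 1 (∑ i, (w i : ℂ))) * 1 := by
          rw [mul_one]
          gcongr
          exact hle τ w
      _ ≤ _ := mul_le_mul_right h1 _
      _ = _ := by ring
  calc ∫⁻ x, g x * ballMass r H x ∂arc
      = ∫⁻ x, ∫⁻ w, g x * (H w * (Metric.ball (x : ℂ) r).indicator 1 (∑ i, (w i : ℂ)))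
          ∂pi5 ∂arc := by
        refine lintegral_congr fun x => ?_
        rw [ballMass, lintegral_const_mul]
        exact hH.mul (measurable_ball_indicator₂ measurable_sum5 measurable_const r)
    _ = ∫⁻ w, ∫⁻ x, g x * (H w * (Metric.ball (x : ℂ) r).indicator 1 (∑ i, (w i : ℂ)))
          ∂arc ∂pi5 := lintegral_lintegral_swap hmeas0.aemeasurable
    _ ≤ ∫⁻ w, ∫⁻ x, ∑ τ : Equiv.Perm (Fin 5), 2 * (G₁ τ (w (τ 0), w (τ 1), w (τ 2)) *
        (G₂ τ (w (τ 3), w (τ 4)) * g x) *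
      (ENNReal.ofReal (wt ((w (τ 0) : ℂ) + w (τ 1) + w (τ 2))) *
        (Metric.ball (x : ℂ) r).indicator 1 (∑ i, (w i : ℂ)))) ∂arc ∂pi5 :=
        lintegral_mono fun w => lintegral_mono fun x => hpt w x
    _ = ∑ τ : Equiv.Perm (Fin 5), 2 * ∫⁻ w, ∫⁻ x, G₁ τ (w (τ 0), w (τ 1), w (τ 2)) *
        (G₂ τ (w (τ 3), w (τ 4)) * g x) *
      (ENNReal.ofReal (wt ((w (τ 0) : ℂ) + w (τ 1) + w (τ 2))) *
        (Metric.ball (x : ℂ) r).indicator 1 (∑ i, (w i : ℂ))) ∂arc ∂pi5 := by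
        have e1 : ∀ w : Fin 5 → Circle, ∫⁻ x, ∑ τ : Equiv.Perm (Fin 5),
            2 * (G₁ τ (w (τ 0), w (τ 1), w (τ 2)) * (G₂ τ (w (τ 3), w (τ 4)) * g x) *
            (ENNReal.ofReal (wt ((w (τ 0) : ℂ) + w (τ 1) + w (τ 2))) *
            (Metric.ball (x : ℂ) r).indicator 1 (∑ i, (w i : ℂ)))) ∂arc =
            ∑ τ : Equiv.Perm (Fin 5), 2 * ∫⁻ x, G₁ τ (w (τ 0), w (τ 1), w (τ 2)) *
            (G₂ τ (w (τ 3), w (τ 4)) * g x) *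
            (ENNReal.ofReal (wt ((w (τ 0) : ℂ) + w (τ 1) + w (τ 2))) *
            (Metric.ball (x : ℂ) r).indicator 1 (∑ i, (w i : ℂ))) ∂arc := fun w => by
          refine (lintegral_finsetSum _ fun τ _ => ((hmeas τ).comp
            (by fun_prop : Measurable fun x : Circle => (w, x))).const_mul 2).trans ?_
          refine Finset.sum_congr rfl fun τ _ => ?_
          exact lintegral_const_mul' _ _ (by norm_num)
        rw [lintegral_congr e1,
          lintegral_finsetSum _ fun τ _ => ((hmeas τ).lintegral_prod_right').const_mul 2]
        refine Finset.sum_congr rfl fun τ _ => ?_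
        exact lintegral_const_mul' _ _ (by norm_num)
    _ ≤ ∑ _τ : Equiv.Perm (Fin 5), 2 * (ENNReal.ofReal (632 * Real.pi ^ 3 * r ^ 2) *
        (B * l2 arc g)) := by
        refine Finset.sum_le_sum fun τ _ => mul_le_mul_right ?_ _
        refine (lintegral_split_le τ (h₁ τ) (h₂ τ) hg hr hr1).trans ?_
        exact mul_le_mul_right (mul_le_mul_left (hb τ) _) _
    _ = _ := by
        rw [← Finset.sum_mul, card_perm_mul_two]
        ring

theorem ballMass_le (r : ℝ) (H : (Fin 5 → Circle) → ℝ≥0∞) (x : Circle) :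
    ballMass r H x ≤ ∫⁻ w, H w ∂pi5 := by
  refine lintegral_mono fun w => ?_
  refine mul_le_of_le_one_right' ?_
  exact Set.indicator_le_self' (fun _ _ => zero_le) _

/-- The uniform `L²` bound for the masses of small discs. -/
theorem l2_ballMass_le {H : (Fin 5 → Circle) → ℝ≥0∞} {B : ℝ≥0∞} (hH : Measurable H)
    (hfin : ∫⁻ w, H w ∂pi5 ≠ ⊤)
    (hB : ∀ τ : Equiv.Perm (Fin 5), ∃ (G₁ : Circle × Circle × Circle → ℝ≥0∞)
      (G₂ : Circle × Circle → ℝ≥0∞), Measurable G₁ ∧ Measurable G₂ ∧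
        (∀ w, H w ≤ G₁ (w (τ 0), w (τ 1), w (τ 2)) * G₂ (w (τ 3), w (τ 4))) ∧
        l2 arc3 G₁ * l2 (arc.prod arc) G₂ ≤ B)
    {r : ℝ} (hr : 0 < r) (hr1 : r ≤ 1) :
    l2 arc (ballMass r H) ≤ 240 * ENNReal.ofReal (632 * Real.pi ^ 3 * r ^ 2) * B := by
  -- Duality: the form is tested on `ballMass r H` itself. Cancelling one factor of its norm
  -- requires that norm to be finite, which integrability of `H` ensures.
  have h := lintegral_mul_ballMass_le hH hB (g := ballMass r H) (measurable_ballMass hH) hr hr1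
  simp only [← sq] at h
  rw [← l2_sq] at h
  have htop : l2 arc (ballMass r H) ≠ ⊤ := by
    refine ENNReal.rpow_ne_top_of_nonneg (by norm_num) (ne_of_lt ?_)
    calc _ ≤ ∫⁻ _, (∫⁻ w, H w ∂pi5) ^ 2 ∂arc :=
          lintegral_mono fun x => pow_le_pow_left₀ zero_le (ballMass_le r H x) 2
      _ < ⊤ := by
          rw [lintegral_const]
          exact ENNReal.mul_lt_top (ENNReal.pow_lt_top hfin.lt_top) (measure_lt_top _ _)
  rcases eq_or_ne (l2 arc (ballMass r H)) 0 with h0 | h0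
  · rw [h0]
    exact zero_le
  · rw [sq] at h
    exact (ENNReal.mul_le_mul_iff_left h0 htop).1 h

/-- The mean density, over the disc of radius `r` about `x`, of the push-forward of `H` under
addition. -/
def mean (r : ℝ) (H : (Fin 5 → Circle) → ℂ) (x : Circle) : ℂ :=
  (∫ w in {w : Fin 5 → Circle | ∑ i, (w i : ℂ) ∈ Metric.ball (x : ℂ) r}, H w ∂pi5) /
    ((Real.pi * r ^ 2 : ℝ) : ℂ)

theorem measurableSet_sum_mem_ball (x : ℂ) (r : ℝ) :
    MeasurableSet {w : Fin 5 → Circle | ∑ i, (w i : ℂ) ∈ Metric.ball x r} :=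
  measurableSet_ball_circle measurable_sum5 measurable_const r

theorem enorm_mean_le {r : ℝ} (hr : 0 < r) (H : (Fin 5 → Circle) → ℂ) (x : Circle) :
    ‖mean r H x‖ₑ ≤ (ENNReal.ofReal (Real.pi * r ^ 2))⁻¹ * ballMass r (fun w => ‖H w‖ₑ) x := by
  have hc : 0 < Real.pi * r ^ 2 := by positivity
  rw [mean, div_eq_inv_mul, enorm_mul, enorm_inv (by exact_mod_cast hc.ne'),
    show ‖((Real.pi * r ^ 2 : ℝ) : ℂ)‖ₑ = ENNReal.ofReal (Real.pi * r ^ 2) by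
      rw [← ofReal_norm, Complex.norm_real, Real.norm_of_nonneg hc.le]]
  refine mul_le_mul_right ((enorm_integral_le_lintegral_enorm _).trans_eq ?_) _
  rw [ballMass, ← lintegral_indicator (measurableSet_sum_mem_ball _ _)]
  refine lintegral_congr fun w => ?_
  by_cases h : ∑ i, (w i : ℂ) ∈ Metric.ball (x : ℂ) r
  · rw [Set.indicator_of_mem (by exact h), Set.indicator_of_mem h, Pi.one_apply, mul_one]
  · rw [Set.indicator_of_notMem (by exact h), Set.indicator_of_notMem h, mul_zero]

theorem l2_const_mul {α : Type*} [MeasurableSpace α] {μ : Measure α} {c : ℝ≥0∞} (hc : c ≠ ⊤)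
    (f : α → ℝ≥0∞) : l2 μ (fun a => c * f a) = c * l2 μ f := by
  unfold l2
  simp only [mul_pow]
  rw [lintegral_const_mul' _ _ (by simp [hc]), ENNReal.mul_rpow_of_nonneg _ _ (by norm_num),
    ← ENNReal.rpow_natCast, ← ENNReal.rpow_mul]
  norm_num

/-- The constant in the `L²` bound for mean densities. -/
def meanConst : ℝ≥0∞ := 240 * ENNReal.ofReal (632 * Real.pi ^ 2)

theorem meanConst_ne_top : meanConst ≠ ⊤ :=
  ENNReal.mul_ne_top (by norm_num) ENNReal.ofReal_ne_top

/-- A product bound for every splitting is all that is asked of `H`. This covers both tensor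
products and functions supported on nearly parallel configurations. -/
theorem eLpNorm_mean_le {H : (Fin 5 → Circle) → ℂ} {B : ℝ≥0∞} (hH : Measurable H)
    (hint : Integrable H pi5)
    (hB : ∀ τ : Equiv.Perm (Fin 5), ∃ (G₁ : Circle × Circle × Circle → ℝ≥0∞)
      (G₂ : Circle × Circle → ℝ≥0∞), Measurable G₁ ∧ Measurable G₂ ∧
        (∀ w, ‖H w‖ₑ ≤ G₁ (w (τ 0), w (τ 1), w (τ 2)) * G₂ (w (τ 3), w (τ 4))) ∧
        l2 arc3 G₁ * l2 (arc.prod arc) G₂ ≤ B)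
    {r : ℝ} (hr : 0 < r) (hr1 : r ≤ 1) :
    eLpNorm (mean r H) 2 arc ≤ meanConst * B := by
  have hc : 0 < Real.pi * r ^ 2 := by positivity
  have h := l2_ballMass_le (H := fun w => ‖H w‖ₑ) (B := B) hH.enorm hint.2.ne hB hr hr1
  calc eLpNorm (mean r H) 2 arc = l2 arc (fun x => ‖mean r H x‖ₑ) := eLpNorm_two_eq_l2 _ _
    _ ≤ l2 arc (fun x => (ENNReal.ofReal (Real.pi * r ^ 2))⁻¹ *
          ballMass r (fun w => ‖H w‖ₑ) x) := l2_mono (enorm_mean_le hr H)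
    _ = (ENNReal.ofReal (Real.pi * r ^ 2))⁻¹ * l2 arc (ballMass r (fun w => ‖H w‖ₑ)) :=
        l2_const_mul (by simpa using hc) _
    _ ≤ (ENNReal.ofReal (Real.pi * r ^ 2))⁻¹ *
        (240 * ENNReal.ofReal (632 * Real.pi ^ 3 * r ^ 2) * B) := mul_le_mul_right h _
    _ = _ := by
        have h0 : ENNReal.ofReal (Real.pi * r ^ 2) ≠ 0 := by simpa using hc
        have h1 : ENNReal.ofReal (632 * Real.pi ^ 3 * r ^ 2) =
            ENNReal.ofReal (632 * Real.pi ^ 2) * ENNReal.ofReal (Real.pi * r ^ 2) := by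
          rw [← ENNReal.ofReal_mul (by positivity)]
          congr 1
          ring
        rw [meanConst, h1]
        generalize hd : ENNReal.ofReal (Real.pi * r ^ 2) = d at h0
        have hd' : d ≠ ⊤ := hd ▸ ENNReal.ofReal_ne_top
        calc _ = (240 * ENNReal.ofReal (632 * Real.pi ^ 2) * B) * (d⁻¹ * d) := by ring
          _ = _ := by rw [ENNReal.inv_mul_cancel h0 hd', mul_one]

theorem l2_prod {α β : Type*} [MeasurableSpace α] [MeasurableSpace β] {μ : Measure α}
    {ν : Measure β} [SFinite ν] {f : α → ℝ≥0∞} {g : β → ℝ≥0∞} (hf : Measurable f)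
    (hg : Measurable g) :
    l2 (μ.prod ν) (fun z => f z.1 * g z.2) = l2 μ f * l2 ν g := by
  unfold l2
  rw [← ENNReal.mul_rpow_of_nonneg _ _ (by norm_num)]
  simp only [mul_pow]
  rw [← lintegral_prod_mul (by fun_prop) (by fun_prop)]

theorem integrable_tensor {f : Fin 5 → Circle → ℂ} (hf : ∀ i, MemLp (f i) 2 arc) :
    Integrable (fun w : Fin 5 → Circle => ∏ i, f i (w i)) pi5 :=
  Integrable.fintype_prod fun i => (hf i).integrable (by norm_num)

theorem measurable_tensor {f : Fin 5 → Circle → ℂ} (hf : ∀ i, Measurable (f i)) :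
    Measurable (fun w : Fin 5 → Circle => ∏ i, f i (w i)) := by
  fun_prop

/-- The uniform `L²` bound for mean densities of convolutions. -/
theorem eLpNorm_mean_tensor_le {f : Fin 5 → Circle → ℂ} (hm : ∀ i, Measurable (f i))
    (hf : ∀ i, MemLp (f i) 2 arc) {r : ℝ} (hr : 0 < r) (hr1 : r ≤ 1) :
    eLpNorm (mean r fun w => ∏ i, f i (w i)) 2 arc ≤ meanConst * ∏ i, eLpNorm (f i) 2 arc := by
  refine eLpNorm_mean_le (measurable_tensor hm) (integrable_tensor hf) (fun τ => ?_) hr hr1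
  refine ⟨fun p => ‖f (τ 0) p.1‖ₑ * (‖f (τ 1) p.2.1‖ₑ * ‖f (τ 2) p.2.2‖ₑ),
    fun q => ‖f (τ 3) q.1‖ₑ * ‖f (τ 4) q.2‖ₑ, by fun_prop, by fun_prop, fun w => ?_, ?_⟩
  · rw [← Equiv.prod_comp τ, Fin.prod_univ_five]
    simp only [enorm_mul]
    refine le_of_eq ?_
    ring
  · rw [arc3, l2_prod (f := fun a => ‖f (τ 0) a‖ₑ)
      (g := fun q : Circle × Circle => ‖f (τ 1) q.1‖ₑ * ‖f (τ 2) q.2‖ₑ) (by fun_prop) (by fun_prop),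
      l2_prod (f := fun a => ‖f (τ 1) a‖ₑ) (g := fun a => ‖f (τ 2) a‖ₑ) (by fun_prop)
        (by fun_prop), l2_prod (f := fun a => ‖f (τ 3) a‖ₑ) (g := fun a => ‖f (τ 4) a‖ₑ)
        (by fun_prop) (by fun_prop), ← Equiv.prod_comp τ, Fin.prod_univ_five]
    simp only [eLpNorm_two_eq_l2]
    refine le_of_eq ?_
    ring

/-! ### Nearly parallel configurations. -/

/-- Triples of points on the circle, two of which are nearly parallel. -/
def nearParallel₃ (ε : ℝ) : Set (Circle × Circle × Circle) :=
  {p | absSin p.1 p.2.1 < ε ∨ absSin p.2.1 p.2.2 < ε ∨ absSin p.1 p.2.2 < ε}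

/-- Nearly parallel pairs of points on the circle. -/
def nearParallel₂ (ε : ℝ) : Set (Circle × Circle) := {q | absSin q.1 q.2 < ε}

/-- Points of the torus, the first three of whose coordinates are nearly parallel. -/
def nearParallel₅ (ε : ℝ) : Set (Fin 5 → Circle) :=
  {w | absSin (w 0) (w 1) < ε ∧ absSin (w 1) (w 2) < ε ∧ absSin (w 0) (w 2) < ε}

theorem measurableSet_absSin_lt {α : Type*} [MeasurableSpace α] {f g : α → Circle}
    (hf : Measurable f) (hg : Measurable g) (ε : ℝ) :
    MeasurableSet {a | absSin (f a) (g a) < ε} :=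
  measurableSet_lt (by fun_prop) measurable_const

theorem measurableSet_nearParallel₃ (ε : ℝ) : MeasurableSet (nearParallel₃ ε) :=
  (measurableSet_absSin_lt (by fun_prop) (by fun_prop) ε).union
    ((measurableSet_absSin_lt (by fun_prop) (by fun_prop) ε).union
      (measurableSet_absSin_lt (by fun_prop) (by fun_prop) ε))

theorem measurableSet_nearParallel₂ (ε : ℝ) : MeasurableSet (nearParallel₂ ε) :=
  measurableSet_absSin_lt (by fun_prop) (by fun_prop) ε

/-- The `L²` size of nearly parallel configurations. -/
def nearParallelBound (ε : ℝ) : ℝ≥0∞ :=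
  l2 arc3 ((nearParallel₃ ε).indicator 1) * l2 (arc.prod arc) 1 +
    l2 arc3 1 * l2 (arc.prod arc) ((nearParallel₂ ε).indicator 1)

theorem mem_nearParallel₃ {ε : ℝ} {w : Fin 5 → Circle} {τ : Equiv.Perm (Fin 5)} {i j : Fin 5}
    (hij : i ≠ j) (hi : i < 3) (hj : j < 3) (h : absSin (w (τ i)) (w (τ j)) < ε) :
    (w (τ 0), w (τ 1), w (τ 2)) ∈ nearParallel₃ ε := by
  unfold nearParallel₃
  have h' := h
  rw [absSin_comm] at h'
  fin_cases i <;> fin_cases j <;> simp_all [Fin.lt_def]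

theorem mem_nearParallel₂ {ε : ℝ} {w : Fin 5 → Circle} {τ : Equiv.Perm (Fin 5)} {i j : Fin 5}
    (hij : i ≠ j) (hi : ¬ i < 3) (hj : ¬ j < 3) (h : absSin (w (τ i)) (w (τ j)) < ε) :
    (w (τ 3), w (τ 4)) ∈ nearParallel₂ ε := by
  unfold nearParallel₂
  have h' := h
  rw [absSin_comm] at h'
  fin_cases i <;> fin_cases j <;> simp_all [Fin.lt_def]

/-- Pigeonhole: of the indices 0, 1, 2, two fall into the same block of the splitting, and they are
the same two for all `w`. -/
theorem nearParallel₅_split {ε : ℝ} (τ : Equiv.Perm (Fin 5)) :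
    (∀ w ∈ nearParallel₅ ε, (w (τ 0), w (τ 1), w (τ 2)) ∈ nearParallel₃ ε) ∨
      ∀ w ∈ nearParallel₅ ε, (w (τ 3), w (τ 4)) ∈ nearParallel₂ ε := by
  have hne : ∀ i j : Fin 5, i ≠ j → τ.symm i ≠ τ.symm j := fun i j h => τ.symm.injective.ne h
  have key : ∀ i j : Fin 5, i ≠ j → (∀ w ∈ nearParallel₅ ε, absSin (w i) (w j) < ε) →
      (τ.symm i < 3 ↔ τ.symm j < 3) →
      (∀ w ∈ nearParallel₅ ε, (w (τ 0), w (τ 1), w (τ 2)) ∈ nearParallel₃ ε) ∨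
      ∀ w ∈ nearParallel₅ ε, (w (τ 3), w (τ 4)) ∈ nearParallel₂ ε := by
    intro i j hij hw hiff
    by_cases hi : τ.symm i < 3
    · exact Or.inl fun w h => mem_nearParallel₃ (hne i j hij) hi (hiff.1 hi) (by simpa using hw w h)
    · exact Or.inr fun w h => mem_nearParallel₂ (hne i j hij) hi (fun hj => hi (hiff.2 hj))
        (by simpa using hw w h)
  by_cases h01 : τ.symm 0 < 3 ↔ τ.symm 1 < 3
  · exact key 0 1 (by decide) (fun w h => h.1) h01
  by_cases h12 : τ.symm 1 < 3 ↔ τ.symm 2 < 3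
  · exact key 1 2 (by decide) (fun w h => h.2.1) h12
  exact key 0 2 (by decide) (fun w h => h.2.2) (by tauto)

/-- The block that contains the nearly parallel pair takes the indicator, and the other block takes
a constant. Either product is bounded by one summand of `nearParallelBound`. -/
theorem eLpNorm_mean_nearParallel_le {H : (Fin 5 → Circle) → ℂ} {M : ℝ≥0∞} {ε : ℝ}
    (hH : Measurable H) (hint : Integrable H pi5) (hM : M ≠ ⊤)
    (hle : ∀ w, ‖H w‖ₑ ≤ M * (nearParallel₅ ε).indicator 1 w) {r : ℝ} (hr : 0 < r) (hr1 : r ≤ 1) :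
    eLpNorm (mean r H) 2 arc ≤ meanConst * (M * nearParallelBound ε) := by
  refine eLpNorm_mean_le hH hint (fun τ => ?_) hr hr1
  have h3 : Measurable ((nearParallel₃ ε).indicator (1 : Circle × Circle × Circle → ℝ≥0∞)) :=
    measurable_one.indicator (measurableSet_nearParallel₃ ε)
  have h2 : Measurable ((nearParallel₂ ε).indicator (1 : Circle × Circle → ℝ≥0∞)) :=
    measurable_one.indicator (measurableSet_nearParallel₂ ε)
  rcases nearParallel₅_split (ε := ε) τ with h | h
  · refine ⟨fun p => M * (nearParallel₃ ε).indicator 1 p, 1, by fun_prop, measurable_one,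
      fun w => (hle w).trans ?_, ?_⟩
    · rw [Pi.one_apply, mul_one]
      refine mul_le_mul_right ?_ _
      by_cases hw : w ∈ nearParallel₅ ε
      · rw [Set.indicator_of_mem hw, Set.indicator_of_mem (h w hw)]
        rfl
      · rw [Set.indicator_of_notMem hw]
        exact zero_le
    · rw [l2_const_mul hM, mul_assoc]
      exact mul_le_mul_right le_self_add _
  · refine ⟨fun _ => M * 1, (nearParallel₂ ε).indicator 1, by fun_prop, h2,
      fun w => (hle w).trans ?_, ?_⟩
    · rw [mul_one]
      refine mul_le_mul_right ?_ _
      by_cases hw : w ∈ nearParallel₅ ε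
      · rw [Set.indicator_of_mem hw, Set.indicator_of_mem (h w hw)]
        rfl
      · rw [Set.indicator_of_notMem hw]
        exact zero_le
    · rw [l2_const_mul hM, mul_assoc]
      exact mul_le_mul_right le_add_self _

theorem tendsto_measure_lt_zero {α : Type*} [MeasurableSpace α] {μ : Measure α}
    [IsFiniteMeasure μ] {m : α → ℝ} (hm : Measurable m) (hpos : ∀ᵐ a ∂μ, 0 < m a) :
    Tendsto (fun ε : ℝ => μ {a | m a < ε}) (𝓝[>] 0) (𝓝 0) := by
  have h := tendsto_measure_biInter_gt (μ := μ) (s := fun ε : ℝ => {a | m a < ε}) (a := 0)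
    (fun ε _ => (measurableSet_lt hm measurable_const).nullMeasurableSet)
    (fun i j _ hij a (ha : m a < i) => ha.trans_le hij) ⟨1, one_pos, measure_ne_top _ _⟩
  have h0 : μ (⋂ ε > (0 : ℝ), {a | m a < ε}) = 0 := by
    refine measure_mono_null ?_ hpos
    intro a ha hlt
    simp only [Set.mem_iInter] at ha
    exact lt_irrefl (m a) (ha (m a) hlt)
  rwa [h0] at h

theorem l2_indicator {α : Type*} [MeasurableSpace α] {μ : Measure α} {s : Set α}
    (hs : MeasurableSet s) : l2 μ (s.indicator 1) = μ s ^ (2⁻¹ : ℝ) := by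
  unfold l2
  congr 1
  rw [← lintegral_indicator_one hs]
  refine lintegral_congr fun a => ?_
  by_cases h : a ∈ s <;> simp [h]

theorem tendsto_nearParallelBound : Tendsto nearParallelBound (𝓝[>] 0) (𝓝 0) := by
  have hpos : ∀ a : Circle, ∀ᵐ b ∂arc, 0 < absSin a b := fun a => by
    filter_upwards [ae_absSin_ne_zero a] with b hb
    exact lt_of_le_of_ne (absSin_nonneg a b) hb.symm
  have hp2 : ∀ᵐ q ∂(arc.prod arc), 0 < absSin q.1 q.2 := by
    rw [Measure.ae_prod_iff_ae_ae (measurableSet_lt (by fun_prop) (by fun_prop))]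
    exact Eventually.of_forall hpos
  have h2 : Tendsto (fun ε => (arc.prod arc) (nearParallel₂ ε)) (𝓝[>] 0) (𝓝 0) :=
    tendsto_measure_lt_zero (by fun_prop) hp2
  have hp3 : ∀ᵐ p ∂arc3, 0 < min (absSin p.1 p.2.1) (min (absSin p.2.1 p.2.2)
      (absSin p.1 p.2.2)) := by
    rw [arc3, Measure.ae_prod_iff_ae_ae (measurableSet_lt (by fun_prop) (by fun_prop))]
    refine Eventually.of_forall fun a => ?_
    filter_upwards [hp2, Measure.quasiMeasurePreserving_fst.ae (hpos a),
      Measure.quasiMeasurePreserving_snd.ae (hpos a)] with q h1 h2 h3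
    exact lt_min h2 (lt_min h1 h3)
  have h3 : Tendsto (fun ε => arc3 (nearParallel₃ ε)) (𝓝[>] 0) (𝓝 0) := by
    have := tendsto_measure_lt_zero (by fun_prop) hp3
    simp only [min_lt_iff] at this
    exact this
  have hr2 : Tendsto (fun ε => (arc.prod arc) (nearParallel₂ ε) ^ (2⁻¹ : ℝ)) (𝓝[>] 0) (𝓝 0) := by
    have := (ENNReal.continuous_rpow_const (y := 2⁻¹)).tendsto 0 |>.comp h2
    rwa [ENNReal.zero_rpow_of_pos (by norm_num)] at this
  have hr3 : Tendsto (fun ε => arc3 (nearParallel₃ ε) ^ (2⁻¹ : ℝ)) (𝓝[>] 0) (𝓝 0) := by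
    have := (ENNReal.continuous_rpow_const (y := 2⁻¹)).tendsto 0 |>.comp h3
    rwa [ENNReal.zero_rpow_of_pos (by norm_num)] at this
  have hfin : ∀ {α : Type} [MeasurableSpace α] (μ : Measure α) [IsFiniteMeasure μ],
      l2 μ 1 ≠ ⊤ := fun μ _ => by
    unfold l2
    refine ENNReal.rpow_ne_top_of_nonneg (by norm_num) ?_
    simp
  unfold nearParallelBound
  simp only [l2_indicator (measurableSet_nearParallel₃ _),
    l2_indicator (measurableSet_nearParallel₂ _)]
  have ha := ENNReal.Tendsto.mul_const hr3 (Or.inr (hfin (arc.prod arc)))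
  have hb := ENNReal.Tendsto.const_mul hr2 (Or.inr (hfin arc3))
  rw [zero_mul] at ha
  rw [mul_zero] at hb
  simpa using ha.add hb

/-! ### Lebesgue differentiation of the twofold convolution. -/

/-- The mean density, over the disc of radius `r` about `z`, of the push-forward of `B` under
addition. -/
def pairMean (r : ℝ) (B : Circle × Circle → ℂ) (z : ℂ) : ℂ :=
  (∫ q in {q : Circle × Circle | (q.1 : ℂ) + q.2 ∈ Metric.ball z r}, B q ∂(arc.prod arc)) /
    ((Real.pi * r ^ 2 : ℝ) : ℂ)

theorem measurableSet_add_mem_ball (z : ℂ) (r : ℝ) :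
    MeasurableSet {q : Circle × Circle | (q.1 : ℂ) + q.2 ∈ Metric.ball z r} :=
  measurableSet_ball_circle (by fun_prop) measurable_const r

/-- The quantity is `ν(B(z, r)) / |B(z, r)|` for the image `ν` of the density under addition, so the
Besicovitch differentiation theorem applies. -/
theorem exists_tendsto_pairMean_of_nonneg {φ : Circle × Circle → ℝ} (hφ : Measurable φ)
    (hφ0 : ∀ q, 0 ≤ φ q) (hint : Integrable φ (arc.prod arc)) :
    ∀ᵐ z : ℂ, ∃ l, Tendsto (fun r => pairMean r (fun q => (φ q : ℂ)) z) (𝓝[>] 0) (𝓝 l) := by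
  set ρ := (arc.prod arc).withDensity fun q => ENNReal.ofReal (φ q) with hρ
  have hadd : Measurable fun q : Circle × Circle => (q.1 : ℂ) + q.2 := by fun_prop
  set ν : Measure ℂ := ρ.map fun q => (q.1 : ℂ) + q.2 with hν
  have hρfin : IsFiniteMeasure ρ := isFiniteMeasure_withDensity_ofReal hint.2
  have hνfin : IsFiniteMeasure ν := Measure.isFiniteMeasure_map _ _
  have hac : ∀ N : Set ℂ, MeasurableSet N → volume N = 0 → ν N = 0 := fun N hN hN0 => by
    rw [hν, Measure.map_apply hadd hN]
    refine withDensity_absolutelyContinuous _ _ ?_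
    have := ae_add_notMem hN0
    rw [ae_iff] at this
    simp only [not_not] at this
    exact this
  -- The differentiation theorem concerns closed discs; circles are null for `ν` by absolute
  -- continuity.
  have hball : ∀ (z : ℂ) (r : ℝ), 0 < r → ν (Metric.closedBall z r) = ν (Metric.ball z r) := by
    intro z r hr
    rw [← Metric.ball_union_sphere]
    refine le_antisymm ((measure_union_le _ _).trans_eq ?_) (measure_mono Set.subset_union_left)
    rw [hac _ Metric.isClosed_sphere.measurableSet (Measure.addHaar_sphere _ _ _), add_zero]
  filter_upwards [Besicovitch.ae_tendsto_rnDeriv ν volume, Measure.rnDeriv_lt_top ν volume]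
    with z hz hfin
  refine ⟨((ν.rnDeriv volume z).toReal : ℝ), ?_⟩
  have h1 := (Complex.continuous_ofReal.tendsto _).comp
    ((ENNReal.tendsto_toReal hfin.ne).comp hz)
  refine h1.congr' ?_
  filter_upwards [self_mem_nhdsWithin] with r hr
  have hr' : 0 < r := hr
  simp only [Function.comp_apply]
  rw [hball z r hr', pairMean, integral_complex_ofReal, ← Complex.ofReal_div]
  congr 1
  rw [ENNReal.toReal_div, Measure.addHaar_closedBall_eq_addHaar_ball, volume_ball_eq _ hr'.le,
    ENNReal.toReal_ofReal (by positivity)]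
  congr 1
  rw [hν, Measure.map_apply hadd Metric.isOpen_ball.measurableSet, hρ,
    withDensity_apply _ (hadd Metric.isOpen_ball.measurableSet),
    integral_eq_lintegral_of_nonneg_ae (Eventually.of_forall hφ0) (by fun_prop)]
  rfl

theorem pairMean_add {r : ℝ} {B₁ B₂ : Circle × Circle → ℂ} (h₁ : Integrable B₁ (arc.prod arc))
    (h₂ : Integrable B₂ (arc.prod arc)) (z : ℂ) :
    pairMean r (fun q => B₁ q + B₂ q) z = pairMean r B₁ z + pairMean r B₂ z := by
  rw [pairMean, integral_add h₁.integrableOn h₂.integrableOn, add_div]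
  rfl

theorem pairMean_const_mul {r : ℝ} {B : Circle × Circle → ℂ} (c : ℂ) (z : ℂ) :
    pairMean r (fun q => c * B q) z = c * pairMean r B z := by
  rw [pairMean, integral_const_mul, mul_div_assoc]
  rfl

/-- Lebesgue differentiation for the image of a bounded density on the two-dimensional torus. -/
theorem exists_tendsto_pairMean {B : Circle × Circle → ℂ} (hB : Measurable B)
    (hint : Integrable B (arc.prod arc)) :
    ∀ᵐ z : ℂ, ∃ l, Tendsto (fun r => pairMean r B z) (𝓝[>] 0) (𝓝 l) := by
  have hp : ∀ φ : Circle × Circle → ℝ, Measurable φ → Integrable φ (arc.prod arc) →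
      (∀ᵐ z : ℂ, ∃ l, Tendsto (fun r => pairMean r (fun q => ((max (φ q) 0 : ℝ) : ℂ)) z)
        (𝓝[>] 0) (𝓝 l)) ∧ Integrable (fun q => ((max (φ q) 0 : ℝ) : ℂ)) (arc.prod arc) :=
    fun φ hφ hφi => ⟨exists_tendsto_pairMean_of_nonneg (by fun_prop) (fun q => le_max_right _ _)
      hφi.pos_part, hφi.pos_part.ofReal⟩
  have hre : Measurable fun q => (B q).re := by fun_prop
  have him : Measurable fun q => (B q).im := by fun_prop
  have hrei : Integrable (fun q => (B q).re) (arc.prod arc) := hint.re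
  have himi : Integrable (fun q => (B q).im) (arc.prod arc) := hint.im
  obtain ⟨c1, i1⟩ := hp _ hre hrei
  obtain ⟨c2, i2⟩ := hp _ hre.neg hrei.neg
  obtain ⟨c3, i3⟩ := hp _ him himi
  obtain ⟨c4, i4⟩ := hp _ him.neg himi.neg
  filter_upwards [c1, c2, c3, c4] with z ⟨l1, h1⟩ ⟨l2, h2⟩ ⟨l3, h3⟩ ⟨l4, h4⟩
  refine ⟨l1 + -1 * l2 + (Complex.I * l3 + -Complex.I * l4), ?_⟩
  refine (((h1.add (h2.const_mul (-1))).add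
    ((h3.const_mul Complex.I).add (h4.const_mul (-Complex.I))))).congr fun r => ?_
  have j1 := i1.add (i2.const_mul (-1))
  have j2 := (i3.const_mul Complex.I).add (i4.const_mul (-Complex.I))
  rw [← pairMean_const_mul, ← pairMean_const_mul, ← pairMean_const_mul,
    ← pairMean_add i1 (i2.const_mul _), ← pairMean_add (i3.const_mul _) (i4.const_mul _)]
  refine (pairMean_add j1 j2 z).symm.trans ?_
  congr 1
  ext q
  simp only [Pi.add_apply]
  have key : ∀ x : ℝ, max x 0 - max (-x) 0 = x := fun x => by
    rcases le_total x 0 with h | h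
    · rw [max_eq_right h, max_eq_left (by linarith)]; ring
    · rw [max_eq_left h, max_eq_right (by linarith)]; ring
  have e1 := key (B q).re
  have e2 := key (B q).im
  simp only [Pi.neg_apply]
  conv_rhs => rw [← Complex.re_add_im (B q), ← e1, ← e2]
  push_cast
  ring

/-- The bound is uniform in `r` and `z`, so it can serve as the dominating constant in the limit `r
→ 0`. -/
theorem enorm_pairMean_le {B : Circle × Circle → ℂ} {M : ℝ≥0∞} {ε : ℝ} (hε : 0 < ε)
    (hM : M ≠ ⊤)
    (hB : ∀ q, ‖B q‖ₑ ≤ M * {q : Circle × Circle | ε ≤ absSin q.1 q.2}.indicator 1 q)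
    {r : ℝ} (hr : 0 < r) (z : ℂ) :
    ‖pairMean r B z‖ₑ ≤ M * ENNReal.ofReal (2 / ε) := by
  have hc : 0 < Real.pi * r ^ 2 := by positivity
  have hmS : MeasurableSet {p : Circle × Circle | ε ≤ absSin p.1 p.2} :=
    measurableSet_le measurable_const (by fun_prop)
  have hmeas : Measurable fun q : Circle × Circle =>
      {p : Circle × Circle | ε ≤ absSin p.1 p.2}.indicator (1 : Circle × Circle → ℝ≥0∞) q *
        (Metric.ball z r).indicator (1 : ℂ → ℝ≥0∞) ((q.1 : ℂ) + q.2) :=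
    (measurable_one.indicator hmS).mul ((measurable_ball_indicator z r).comp
      (by fun_prop : Measurable fun q : Circle × Circle => (q.1 : ℂ) + q.2))
  have h1 : ‖∫ q in {q : Circle × Circle | (q.1 : ℂ) + q.2 ∈ Metric.ball z r}, B q
      ∂(arc.prod arc)‖ₑ ≤ M * (ENNReal.ofReal (2 / ε) * ENNReal.ofReal (Real.pi * r ^ 2)) := by
    refine (enorm_integral_le_lintegral_enorm _).trans ?_
    rw [← lintegral_indicator (measurableSet_add_mem_ball z r)]
    calc _ ≤ ∫⁻ q, M * ({p : Circle × Circle | ε ≤ absSin p.1 p.2}.indicator 1 q *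
          (Metric.ball z r).indicator 1 ((q.1 : ℂ) + q.2)) ∂(arc.prod arc) := by
          refine lintegral_mono fun q => ?_
          by_cases h : (q.1 : ℂ) + q.2 ∈ Metric.ball z r
          · rw [Set.indicator_of_mem (by exact h), Set.indicator_of_mem h, Pi.one_apply, mul_one]
            exact hB q
          · rw [Set.indicator_of_notMem (by exact h)]
            exact zero_le
      _ = M * ∫⁻ a, ∫⁻ b, {p : Circle × Circle | ε ≤ absSin p.1 p.2}.indicator 1 (a, b) *
          (Metric.ball z r).indicator 1 ((a : ℂ) + b) ∂arc ∂arc := by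
          rw [lintegral_const_mul' _ _ hM, lintegral_prod _ hmeas.aemeasurable]
      _ ≤ _ := by
          refine mul_le_mul_right ((lintegral_indicator_add_of_le
            Metric.isOpen_ball.measurableSet hε).trans_eq ?_) _
          rw [volume_ball_eq _ hr.le]
  have h0 : ENNReal.ofReal (Real.pi * r ^ 2) ≠ 0 := by simpa using hc
  rw [pairMean, div_eq_mul_inv, enorm_mul, enorm_inv (by exact_mod_cast hc.ne'),
    show ‖((Real.pi * r ^ 2 : ℝ) : ℂ)‖ₑ = ENNReal.ofReal (Real.pi * r ^ 2) by
      rw [← ofReal_norm, Complex.norm_real, Real.norm_of_nonneg hc.le]]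
  refine (mul_le_mul_left h1 _).trans_eq ?_
  generalize ENNReal.ofReal (Real.pi * r ^ 2) = d, ENNReal.ofReal_ne_top (r := Real.pi * r ^ 2) = hd
    at h0
  rw [mul_assoc, mul_assoc, ENNReal.mul_inv_cancel h0 hd, mul_one]

theorem measurable_pairMean {B : Circle × Circle × Circle → ℂ} (hB : Measurable B) (r : ℝ) :
    Measurable fun y : ℂ × Circle => pairMean r (fun q => B (q.1, q.2, y.2)) y.1 := by
  unfold pairMean
  refine Measurable.div_const ?_ _
  have h : ∀ y : ℂ × Circle, ∫ q in {q : Circle × Circle | (q.1 : ℂ) + q.2 ∈ Metric.ball y.1 r},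
      B (q.1, q.2, y.2) ∂(arc.prod arc) = ∫ q, {z : (ℂ × Circle) × (Circle × Circle) |
        (z.2.1 : ℂ) + z.2.2 ∈ Metric.ball z.1.1 r}.indicator
        (fun z => B (z.2.1, z.2.2, z.1.2)) (y, q) ∂(arc.prod arc) := fun y => by
    rw [← integral_indicator (measurableSet_add_mem_ball y.1 r)]
    rfl
  simp only [h]
  refine (StronglyMeasurable.integral_prod_right' (Measurable.stronglyMeasurable ?_)).measurable
  exact (hB.comp (by fun_prop)).indicator (measurableSet_ball_circle (by fun_prop) (by fun_prop) r)

/-- Fubini: the mean density when two of the variables are integrated first. -/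
theorem mean_eq_integral_pairMean (τ : Equiv.Perm (Fin 5)) {B : Circle × Circle × Circle → ℂ}
    {u : Circle × Circle → ℂ} 
    (hint : Integrable (fun w : Fin 5 → Circle =>
      u (w (τ 1), w (τ 2)) * B (w (τ 3), w (τ 4), w (τ 0))) pi5) (r : ℝ) (x : Circle) :
    mean r (fun w => u (w (τ 1), w (τ 2)) * B (w (τ 3), w (τ 4), w (τ 0))) x =
      ∫ p, u p.2 * pairMean r (fun q => B (q.1, q.2, p.1)) (x - sum3 p) ∂arc3 := by
  have hS := measurableSet_sum_mem_ball x r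
  have hint' := hint.indicator hS
  have hmp := measurePreserving_join τ
  unfold mean pairMean
  simp only [← mul_div_assoc]
  rw [integral_div]
  congr 1
  rw [← integral_indicator hS, ← hmp.map_eq, integral_map hmp.measurable.aemeasurable
    (by rw [hmp.map_eq]; exact hint'.aestronglyMeasurable), integral_prod]
  · refine integral_congr_ae (Eventually.of_forall fun p => ?_)
    simp only []
    rw [← integral_const_mul, ← integral_indicator (measurableSet_add_mem_ball _ r)]
    refine integral_congr_ae (Eventually.of_forall fun q => ?_)
    have hiff : ∑ i, (join τ (p, q) i : ℂ) ∈ Metric.ball (x : ℂ) r ↔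
        (q.1 : ℂ) + q.2 ∈ Metric.ball (x - sum3 p) r := by
      rw [sum_join, mem_ball_iff_norm, mem_ball_iff_norm]
      simp only []
      rw [show sum3 p + ((q.1 : ℂ) + q.2) - x = q.1 + q.2 - (x - sum3 p) by ring]
    simp only []
    by_cases h : ∑ i, (join τ (p, q) i : ℂ) ∈ Metric.ball (x : ℂ) r
    · rw [Set.indicator_of_mem (by exact h), Set.indicator_of_mem (by exact hiff.1 h)]
      simp only [join_apply]
      rfl
    · rw [Set.indicator_of_notMem (by exact h), Set.indicator_of_notMem (by exact hiff.not.1 h)]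
  · have := hmp.integrable_comp_of_integrable hint'
    exact this

theorem measurable_mean {H : (Fin 5 → Circle) → ℂ} (hH : Measurable H) (r : ℝ) :
    Measurable (mean r H) := by
  unfold mean
  refine Measurable.div_const ?_ _
  have h : ∀ x : Circle, ∫ w in {w : Fin 5 → Circle | ∑ i, (w i : ℂ) ∈ Metric.ball (x : ℂ) r},
      H w ∂pi5 = ∫ w, {z : Circle × (Fin 5 → Circle) |
        ∑ i, (z.2 i : ℂ) ∈ Metric.ball (z.1 : ℂ) r}.indicator (fun z => H z.2) (x, w) ∂pi5 :=
    fun x => by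
      rw [← integral_indicator (measurableSet_sum_mem_ball x r)]
      rfl
  simp only [h]
  refine (StronglyMeasurable.integral_prod_right' (Measurable.stronglyMeasurable ?_)).measurable
  exact (hH.comp (by fun_prop)).indicator
    (measurableSet_ball_circle (measurable_sum5.comp measurable_snd) (by fun_prop) r)

theorem mean_add {H₁ H₂ : (Fin 5 → Circle) → ℂ} (h₁ : Integrable H₁ pi5) (h₂ : Integrable H₂ pi5)
    (r : ℝ) (x : Circle) : mean r (fun w => H₁ w + H₂ w) x = mean r H₁ x + mean r H₂ x := by
  rw [mean, integral_add h₁.integrableOn h₂.integrableOn, add_div]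
  rfl

theorem mean_sub {H₁ H₂ : (Fin 5 → Circle) → ℂ} (h₁ : Integrable H₁ pi5) (h₂ : Integrable H₂ pi5)
    (r : ℝ) (x : Circle) : mean r (fun w => H₁ w - H₂ w) x = mean r H₁ x - mean r H₂ x := by
  rw [mean, integral_sub h₁.integrableOn h₂.integrableOn, sub_div]
  rfl

/-! ### Convergence of the mean densities in `L²(S¹)`. -/

/-- The mean densities of `H` form a Cauchy net in `L²(S¹)` as the radius shrinks. -/
def CauchyMean (H : (Fin 5 → Circle) → ℂ) : Prop :=
  Tendsto (fun p : ℝ × ℝ => eLpNorm (fun x => mean p.1 H x - mean p.2 H x) 2 arc)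
    (𝓝[>] 0 ×ˢ 𝓝[>] 0) (𝓝 0)

theorem cauchyMean_add {H₁ H₂ : (Fin 5 → Circle) → ℂ} (h₁ : CauchyMean H₁) (h₂ : CauchyMean H₂)
    (m₁ : Measurable H₁) (m₂ : Measurable H₂) (i₁ : Integrable H₁ pi5) (i₂ : Integrable H₂ pi5) :
    CauchyMean fun w => H₁ w + H₂ w := by
  unfold CauchyMean at h₁ h₂ ⊢
  have h := h₁.add h₂
  rw [add_zero] at h
  refine tendsto_of_tendsto_of_tendsto_of_le_of_le tendsto_const_nhds h (fun _ => zero_le)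
    fun p => ?_
  refine le_trans (le_of_eq ?_) (eLpNorm_add_le
    (((measurable_mean m₁ p.1).sub (measurable_mean m₁ p.2)).aestronglyMeasurable)
    (((measurable_mean m₂ p.1).sub (measurable_mean m₂ p.2)).aestronglyMeasurable) (by norm_num))
  congr 1
  ext x
  simp only [Pi.add_apply, mean_add i₁ i₂]
  ring

theorem CauchyMean.of_approx {H : (Fin 5 → Circle) → ℂ} (hm : Measurable H)
    (h : ∀ δ : ℝ≥0∞, 0 < δ → ∃ H', Measurable H' ∧ CauchyMean H' ∧
      ∀ᶠ r in 𝓝[>] (0 : ℝ), eLpNorm (fun x => mean r H x - mean r H' x) 2 arc ≤ δ) :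
    CauchyMean H := by
  refine ENNReal.tendsto_nhds_zero.2 fun ε hε => ?_
  have h3 : 0 < ε / 3 := ENNReal.div_pos hε.ne' (by norm_num)
  obtain ⟨H', hm', hc, hr⟩ := h (ε / 3) h3
  filter_upwards [hr.prod_mk hr, ENNReal.tendsto_nhds_zero.1 hc _ h3] with p hp hp'
  have m := fun r => measurable_mean hm r
  have m' := fun r => measurable_mean hm' r
  have e : (fun x => mean p.1 H x - mean p.2 H x) =
      (fun x => mean p.1 H x - mean p.1 H' x) + ((fun x => mean p.1 H' x - mean p.2 H' x) +
        -(fun x => mean p.2 H x - mean p.2 H' x)) := by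
    ext x
    simp only [Pi.add_apply, Pi.neg_apply]
    ring
  rw [e]
  refine (eLpNorm_add_le ((m _).sub (m' _)).aestronglyMeasurable
    (((m' _).sub (m' _)).aestronglyMeasurable.add ((m _).sub (m' _)).aestronglyMeasurable.neg)
    (by norm_num)).trans ?_
  refine (add_le_add le_rfl (eLpNorm_add_le ((m' _).sub (m' _)).aestronglyMeasurable
    ((m _).sub (m' _)).aestronglyMeasurable.neg (by norm_num))).trans ?_
  rw [eLpNorm_neg]
  refine (add_le_add hp.1 (add_le_add hp' hp.2)).trans_eq ?_
  rw [← add_assoc, ENNReal.add_thirds]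

/-- The difference of two mean densities of `B(·, ·, p₁)` about the point `x - (p₁ + p₂ + p₃)`. -/
def pairDiff (r s : ℝ) (B : Circle × Circle × Circle → ℂ)
    (y : Circle × (Circle × Circle × Circle)) : ℂ :=
  pairMean r (fun q => B (q.1, q.2, y.2.1)) (y.1 - sum3 y.2) -
    pairMean s (fun q => B (q.1, q.2, y.2.1)) (y.1 - sum3 y.2)

theorem measurable_pairMean_sub {B : Circle × Circle × Circle → ℂ} (hB : Measurable B) (r : ℝ) :
    Measurable fun y : Circle × (Circle × Circle × Circle) =>
      pairMean r (fun q => B (q.1, q.2, y.2.1)) (y.1 - sum3 y.2) := by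
  have hy : Measurable fun y : Circle × (Circle × Circle × Circle) =>
      (((y.1 : ℂ) - sum3 y.2, y.2.1) : ℂ × Circle) := by
    refine Measurable.prodMk (Measurable.sub ?_ (measurable_sum3.comp measurable_snd)) ?_ <;>
      fun_prop
  have h := (measurable_pairMean hB r).comp hy
  simp only [Function.comp_def] at h
  exact h

theorem measurable_pairDiff {B : Circle × Circle × Circle → ℂ} (hB : Measurable B) (r s : ℝ) :
    Measurable (pairDiff r s B) :=
  (measurable_pairMean_sub hB r).sub (measurable_pairMean_sub hB s)

/-- Differentiation fails only on a Lebesgue null set of centres, which depends on `p₁`. With `p₁`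
and `p₂` fixed, the centre `x - p₁ - p₂ - p₃` still moves with two points of the circle, and a sum
of two such points almost surely avoids a null set. -/
theorem ae_ae_tendsto_pairDiff {B : Circle × Circle × Circle → ℂ} (hB : Measurable B)
    (hint : ∀ c, Integrable (fun q : Circle × Circle => B (q.1, q.2, c)) (arc.prod arc))
    {r s : ℕ → ℝ} (hr : Tendsto r atTop (𝓝[>] 0)) (hs : Tendsto s atTop (𝓝[>] 0)) :
    ∀ᵐ x ∂arc, ∀ᵐ p ∂arc3, Tendsto (fun n => pairDiff (r n) (s n) B (x, p)) atTop (𝓝 0) := by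
  have hG : MeasurableSet {y | Tendsto (fun n => pairDiff (r n) (s n) B y) atTop (𝓝 0)} :=
    measurableSet_tendsto _ fun n => measurable_pairDiff hB (r n) (s n)
  obtain ⟨G, hGd⟩ : ∃ G : Set (Circle × (Circle × Circle × Circle)),
    G = {y | Tendsto (fun n => pairDiff (r n) (s n) B y) atTop (𝓝 0)} := ⟨_, rfl⟩
  rw [Measure.ae_ae_comm hG]
  rw [← hGd] at hG
  have hm : Measurable fun p : Circle × Circle × Circle =>
      arc ((fun x : Circle => (x, p)) ⁻¹' Gᶜ) :=
    measurable_measure_prodMk_right hG.compl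
  have h0 : ∫⁻ p, arc ((fun x : Circle => (x, p)) ⁻¹' Gᶜ) ∂arc3
      = 0 := by
    rw [lintegral_arc3 hm]
    have hcd : ∀ c d, ∫⁻ e, arc ((fun x : Circle => (x, (c, d, e))) ⁻¹' Gᶜ) ∂arc = 0 := fun c d => by
      have hm' := hm.comp (by fun_prop : Measurable fun e : Circle => (c, d, e))
      simp only [Function.comp_def] at hm'
      rw [lintegral_eq_zero_iff hm']
      have hz := exists_tendsto_pairMean (hB.comp (by fun_prop :
        Measurable fun q : Circle × Circle => (q.1, q.2, c))) (hint c)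
      have hz' : ∀ᵐ z : ℂ, ∃ l, Tendsto (fun r =>
          pairMean r (fun q => B (q.1, q.2, c)) (z + -(c + d : ℂ))) (𝓝[>] 0) (𝓝 l) :=
        (measurePreserving_add_right volume (-(c + d : ℂ))).quasiMeasurePreserving.ae hz
      have h1 := Measure.ae_ae_of_ae_prod (ae_add_notMem (ae_iff.1 hz'))
      -- The centre involves `x - e`, so the sum of two points is taken at `-e` and `x`.
      have h2 := (measurePreserving_mul_left (-1)).quasiMeasurePreserving.ae h1
      filter_upwards [h2] with e he
      refine measure_mono_null ?_ (ae_iff.1 he)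
      intro x hx hx'
      refine hx ?_
      rw [hGd]
      simp only [not_not] at hx'
      obtain ⟨l, hl⟩ := hx'
      have := (hl.comp hr).sub (hl.comp hs)
      rw [sub_self] at this
      refine this.congr fun n => ?_
      have e1 : ((-1 * e : Circle) : ℂ) + x + -(c + d : ℂ) = x - sum3 (c, d, e) := by
        rw [coe_neg_one_mul, sum3]
        ring
      simp only [Function.comp_apply, pairDiff]
      rw [e1]
    simp only [hcd, lintegral_zero]
  rw [lintegral_eq_zero_iff hm] at h0
  filter_upwards [h0] with p hp
  rw [ae_iff]
  rw [hGd] at hp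
  exact hp

theorem norm_le_of_enorm_le {z : ℂ} {M : ℝ≥0} (h : ‖z‖ₑ ≤ M) : ‖z‖ ≤ M := by
  rwa [← enorm_norm, Real.enorm_of_nonneg (norm_nonneg _), ENNReal.ofReal_le_coe] at h

theorem tendsto_eLpNorm_two_zero {α : Type*} [MeasurableSpace α] {μ : Measure α}
    [IsFiniteMeasure μ] {f : ℕ → α → ℂ} (hf : ∀ n, Measurable (f n)) {K : ℝ}
    (hK : ∀ᶠ n in atTop, ∀ x, ‖f n x‖ ≤ K) (h : ∀ᵐ x ∂μ, Tendsto (fun n => f n x) atTop (𝓝 0)) :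
    Tendsto (fun n => eLpNorm (f n) 2 μ) atTop (𝓝 0) := by
  simp only [eLpNorm_two_eq_l2]
  unfold l2
  have h0 : (0 : ℝ≥0∞) = (∫⁻ _ : α, 0 ∂μ) ^ (2⁻¹ : ℝ) := by simp
  rw [h0]
  refine Tendsto.ennrpow_const _ ?_
  refine tendsto_lintegral_filter_of_dominated_convergence (fun _ => ENNReal.ofReal K ^ 2)
    (Eventually.of_forall fun n => (hf n).enorm.pow_const 2) ?_ ?_ ?_
  · filter_upwards [hK] with n hn
    refine Eventually.of_forall fun x => ?_
    rw [← enorm_norm, Real.enorm_of_nonneg (norm_nonneg _)]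
    exact pow_le_pow_left₀ zero_le (ENNReal.ofReal_le_ofReal (hn x)) 2
  · rw [lintegral_const]
    exact ENNReal.mul_ne_top (by simp) (measure_ne_top _ _)
  · filter_upwards [h] with x hx
    have h2 := ENNReal.Tendsto.pow (n := 2) hx.enorm
    simpa using h2

/-- After the transversal pair is integrated out, the difference of two means is an integral of
`pairDiff`, which is bounded and tends to 0 almost everywhere. Dominated convergence is used in the
other three variables and then in `x`. -/
theorem cauchyMean_of_transversal (τ : Equiv.Perm (Fin 5)) {B : Circle × Circle × Circle → ℂ}
    {u : Circle × Circle → ℂ} (hB : Measurable B) (hu : Measurable u) {M : ℝ≥0} {ε : ℝ}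
    (hε : 0 < ε) (huM : ∀ q, ‖u q‖ₑ ≤ M)
    (hBM : ∀ q, ‖B q‖ₑ ≤ M * {q : Circle × Circle | ε ≤ absSin q.1 q.2}.indicator 1 (q.1, q.2.1)) :
    CauchyMean fun w => u (w (τ 1), w (τ 2)) * B (w (τ 3), w (τ 4), w (τ 0)) := by
  have hBM' : ∀ q, ‖B q‖ₑ ≤ M := fun q => (hBM q).trans <| by
    refine (mul_le_mul_right (Set.indicator_le_self _ _ _) _).trans ?_
    simp
  have hint : Integrable (fun w : Fin 5 → Circle =>
      u (w (τ 1), w (τ 2)) * B (w (τ 3), w (τ 4), w (τ 0))) pi5 := by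
    refine Integrable.of_bound (C := M * M) (by fun_prop) (Eventually.of_forall fun w => ?_)
    rw [norm_mul]
    exact mul_le_mul (norm_le_of_enorm_le (huM _)) (norm_le_of_enorm_le (hBM' _)) (norm_nonneg _)
      M.2
  have hintB : ∀ c, Integrable (fun q : Circle × Circle => B (q.1, q.2, c)) (arc.prod arc) :=
    fun c => by
      exact Integrable.of_bound (C := M) (hB.comp (by fun_prop)).aestronglyMeasurable
        (Eventually.of_forall fun w => norm_le_of_enorm_le (hBM' _))
  unfold CauchyMean
  -- Sequences suffice, as the filter is countably generated; almost everywhere statements then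
  -- involve only countably many radii.
  refine tendsto_of_seq_tendsto fun v hv => ?_
  obtain ⟨r, hrv⟩ : ∃ r : ℕ → ℝ, r = fun n => (v n).1 := ⟨_, rfl⟩
  obtain ⟨s, hsv⟩ : ∃ s : ℕ → ℝ, s = fun n => (v n).2 := ⟨_, rfl⟩
  have hr : Tendsto r atTop (𝓝[>] 0) := hrv ▸ tendsto_fst.comp hv
  have hs : Tendsto s atTop (𝓝[>] 0) := hsv ▸ tendsto_snd.comp hv
  have hae := ae_ae_tendsto_pairDiff hB hintB hr hs
  set K : ℝ≥0 := 2 * (M * Real.toNNReal (2 / ε)) with hK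
  have hpb : ∀ (t : ℝ), 0 < t → ∀ (c : Circle) (z : ℂ),
      ‖pairMean t (fun q => B (q.1, q.2, c)) z‖ ≤ M * Real.toNNReal (2 / ε) := fun t ht c z => by
    have := enorm_pairMean_le (B := fun q => B (q.1, q.2, c)) hε ENNReal.coe_ne_top
      (fun q => hBM (q.1, q.2, c)) ht z
    rw [← enorm_norm, Real.enorm_of_nonneg (norm_nonneg _), ENNReal.ofReal, ENNReal.ofReal,
      ← ENNReal.coe_mul, ENNReal.coe_le_coe, Real.toNNReal_le_iff_le_coe] at this
    exact_mod_cast this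
  have hpm : ∀ (t : ℝ) (x : Circle), Measurable fun p : Circle × Circle × Circle =>
      pairMean t (fun q => B (q.1, q.2, p.1)) (x - sum3 p) := fun t x => by
    have h := (measurable_pairMean_sub hB t).comp
      (by fun_prop : Measurable fun p : Circle × Circle × Circle => (x, p))
    simp only [Function.comp_def] at h
    exact h
  have hDb : ∀ᶠ n in atTop, ∀ x p, ‖u p.2 * pairDiff (r n) (s n) B (x, p)‖ ≤ M * K := by
    filter_upwards [hr self_mem_nhdsWithin, hs self_mem_nhdsWithin] with n hn hn' x p
    rw [norm_mul]
    have h1 := norm_le_of_enorm_le (huM p.2)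
    refine mul_le_mul h1 ?_ (norm_nonneg _) M.2
    refine (norm_sub_le _ _).trans ((add_le_add (hpb _ hn _ _) (hpb _ hn' _ _)).trans_eq ?_)
    rw [hK]
    push_cast
    ring
  have hui : ∀ t, 0 < t → ∀ x : Circle, Integrable (fun p : Circle × Circle × Circle => u p.2 *
      pairMean t (fun q => B (q.1, q.2, p.1)) (x - sum3 p)) arc3 := fun t ht x => by
    refine Integrable.of_bound (C := M * (M * Real.toNNReal (2 / ε)))
      (((hu.comp measurable_snd).mul (hpm t x)).aestronglyMeasurable)
      (Eventually.of_forall fun p => ?_)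
    rw [norm_mul]
    have h1 := norm_le_of_enorm_le (huM p.2)
    exact mul_le_mul h1 (hpb t ht _ _) (norm_nonneg _) M.2
  have hdiff : ∀ᶠ n in atTop, ∀ x,
      mean (r n) (fun w => u (w (τ 1), w (τ 2)) * B (w (τ 3), w (τ 4), w (τ 0))) x -
      mean (s n) (fun w => u (w (τ 1), w (τ 2)) * B (w (τ 3), w (τ 4), w (τ 0))) x =
      ∫ p, u p.2 * pairDiff (r n) (s n) B (x, p) ∂arc3 := by
    filter_upwards [hr self_mem_nhdsWithin, hs self_mem_nhdsWithin] with n hn hn' x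
    rw [mean_eq_integral_pairMean τ hint, mean_eq_integral_pairMean τ hint,
      ← integral_sub (hui _ hn x) (hui _ hn' x)]
    simp only [pairDiff, mul_sub]
  have hpt : ∀ᵐ x ∂arc, Tendsto (fun n => ∫ p, u p.2 * pairDiff (r n) (s n) B (x, p) ∂arc3) atTop (𝓝 0) := by
    filter_upwards [hae] with x hx
    have := tendsto_integral_filter_of_dominated_convergence (μ := arc3) (l := atTop)
      (F := fun n p => u p.2 * pairDiff (r n) (s n) B (x, p)) (f := fun _ => 0)
      (fun _ => (M * K : ℝ)) (Eventually.of_forall fun n => ((hu.comp measurable_snd).mul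
        ((hpm _ x).sub (hpm _ x))).aestronglyMeasurable)
      (hDb.mono fun n hn => Eventually.of_forall fun p => hn x p) (integrable_const _) ?_
    · simpa using this
    · filter_upwards [hx] with p hp
      simpa using hp.const_mul (u p.2)
  have hmm := fun t => measurable_mean
    (H := fun w => u (w (τ 1), w (τ 2)) * B (w (τ 3), w (τ 4), w (τ 0))) (by fun_prop) t
  have hgoal : (fun n => eLpNorm (fun x => mean (r n)
      (fun w => u (w (τ 1), w (τ 2)) * B (w (τ 3), w (τ 4), w (τ 0))) x - mean (s n)
      (fun w => u (w (τ 1), w (τ 2)) * B (w (τ 3), w (τ 4), w (τ 0))) x) 2 arc) =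
    (fun p : ℝ × ℝ => eLpNorm (fun x => mean p.1
      (fun w => u (w (τ 1), w (τ 2)) * B (w (τ 3), w (τ 4), w (τ 0))) x - mean p.2
      (fun w => u (w (τ 1), w (τ 2)) * B (w (τ 3), w (τ 4), w (τ 0))) x) 2 arc) ∘ v := by
    rw [hrv, hsv]
    rfl
  rw [← hgoal]
  refine tendsto_eLpNorm_two_zero (K := M * K * arc3.real Set.univ)
    (fun n => (hmm (r n)).sub (hmm (s n))) ?_ ?_
  · filter_upwards [hdiff, hDb] with n hn hb x
    refine (congrArg norm (hn x)).trans_le ?_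
    exact norm_integral_le_of_norm_le_const (Eventually.of_forall (hb x))
  · filter_upwards [hpt] with x hx
    exact hx.congr' (hdiff.mono fun n hn => (hn x).symm)

theorem memLp_two_of_bound {f : Fin 5 → Circle → ℂ} (hm : ∀ i, Measurable (f i)) {M : ℝ≥0}
    (hM : ∀ i x, ‖f i x‖ₑ ≤ M) : ∀ i, MemLp (f i) 2 arc := fun i =>
  MemLp.of_bound (hm i).aestronglyMeasurable M
    (Eventually.of_forall fun x => norm_le_of_enorm_le (hM i x))

/-- The set `S` may restrict one point besides the transversal pair. This allows the torus to be cut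
into disjoint pieces. -/
theorem cauchyMean_indicator_tensor (τ : Equiv.Perm (Fin 5)) {f : Fin 5 → Circle → ℂ}
    (hm : ∀ i, Measurable (f i)) {M : ℝ≥0} (hM : ∀ i x, ‖f i x‖ₑ ≤ M) {ε : ℝ} (hε : 0 < ε)
    {S : Set (Circle × Circle × Circle)} (hS : MeasurableSet S)
    (hSε : ∀ q ∈ S, ε ≤ absSin q.1 q.2.1) :
    CauchyMean fun w => S.indicator 1 (w (τ 3), w (τ 4), w (τ 0)) * ∏ i, f i (w i) := by
  have h := cauchyMean_of_transversal τ
    (B := fun q => S.indicator 1 q * (f (τ 3) q.1 * f (τ 4) q.2.1 * f (τ 0) q.2.2))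
    (u := fun q => f (τ 1) q.1 * f (τ 2) q.2) (M := max (M ^ 2) (M ^ 3)) (ε := ε)
    ((measurable_one.indicator hS).mul (by fun_prop)) (by fun_prop) hε (fun q => ?_) (fun q => ?_)
  · refine Eq.mp ?_ h
    congr 1
    ext w
    rw [← Equiv.prod_comp τ, Fin.prod_univ_five]
    ring
  · rw [enorm_mul]
    refine (mul_le_mul' (hM _ _) (hM _ _)).trans ?_
    rw [← ENNReal.coe_mul, ENNReal.coe_le_coe, ← sq]
    exact le_max_left _ _
  · by_cases hq : q ∈ S
    · rw [Set.indicator_of_mem hq, Set.indicator_of_mem (by exact hSε q hq), Pi.one_apply,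
        Pi.one_apply, one_mul, mul_one, enorm_mul, enorm_mul]
      refine (mul_le_mul' (mul_le_mul' (hM _ _) (hM _ _)) (hM _ _)).trans ?_
      rw [← ENNReal.coe_mul, ← ENNReal.coe_mul, ENNReal.coe_le_coe, ← pow_three']
      exact le_max_right _ _
    · rw [Set.indicator_of_notMem hq, zero_mul, enorm_zero]
      exact zero_le

theorem cauchyMean_tensor_of_bound {f : Fin 5 → Circle → ℂ} (hm : ∀ i, Measurable (f i)) {M : ℝ≥0}
    (hM : ∀ i x, ‖f i x‖ₑ ≤ M) : CauchyMean fun w => ∏ i, f i (w i) := by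
  have hf := memLp_two_of_bound hm hM
  refine CauchyMean.of_approx (measurable_tensor hm) fun δ hδ => ?_
  have hlim : Tendsto (fun ε => meanConst * ((M ^ 5 : ℝ≥0) * nearParallelBound ε)) (𝓝[>] 0)
      (𝓝 0) := by
    have := ENNReal.Tendsto.const_mul (ENNReal.Tendsto.const_mul tendsto_nearParallelBound
      (.inr (ENNReal.coe_ne_top (r := M ^ 5)))) (.inr meanConst_ne_top)
    simpa using this
  obtain ⟨ε, hε', hε⟩ := (((ENNReal.tendsto_nhds_zero.1 hlim) δ hδ).and self_mem_nhdsWithin).exists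
  have hε : 0 < ε := hε
  have mlt : ∀ {g h : Circle × Circle × Circle → Circle}, Measurable g → Measurable h →
    MeasurableSet {q | absSin (g q) (h q) < ε} := fun hg hh => measurableSet_absSin_lt hg hh ε
  have mle : ∀ {g h : Circle × Circle × Circle → Circle}, Measurable g → Measurable h →
    MeasurableSet {q | ε ≤ absSin (g q) (h q)} := fun hg hh =>
      measurableSet_le measurable_const (by fun_prop)
  -- Slots 3 and 4 receive the pairs (0,1), (1,2), (0,2) in turn, and slot 0 the remaining index
  -- among 0, 1, 2. Each piece requires its own pair to be transversal and the earlier pairs not to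
  -- be, so the three pieces are disjoint and miss exactly `nearParallel₅ ε`.
  let τ₀ : Equiv.Perm (Fin 5) := Equiv.ofBijective ![2, 3, 4, 0, 1] (by decide)
  let τ₁ : Equiv.Perm (Fin 5) := Equiv.ofBijective ![0, 3, 4, 1, 2] (by decide)
  let τ₂ : Equiv.Perm (Fin 5) := Equiv.ofBijective ![1, 3, 4, 0, 2] (by decide)
  obtain ⟨S₀, hS₀⟩ : ∃ S : Set (Circle × Circle × Circle), S = {q | ε ≤ absSin q.1 q.2.1} :=
    ⟨_, rfl⟩
  obtain ⟨S₁, hS₁⟩ : ∃ S : Set (Circle × Circle × Circle),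
    S = {q | ε ≤ absSin q.1 q.2.1} ∩ {q | absSin q.2.2 q.1 < ε} := ⟨_, rfl⟩
  obtain ⟨S₂, hS₂⟩ : ∃ S : Set (Circle × Circle × Circle),
    S = {q | ε ≤ absSin q.1 q.2.1} ∩ ({q | absSin q.1 q.2.2 < ε} ∩
      {q | absSin q.2.2 q.2.1 < ε}) := ⟨_, rfl⟩
  have m₀ : MeasurableSet S₀ := hS₀ ▸ mle (by fun_prop) (by fun_prop)
  have m₁ : MeasurableSet S₁ := hS₁ ▸ (mle (by fun_prop) (by fun_prop)).inter
    (mlt (by fun_prop) (by fun_prop))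
  have m₂ : MeasurableSet S₂ := hS₂ ▸ (mle (by fun_prop) (by fun_prop)).inter
    ((mlt (by fun_prop) (by fun_prop)).inter (mlt (by fun_prop) (by fun_prop)))
  have c₀ := cauchyMean_indicator_tensor τ₀ hm hM hε m₀ (by rw [hS₀]; exact fun q h => h)
  have c₁ := cauchyMean_indicator_tensor τ₁ hm hM hε m₁ (by rw [hS₁]; exact fun q h => h.1)
  have c₂ := cauchyMean_indicator_tensor τ₂ hm hM hε m₂ (by rw [hS₂]; exact fun q h => h.1)
  have hmeas : ∀ {τ : Equiv.Perm (Fin 5)} {S : Set (Circle × Circle × Circle)},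
      MeasurableSet S → Measurable fun w : Fin 5 → Circle =>
        S.indicator (1 : Circle × Circle × Circle → ℂ) (w (τ 3), w (τ 4), w (τ 0)) *
          ∏ i, f i (w i) := fun hS => ((measurable_one.indicator hS).comp
      (by fun_prop : Measurable fun w : Fin 5 → Circle => (w _, w _, w _))).mul
        (measurable_tensor hm)
  have hind : ∀ {S : Set (Circle × Circle × Circle)} (q),
      ‖S.indicator (1 : Circle × Circle × Circle → ℂ) q‖ ≤ 1 := fun {S} q => by
    by_cases h : q ∈ S <;> simp [h]
  have hint : ∀ {τ : Equiv.Perm (Fin 5)} {S : Set (Circle × Circle × Circle)},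
      MeasurableSet S → Integrable (fun w : Fin 5 → Circle =>
        S.indicator (1 : Circle × Circle × Circle → ℂ) (w (τ 3), w (τ 4), w (τ 0)) *
          ∏ i, f i (w i)) pi5 := fun hS => (integrable_tensor hf).mono
      (hmeas hS).aestronglyMeasurable (Eventually.of_forall fun w => by
        rw [norm_mul]
        exact mul_le_of_le_one_left (norm_nonneg _) (hind _))
  have c₀₁ := cauchyMean_add c₀ c₁ (hmeas m₀) (hmeas m₁) (hint m₀) (hint m₁)
  have c := cauchyMean_add c₀₁ c₂ ((hmeas m₀).add (hmeas m₁)) (hmeas m₂)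
    ((hint m₀).add (hint m₁)) (hint m₂)
  have hmc := ((hmeas (τ := τ₀) m₀).add (hmeas (τ := τ₁) m₁)).add (hmeas (τ := τ₂) m₂)
  have hic := ((hint (τ := τ₀) m₀).add (hint (τ := τ₁) m₁)).add (hint (τ := τ₂) m₂)
  refine ⟨_, hmc, c, ?_⟩
  filter_upwards [Ioc_mem_nhdsGT one_pos] with r hr
  refine le_trans (le_of_eq ?_) ((eLpNorm_mean_nearParallel_le
    (H := fun w => (∏ i, f i (w i)) - _) (M := (M ^ 5 : ℝ≥0)) (ε := ε)
    ((measurable_tensor hm).sub hmc) ((integrable_tensor hf).sub hic) ENNReal.coe_ne_top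
    (fun w => ?_) hr.1 hr.2).trans hε')
  · congr 1
    ext x
    exact (mean_sub (integrable_tensor hf) hic r x).symm
  · have hP : ‖∏ i, f i (w i)‖ₑ ≤ (M ^ 5 : ℝ≥0) := by
      rw [Fin.prod_univ_five]
      simp only [enorm_mul]
      refine (mul_le_mul' (mul_le_mul' (mul_le_mul' (mul_le_mul' (hM _ _) (hM _ _)) (hM _ _))
        (hM _ _)) (hM _ _)).trans_eq ?_
      push_cast
      ring
    have e₀ : (w (τ₀ 3), w (τ₀ 4), w (τ₀ 0)) ∈ S₀ ↔ ε ≤ absSin (w 0) (w 1) := by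
      rw [hS₀]; rfl
    have e₁ : (w (τ₁ 3), w (τ₁ 4), w (τ₁ 0)) ∈ S₁ ↔
        ε ≤ absSin (w 1) (w 2) ∧ absSin (w 0) (w 1) < ε := by
      rw [hS₁]; rfl
    have e₂ : (w (τ₂ 3), w (τ₂ 4), w (τ₂ 0)) ∈ S₂ ↔
        ε ≤ absSin (w 0) (w 2) ∧ absSin (w 0) (w 1) < ε ∧ absSin (w 1) (w 2) < ε := by
      rw [hS₂]; rfl
    have eN : w ∈ nearParallel₅ ε ↔
        absSin (w 0) (w 1) < ε ∧ absSin (w 1) (w 2) < ε ∧ absSin (w 0) (w 2) < ε := Iff.rfl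
    change ‖(∏ i, f i (w i)) - (S₀.indicator 1 (w (τ₀ 3), w (τ₀ 4), w (τ₀ 0)) * ∏ i, f i (w i) +
        S₁.indicator 1 (w (τ₁ 3), w (τ₁ 4), w (τ₁ 0)) * ∏ i, f i (w i) +
      S₂.indicator 1 (w (τ₂ 3), w (τ₂ 4), w (τ₂ 0)) * ∏ i, f i (w i))‖ₑ ≤ _
    generalize ∏ i, f i (w i) = P at hP ⊢
    classical
    simp only [Set.indicator_apply, e₀, e₁, e₂, eN, Pi.one_apply]
    by_cases h0 : ε ≤ absSin (w 0) (w 1)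
    · simp [h0, not_lt.2 h0]
    · by_cases h1 : ε ≤ absSin (w 1) (w 2)
      · simp [h0, h1, not_lt.2 h1, not_le.1 h0]
      · by_cases h2 : ε ≤ absSin (w 0) (w 2)
        · simp [h0, h1, h2, not_lt.2 h2, not_le.1 h0, not_le.1 h1]
        · simp only [h0, h1, h2, not_le.1 h0, not_le.1 h1, not_le.1 h2]
          simpa using hP

theorem prod_update_apply (f : Fin 5 → Circle → ℂ) (j : Fin 5) (g : Circle → ℂ)
    (w : Fin 5 → Circle) : ∏ i, Function.update f j g i (w i) =
      g (w j) * ∏ i ∈ Finset.univ.erase j, f i (w i) := by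
  rw [← Finset.mul_prod_erase _ _ (Finset.mem_univ j), Function.update_self]
  congr 1
  refine Finset.prod_congr rfl fun i hi => ?_
  rw [Function.update_of_ne (Finset.ne_of_mem_erase hi)]

theorem prod_eLpNorm_update (f : Fin 5 → Circle → ℂ) (j : Fin 5) (g : Circle → ℂ) :
    ∏ i, eLpNorm (Function.update f j g i) 2 arc =
      eLpNorm g 2 arc * ∏ i ∈ Finset.univ.erase j, eLpNorm (f i) 2 arc := by
  rw [← Finset.mul_prod_erase _ _ (Finset.mem_univ j), Function.update_self]
  congr 1
  refine Finset.prod_congr rfl fun i hi => ?_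
  rw [Function.update_of_ne (Finset.ne_of_mem_erase hi)]

theorem forall_update {P : (Circle → ℂ) → Prop} {f : Fin 5 → Circle → ℂ} (hf : ∀ i, P (f i))
    (j : Fin 5) {g : Circle → ℂ} (hg : P g) (i : Fin 5) : P (Function.update f j g i) := by
  by_cases h : i = j
  · subst h
    rwa [Function.update_self]
  · rw [Function.update_of_ne h]
    exact hf i

/-- Mean densities of a tensor product of `L²` functions are Cauchy in `L²(S¹)`. -/
theorem cauchyMean_tensor {f : Fin 5 → Circle → ℂ} (hm : ∀ i, Measurable (f i))
    (hf : ∀ i, MemLp (f i) 2 arc) : CauchyMean fun w => ∏ i, f i (w i) := by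
  -- Induction on a set `S` of indices outside which the factors are bounded. Each step replaces one
  -- possibly unbounded factor by a simple function, and the uniform `L²` bound controls the error.
  suffices h : ∀ (S : Finset (Fin 5)) (f : Fin 5 → Circle → ℂ), (∀ i, Measurable (f i)) →
      (∀ i, MemLp (f i) 2 arc) → (∀ i ∉ S, ∃ M : ℝ≥0, ∀ x, ‖f i x‖ₑ ≤ M) →
      CauchyMean fun w => ∏ i, f i (w i) from
    h Finset.univ f hm hf fun i hi => absurd (Finset.mem_univ i) hi
  intro S
  induction S using Finset.induction_on with
  | empty =>
    intro f hm _ hb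
    choose M hM using fun i => hb i (Finset.notMem_empty i)
    exact cauchyMean_tensor_of_bound hm (M := ∑ i, M i) fun i x => (hM i x).trans
      (ENNReal.coe_le_coe.2 (Finset.single_le_sum (f := M) (fun _ _ => zero_le) (Finset.mem_univ i)))
  | insert j S hj ih =>
    intro f hm hf hb
    refine CauchyMean.of_approx (measurable_tensor hm) fun δ hδ => ?_
    have hfin : meanConst * ∏ i ∈ Finset.univ.erase j, eLpNorm (f i) 2 arc ≠ ⊤ :=
      ENNReal.mul_ne_top meanConst_ne_top (ENNReal.prod_ne_top fun i _ => (hf i).2.ne)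
    set A := meanConst * ∏ i ∈ Finset.univ.erase j, eLpNorm (f i) 2 arc with hA
    -- The denominator `A + 1` keeps the tolerance meaningful when `A = 0`.
    obtain ⟨g, hg, hgm⟩ := (hf j).exists_simpleFunc_eLpNorm_sub_lt (by norm_num)
      (ε := δ / (A + 1)) (ENNReal.div_pos hδ.ne' (by finiteness)).ne'
    have m' := forall_update (P := Measurable) hm j g.measurable
    have l' := forall_update (P := fun h => MemLp h 2 arc) hf j hgm
    have m'' := forall_update (P := Measurable) hm j ((hm j).sub g.measurable)
    have l'' := forall_update (P := fun h => MemLp h 2 arc) hf j ((hf j).sub hgm)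
    refine ⟨_, measurable_tensor m', ih _ m' l' fun i hi => ?_, ?_⟩
    · by_cases h : i = j
      · subst h
        rw [Function.update_self]
        obtain ⟨C, hC⟩ := g.exists_forall_norm_le
        refine ⟨C.toNNReal, fun x => ?_⟩
        rw [← enorm_norm, Real.enorm_of_nonneg (norm_nonneg _)]
        exact ENNReal.ofReal_le_ofReal (hC x)
      · rw [Function.update_of_ne h]
        exact hb i (by simp [h, hi])
    · filter_upwards [Ioc_mem_nhdsGT one_pos] with r hr
      have hbd := eLpNorm_mean_tensor_le m'' l'' hr.1 hr.2
      have e : (fun w : Fin 5 → Circle => ∏ i, Function.update f j (f j - ⇑g) i (w i)) =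
          fun w => (∏ i, f i (w i)) - ∏ i, Function.update f j (⇑g) i (w i) := by
        ext w
        rw [prod_update_apply, prod_update_apply, ← Finset.mul_prod_erase _ _ (Finset.mem_univ j),
          Pi.sub_apply, sub_mul]
      rw [e, prod_eLpNorm_update] at hbd
      have e2 : (fun x => mean r (fun w => ∏ i, f i (w i)) x -
          mean r (fun w => ∏ i, Function.update f j (⇑g) i (w i)) x) =
          mean r fun w => (∏ i, f i (w i)) - ∏ i, Function.update f j (⇑g) i (w i) := by
        ext x
        exact (mean_sub (integrable_tensor hf) (integrable_tensor l') r x).symm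
      rw [e2]
      refine hbd.trans ?_
      rw [mul_left_comm, ← hA]
      calc _ ≤ δ / (A + 1) * (A + 1) := mul_le_mul' hg.le le_self_add
        _ ≤ δ := (ENNReal.div_mul_cancel (by simp) (by finiteness)).le

/-! ### The limit density: existence, uniqueness, linearity and rotations. -/

/-- The tensor product `f₁ ⊗ ⋯ ⊗ f₅`. -/
def tensor (f : Fin 5 → Circle → ℂ) (w : Fin 5 → Circle) : ℂ := ∏ i, f i (w i)

theorem tensor_congr {f g : Fin 5 → Circle → ℂ} (h : ∀ i, f i =ᵐ[arc] g i) :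
    tensor f =ᵐ[pi5] tensor g := by
  have h' : ∀ i, ∀ᵐ w ∂pi5, f i (w i) = g i (w i) := fun i =>
    (Measure.quasiMeasurePreserving_eval (μ := fun _ : Fin 5 => arc) i).ae (h i)
  filter_upwards [ae_all_iff.2 h'] with w hw
  exact Finset.prod_congr rfl fun i _ => hw i

theorem mean_congr {H H' : (Fin 5 → Circle) → ℂ} (h : H =ᵐ[pi5] H') (r : ℝ) :
    mean r H = mean r H' := by
  ext x
  rw [mean, mean, integral_congr_ae (ae_restrict_of_ae h)]

theorem exists_measurable_rep {f : Fin 5 → Circle → ℂ} (hf : ∀ i, MemLp (f i) 2 arc) :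
    ∃ g : Fin 5 → Circle → ℂ, (∀ i, Measurable (g i)) ∧ (∀ i, MemLp (g i) 2 arc) ∧
      ∀ i, f i =ᵐ[arc] g i :=
  ⟨fun i => (hf i).1.mk (f i), fun i => (hf i).1.stronglyMeasurable_mk.measurable,
    fun i => (hf i).ae_eq (hf i).1.ae_eq_mk, fun i => (hf i).1.ae_eq_mk⟩

theorem measurable_mean_tensor {f : Fin 5 → Circle → ℂ} (hf : ∀ i, MemLp (f i) 2 arc) (r : ℝ) :
    Measurable (mean r (tensor f)) := by
  obtain ⟨g, hg, -, hfg⟩ := exists_measurable_rep hf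
  rw [mean_congr (tensor_congr hfg)]
  exact measurable_mean (measurable_tensor hg) r

theorem eLpNorm_mean_tensor_le' {f : Fin 5 → Circle → ℂ} (hf : ∀ i, MemLp (f i) 2 arc) {r : ℝ}
    (hr : 0 < r) (hr1 : r ≤ 1) :
    eLpNorm (mean r (tensor f)) 2 arc ≤ meanConst * ∏ i, eLpNorm (f i) 2 arc := by
  obtain ⟨g, hg, hg2, hfg⟩ := exists_measurable_rep hf
  rw [mean_congr (tensor_congr hfg)]
  simp only [fun i => eLpNorm_congr_ae (p := 2) (hfg i)]
  exact eLpNorm_mean_tensor_le hg hg2 hr hr1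

/-- The mean densities of the tensor product of the `f i` converge to `F` in `L²(S¹)`. -/
def IsMeanLimit (f : Fin 5 → Circle → ℂ) (F : Circle → ℂ) : Prop :=
  Tendsto (fun r => eLpNorm (fun x => mean r (tensor f) x - F x) 2 arc) (𝓝[>] 0) (𝓝 0)

theorem exists_isMeanLimit {f : Fin 5 → Circle → ℂ} (hf : ∀ i, MemLp (f i) 2 arc) :
    ∃ F, MemLp F 2 arc ∧ IsMeanLimit f F := by
  classical
  obtain ⟨g, hg, hg2, hfg⟩ := exists_measurable_rep hf
  have hc := cauchyMean_tensor hg hg2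
  have hmem : ∀ r, 0 < r ∧ r ≤ 1 → MemLp (mean r (tensor f)) 2 arc := fun r hr =>
    ⟨(measurable_mean_tensor hf r).aestronglyMeasurable,
      (eLpNorm_mean_tensor_le' hf hr.1 hr.2).trans_lt (ENNReal.mul_lt_top meanConst_ne_top.lt_top
        (ENNReal.prod_lt_top fun i _ => (hf i).2))⟩
  -- The uniform bound is available only for radii in `(0, 1]`; the value 0 elsewhere does not
  -- affect the limit at `0+`.
  set G : ℝ → Lp ℂ 2 arc := fun r => if h : 0 < r ∧ r ≤ 1 then (hmem r h).toLp _ else 0 with hG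
  have hev : ∀ᶠ r : ℝ in 𝓝[>] 0, 0 < r ∧ r ≤ 1 := Ioc_mem_nhdsGT one_pos
  have hcauchy : Cauchy ((𝓝[>] (0 : ℝ)).map G) := by
    rw [cauchy_map_iff', tendsto_uniformity_iff_dist_tendsto_zero]
    have h1 := (ENNReal.tendsto_toReal ENNReal.zero_ne_top).comp hc
    refine h1.congr' ?_
    filter_upwards [hev.prod_mk hev] with p hp
    simp only [Function.comp_apply, hG, dif_pos hp.1, dif_pos hp.2]
    rw [dist_edist, Lp.edist_toLp_toLp, mean_congr (tensor_congr hfg), mean_congr (tensor_congr hfg)]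
    rfl
  obtain ⟨F, hF⟩ := cauchy_map_iff_exists_tendsto.1 hcauchy
  refine ⟨F, Lp.memLp F, ?_⟩
  rw [tendsto_iff_edist_tendsto_0] at hF
  refine hF.congr' ?_
  filter_upwards [hev] with r hr
  simp only [hG, dif_pos hr]
  rw [Lp.edist_def]
  refine eLpNorm_congr_ae ?_
  filter_upwards [(hmem r hr).coeFn_toLp] with x hx
  rw [Pi.sub_apply, hx]

theorem IsMeanLimit.unique {f : Fin 5 → Circle → ℂ} (hf : ∀ i, MemLp (f i) 2 arc)
    {F G : Circle → ℂ} (hF : IsMeanLimit f F) (hG : IsMeanLimit f G) (mF : MemLp F 2 arc)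
    (mG : MemLp G 2 arc) : F =ᵐ[arc] G := by
  have h := Tendsto.add hG hF
  rw [add_zero] at h
  have h0 : eLpNorm (F - G) 2 arc ≤ 0 := by
    refine ge_of_tendsto h (Eventually.of_forall fun r => ?_)
    have hm := (measurable_mean_tensor hf r).aestronglyMeasurable (μ := arc)
    refine le_trans (le_of_eq ?_) (eLpNorm_sub_le (hm.sub mG.1) (hm.sub mF.1) (by norm_num))
    congr 1
    ext x
    simp only [Pi.sub_apply]
    ring
  rw [nonpos_iff_eq_zero, eLpNorm_eq_zero_iff (mF.1.sub mG.1) (by norm_num)] at h0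
  filter_upwards [h0] with x hx
  exact sub_eq_zero.1 hx

theorem IsMeanLimit.eLpNorm_le {f : Fin 5 → Circle → ℂ} (hf : ∀ i, MemLp (f i) 2 arc)
    {F : Circle → ℂ} (hF : IsMeanLimit f F) (mF : MemLp F 2 arc) :
    eLpNorm F 2 arc ≤ meanConst * ∏ i, eLpNorm (f i) 2 arc := by
  have h := hF.add_const (meanConst * ∏ i, eLpNorm (f i) 2 arc)
  rw [zero_add] at h
  refine ge_of_tendsto h ?_
  filter_upwards [Ioc_mem_nhdsGT one_pos] with r hr
  have hm := (measurable_mean_tensor hf r).aestronglyMeasurable (μ := arc)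
  have e : F = mean r (tensor f) - fun x => mean r (tensor f) x - F x := by
    ext x
    simp
  calc eLpNorm F 2 arc = eLpNorm (mean r (tensor f) - fun x => mean r (tensor f) x - F x) 2 arc :=
        by rw [← e]
    _ ≤ _ := eLpNorm_sub_le hm (hm.sub mF.1) (by norm_num)
    _ ≤ _ := by
      rw [add_comm]
      exact add_le_add le_rfl (eLpNorm_mean_tensor_le' hf hr.1 hr.2)

theorem IsMeanLimit.congr {f f' : Fin 5 → Circle → ℂ} {F F' : Circle → ℂ} (h : IsMeanLimit f F)
    (hf : ∀ i, f i =ᵐ[arc] f' i) (hF : F =ᵐ[arc] F') : IsMeanLimit f' F' := by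
  refine Tendsto.congr (fun r => ?_) h
  rw [mean_congr (tensor_congr hf)]
  refine eLpNorm_congr_ae ?_
  filter_upwards [hF] with x hx
  rw [hx]

theorem isMeanLimit_update_add {f : Fin 5 → Circle → ℂ} (hf : ∀ i, MemLp (f i) 2 arc) (j : Fin 5)
    {g h : Circle → ℂ} (hg : MemLp g 2 arc) (hh : MemLp h 2 arc) {G H : Circle → ℂ}
    (mG : MemLp G 2 arc) (mH : MemLp H 2 arc)
    (hG : IsMeanLimit (Function.update f j g) G) (hH : IsMeanLimit (Function.update f j h) H) :
    IsMeanLimit (Function.update f j (g + h)) (G + H) := by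
  have lg := forall_update (P := fun h => MemLp h 2 arc) hf j hg
  have lh := forall_update (P := fun h => MemLp h 2 arc) hf j hh
  have ht := Tendsto.add hG hH
  rw [add_zero] at ht
  refine tendsto_of_tendsto_of_tendsto_of_le_of_le tendsto_const_nhds ht (fun _ => zero_le)
    fun r => ?_
  have e : tensor (Function.update f j (g + h)) =
      fun w => tensor (Function.update f j g) w + tensor (Function.update f j h) w := by
    ext w
    simp only [tensor, prod_update_apply, Pi.add_apply, add_mul]
  refine le_trans (le_of_eq ?_) (eLpNorm_add_le
    ((measurable_mean_tensor lg r).aestronglyMeasurable.sub mG.1)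
    ((measurable_mean_tensor lh r).aestronglyMeasurable.sub mH.1) (by norm_num))
  congr 1
  ext x
  have e2 := mean_add (H₁ := tensor (Function.update f j g)) (H₂ := tensor (Function.update f j h))
    (integrable_tensor lg) (integrable_tensor lh) r x
  rw [e, e2]
  simp only [Pi.add_apply]
  ring

theorem isMeanLimit_update_smul {f : Fin 5 → Circle → ℂ} (j : Fin 5) {g G : Circle → ℂ} (c : ℂ)
    (hG : IsMeanLimit (Function.update f j g) G) :
    IsMeanLimit (Function.update f j (c • g)) (c • G) := by
  have ht := ENNReal.Tendsto.const_mul hG (.inr (enorm_ne_top (x := c)))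
  rw [mul_zero] at ht
  refine ht.congr fun r => ?_
  rw [← eLpNorm_const_smul]
  have e : tensor (Function.update f j (c • g)) =
      fun w => c * tensor (Function.update f j g) w := by
    ext w
    simp only [tensor, prod_update_apply, Pi.smul_apply, smul_eq_mul, mul_assoc]
  congr 1
  ext x
  have : mean r (tensor (Function.update f j (c • g))) x =
      c * mean r (tensor (Function.update f j g)) x := by
    rw [e, mean, integral_const_mul, mul_div_assoc]
    rfl
  rw [this]
  simp only [Pi.smul_apply, smul_eq_mul]
  ring

theorem measurePreserving_rot (t : ℝ) :
    MeasurePreserving (fun x : Circle => Circle.exp t * x) arc arc :=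
  measurePreserving_mul_left _

/-- Rotating all five points rotates their sum, and the product of arc lengths is invariant. -/
theorem mean_tensor_rot {f : Fin 5 → Circle → ℂ} (hf : ∀ i, MemLp (f i) 2 arc) (t r : ℝ)
    (x : Circle) :
    mean r (tensor fun i => rot t (f i)) x = mean r (tensor f) (Circle.exp t * x) := by
  have hmp : MeasurePreserving (fun (w : Fin 5 → Circle) i => Circle.exp t * w i) pi5 pi5 :=
    measurePreserving_pi _ _ fun _ => measurePreserving_rot t
  unfold mean
  congr 1
  have hS := fun y : Circle => measurableSet_sum_mem_ball (y : ℂ) r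
  have hint := (integrable_tensor hf).indicator (hS (Circle.exp t * x))
  rw [← integral_indicator (hS _), ← integral_indicator (hS _)]
  conv_rhs => rw [← hmp.map_eq]
  rw [integral_map hmp.measurable.aemeasurable
    (by rw [hmp.map_eq]; exact hint.aestronglyMeasurable)]
  refine integral_congr_ae (Eventually.of_forall fun w => ?_)
  have hiff : ∑ i, ((Circle.exp t * w i : Circle) : ℂ) ∈
      Metric.ball ((Circle.exp t * x : Circle) : ℂ) r ↔ ∑ i, (w i : ℂ) ∈ Metric.ball (x : ℂ) r := by
    rw [mem_ball_iff_norm, mem_ball_iff_norm]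
    simp only [Circle.coe_mul]
    rw [← Finset.mul_sum, ← mul_sub, norm_mul, Circle.norm_coe, one_mul]
  simp only []
  by_cases h : ∑ i, (w i : ℂ) ∈ Metric.ball (x : ℂ) r
  · rw [Set.indicator_of_mem (by exact h), Set.indicator_of_mem (by exact hiff.2 h)]
    rfl
  · rw [Set.indicator_of_notMem (by exact h), Set.indicator_of_notMem (by exact hiff.not.2 h)]

theorem IsMeanLimit.rot {f : Fin 5 → Circle → ℂ} (hf : ∀ i, MemLp (f i) 2 arc)
    {F : Circle → ℂ} (hF : IsMeanLimit f F) (mF : MemLp F 2 arc) (t : ℝ) :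
    IsMeanLimit (fun i => CircleConv.rot t (f i)) (CircleConv.rot t F) := by
  refine Tendsto.congr (fun r => ?_) hF
  have hm := (measurable_mean_tensor hf r).aestronglyMeasurable (μ := arc)
  refine (eLpNorm_comp_measurePreserving (hm.sub mF.1) (measurePreserving_rot t)).symm.trans ?_
  congr 1
  ext x
  rw [mean_tensor_rot hf]
  rfl

theorem conv5_ball {f : Fin 5 → Circle → ℂ} (hf : ∀ i, MemLp (f i) 2 arc) (x : Circle) (r : ℝ) :
    conv5 f (Metric.ball (x : ℂ) r) / ((Real.pi * r ^ 2 : ℝ) : ℂ) = mean r (tensor f) x := by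
  rw [conv5, VectorMeasure.map_apply _ measurable_sum5 Metric.isOpen_ball.measurableSet]
  exact congrArg (· / ((Real.pi * r ^ 2 : ℝ) : ℂ))
    (withDensityᵥ_apply (integrable_tensor hf) (measurableSet_sum_mem_ball x r))

theorem isRestriction_of_isMeanLimit {f : Fin 5 → Circle → ℂ} (hf : ∀ i, MemLp (f i) 2 arc)
    {F : Circle → ℂ} (mF : MemLp F 2 arc) (h : IsMeanLimit f F) : IsRestriction (conv5 f) F := by
  refine ⟨mF, ?_⟩
  simp only [conv5_ball hf]
  exact h

/-! ### The restriction as a multilinear operator, and the rotation group on `L²(S¹)`. -/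

/-- The Hilbert space `L²(S¹)`. -/
abbrev L2 : Type := Lp ℂ 2 arc

theorem memLp_coe (f : Fin 5 → L2) (i : Fin 5) : MemLp (f i : Circle → ℂ) 2 arc := Lp.memLp (f i)

/-- The restriction to the circle of `f₁σ ∗ ⋯ ∗ f₅σ`, as an element of `L²(S¹)`. -/
def restr (f : Fin 5 → L2) : L2 :=
  (exists_isMeanLimit (memLp_coe f)).choose_spec.1.toLp _

theorem isMeanLimit_restr (f : Fin 5 → L2) : IsMeanLimit (fun i => f i) (restr f) :=
  (exists_isMeanLimit (memLp_coe f)).choose_spec.2.congr (fun _ => ae_eq_refl _)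
    (MemLp.coeFn_toLp _).symm

theorem restr_eq_of_isMeanLimit {f : Fin 5 → L2} {F : L2} (h : IsMeanLimit (fun i => f i) F) :
    restr f = F :=
  Lp.ext ((isMeanLimit_restr f).unique (memLp_coe f) h (Lp.memLp _) (Lp.memLp _))

theorem coe_update [inst : DecidableEq (Fin 5)] (f : Fin 5 → L2) (j : Fin 5) (g : L2) :
    (fun i => (Function.update f j g i : Circle → ℂ)) =
      @Function.update _ _ (instDecidableEqFin 5) (fun i => (f i : Circle → ℂ)) j g := by
  obtain rfl : inst = instDecidableEqFin 5 := Subsingleton.elim _ _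
  funext i
  by_cases h : i = j
  · subst h
    rw [Function.update_self, Function.update_self]
  · rw [Function.update_of_ne h, Function.update_of_ne h]

theorem norm_restr_le (f : Fin 5 → L2) : ‖restr f‖ ≤ meanConst.toReal * ∏ i, ‖f i‖ := by
  have h := (isMeanLimit_restr f).eLpNorm_le (memLp_coe f) (Lp.memLp _)
  have h2 := ENNReal.toReal_mono (ENNReal.mul_ne_top meanConst_ne_top
    (ENNReal.prod_ne_top fun i _ => (memLp_coe f i).2.ne)) h
  rw [ENNReal.toReal_mul, ENNReal.toReal_prod] at h2
  exact h2

theorem restr_update_add [inst : DecidableEq (Fin 5)] (f : Fin 5 → L2) (j : Fin 5) (g h : L2) :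
    restr (Function.update f j (g + h)) =
      restr (Function.update f j g) + restr (Function.update f j h) := by
  obtain rfl : inst = instDecidableEqFin 5 := Subsingleton.elim _ _
  have hg := isMeanLimit_restr (Function.update f j g)
  have hh := isMeanLimit_restr (Function.update f j h)
  rw [coe_update] at hg hh
  refine restr_eq_of_isMeanLimit ?_
  rw [coe_update]
  refine (isMeanLimit_update_add (memLp_coe f) j (Lp.memLp g) (Lp.memLp h) (Lp.memLp _)
    (Lp.memLp _) hg hh).congr (fun i => ?_) (Lp.coeFn_add _ _).symm
  by_cases hi : i = j
  · subst hi
    rw [Function.update_self, Function.update_self]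
    exact (Lp.coeFn_add _ _).symm
  · rw [Function.update_of_ne hi, Function.update_of_ne hi]

theorem restr_update_smul [inst : DecidableEq (Fin 5)] (f : Fin 5 → L2) (j : Fin 5) (c : ℂ) (g : L2) :
    restr (Function.update f j (c • g)) = c • restr (Function.update f j g) := by
  obtain rfl : inst = instDecidableEqFin 5 := Subsingleton.elim _ _
  have hg := isMeanLimit_restr (Function.update f j g)
  rw [coe_update] at hg
  refine restr_eq_of_isMeanLimit ?_
  rw [coe_update]
  refine (isMeanLimit_update_smul j c hg).congr (fun i => ?_) (Lp.coeFn_smul _ _).symm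
  by_cases hi : i = j
  · subst hi
    rw [Function.update_self, Function.update_self]
    exact (Lp.coeFn_smul _ _).symm
  · rw [Function.update_of_ne hi, Function.update_of_ne hi]

/-- The bounded multilinear operator `(f₁, …, f₅) ↦ (f₁σ ∗ ⋯ ∗ f₅σ)|_{S¹}` on `L²(S¹)`. -/
def restrL : ContinuousMultilinearMap ℂ (fun _ : Fin 5 => L2) L2 :=
  MultilinearMap.mkContinuous
    { toFun := restr
      map_update_add' := restr_update_add
      map_update_smul' := restr_update_smul } meanConst.toReal norm_restr_le

/-- The rotation by `t` radians, as an isometry of `L²(S¹)`. -/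
def rotL (t : ℝ) : L2 →ₗᵢ[ℂ] L2 := Lp.compMeasurePreservingₗᵢ ℂ _ (measurePreserving_rot t)

theorem coeFn_rotL (t : ℝ) (f : L2) : rotL t f =ᵐ[arc] rot t f :=
  Lp.coeFn_compMeasurePreserving f (measurePreserving_rot t)

theorem rot_congr {f g : Circle → ℂ} (h : f =ᵐ[arc] g) (t : ℝ) : rot t f =ᵐ[arc] rot t g :=
  (measurePreserving_rot t).quasiMeasurePreserving.ae_eq_comp h

theorem rotL_restrL (t : ℝ) (f : Fin 5 → L2) : rotL t (restrL f) = restrL fun i => rotL t (f i) := by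
  refine (restr_eq_of_isMeanLimit ?_).symm
  exact ((isMeanLimit_restr f).rot (memLp_coe f) (Lp.memLp _) t).congr
    (fun i => (coeFn_rotL t (f i)).symm) (coeFn_rotL t _).symm

theorem rotL_add (s t : ℝ) (f : L2) : rotL (s + t) f = rotL s (rotL t f) := by
  refine Lp.ext ?_
  have h : rotL s (rotL t f) =ᵐ[arc] rot s (rot t f) :=
    (coeFn_rotL _ _).trans (rot_congr (coeFn_rotL _ _) _)
  refine ((coeFn_rotL _ _).trans (Eventually.of_forall fun x => ?_)).trans h.symm
  simp only [rot]
  rw [add_comm, Circle.exp_add, mul_assoc]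

theorem continuous_rotL (f : L2) : Continuous fun t => rotL t f := by
  let g : C(ℝ, C(Circle, Circle)) := ContinuousMap.curry ⟨fun p : ℝ × Circle =>
    Circle.exp p.1 * p.2, by fun_prop⟩
  exact (continuous_const (y := f)).compMeasurePreservingLp g.continuous
    (fun t => measurePreserving_rot t) (by norm_num)

theorem rotL_zero (f : L2) : rotL 0 f = f := by
  refine Lp.ext ((coeFn_rotL _ _).trans (Eventually.of_forall fun x => ?_))
  simp [rot]

/-! ### Weak derivatives as derivatives along the rotation group. -/

/-- The bilinear pairing of `L²(S¹)` with a square integrable function. -/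
def pair {φ : Circle → ℂ} (hφ : MemLp φ 2 arc) : L2 →L[ℂ] ℂ :=
  innerSL ℂ ((hφ.star).toLp _)

theorem pair_apply {φ : Circle → ℂ} (hφ : MemLp φ 2 arc) (h : L2) :
    pair hφ h = ∫ x, h x * φ x ∂arc := by
  rw [pair, innerSL_apply_apply, L2.inner_def]
  refine integral_congr_ae ?_
  filter_upwards [hφ.star.coeFn_toLp] with x hx
  rw [hx]
  simp

theorem integral_arc {f : Circle → ℂ} (hf : AEStronglyMeasurable f arc) :
    ∫ x, f x ∂arc = ∫ y : AddCircle (2 * Real.pi), f y.toCircle := by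
  rw [arc_eq_map_toCircle] at hf ⊢
  rw [integral_map AddCircle.continuous_toCircle.measurable.aemeasurable hf]

theorem measurePreserving_toCircle :
    MeasurePreserving (AddCircle.toCircle (T := 2 * Real.pi)) volume arc :=
  ⟨AddCircle.continuous_toCircle.measurable, arc_eq_map_toCircle.symm⟩

theorem ae_arc_iff {p : Circle → Prop} (hp : MeasurableSet {x | p x}) :
    (∀ᵐ x ∂arc, p x) ↔ ∀ᵐ y : AddCircle (2 * Real.pi), p y.toCircle := by
  rw [arc_eq_map_toCircle, ae_map_iff AddCircle.continuous_toCircle.measurable.aemeasurable hp]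

theorem memLp_zpow (n : ℤ) : MemLp (fun x : Circle => ((x ^ n : Circle) : ℂ)) 2 arc :=
  MemLp.of_bound ((by fun_prop : Continuous fun x : Circle => (x : ℂ)).comp
    (continuous_zpow n)).aestronglyMeasurable 1 (Eventually.of_forall fun x => (Circle.norm_coe _).le)

/-- Fourier coefficients determine an element of `L²(S¹)`. -/
theorem eq_zero_of_pair_zpow {h : L2} (hh : ∀ n : ℤ, pair (memLp_zpow n) h = 0) : h = 0 := by
  have hv := AddCircle.volume_eq_smul_haarAddCircle (T := 2 * Real.pi)
  have hmem : MemLp (fun y : AddCircle (2 * Real.pi) => h y.toCircle) 2 volume :=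
    (Lp.memLp h).comp_measurePreserving measurePreserving_toCircle
  have hT : ENNReal.ofReal (2 * Real.pi) ≠ 0 := by
    simp [Real.pi_pos]
  have hmem' : MemLp (fun y : AddCircle (2 * Real.pi) => h y.toCircle) 2
      AddCircle.haarAddCircle := by
    have : AddCircle.haarAddCircle (T := 2 * Real.pi) =
        (ENNReal.ofReal (2 * Real.pi))⁻¹ • volume := by
      rw [hv, smul_smul, ENNReal.inv_mul_cancel hT ENNReal.ofReal_ne_top, one_smul]
    rw [this]
    exact hmem.smul_measure (by simpa using hT)
  have hc : ∀ n, fourierCoeff (hmem'.toLp _ : AddCircle (2 * Real.pi) → ℂ) n = 0 := fun n => by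
    have h1 : fourierCoeff (hmem'.toLp _ : AddCircle (2 * Real.pi) → ℂ) n =
        fourierCoeff (fun y : AddCircle (2 * Real.pi) => h y.toCircle) n := by
      unfold fourierCoeff
      refine integral_congr_ae ?_
      filter_upwards [hmem'.coeFn_toLp] with y hy
      rw [hy]
    have h2 := hh (-n)
    rw [pair_apply] at h2
    have h2 := (integral_arc ((Lp.memLp h).1.mul (memLp_zpow (-n)).1)).symm.trans h2
    rw [hv, integral_smul_measure] at h2
    rw [h1]
    have h3 := (smul_eq_zero.1 h2).resolve_left (by simp [Real.pi_pos.le, Real.pi_ne_zero])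
    rw [fourierCoeff, ← h3]
    refine integral_congr_ae (Eventually.of_forall fun y => ?_)
    simp only [fourier_apply, AddCircle.toCircle_zsmul, smul_eq_mul]
    rw [mul_comm]
    rfl
  have hz : hmem'.toLp _ = 0 := by
    have hs := hasSum_fourier_series_L2 (hmem'.toLp _)
    simp only [hc, zero_smul] at hs
    exact hs.unique hasSum_zero
  have h0 : (fun y : AddCircle (2 * Real.pi) => h y.toCircle) =ᵐ[AddCircle.haarAddCircle] 0 :=
    (MemLp.toLp_eq_toLp_iff hmem' MemLp.zero').1 (hz.trans (MemLp.toLp_zero _).symm)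
  have h0' : ∀ᵐ y : AddCircle (2 * Real.pi), h y.toCircle = 0 := by
    rw [hv, Measure.ae_ennreal_smul_measure_iff hT]
    exact h0
  refine Lp.ext ?_
  have h2 : ∀ᵐ x ∂arc, h x = 0 :=
    (ae_arc_iff ((Lp.stronglyMeasurable h).measurable (measurableSet_singleton 0))).2 h0'
  filter_upwards [h2, Lp.coeFn_zero ℂ 2 arc] with x hx hx'
  rw [hx, hx']
  rfl

/-- `g` is the derivative of `f` along the rotation group in `L²(S¹)`. -/
def IsGen (f g : L2) : Prop := HasDerivAt (fun t => rotL t f) g 0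

/-- The group law carries the derivative at 0 to every `t`: `rotL s f = rotL t (rotL (s - t) f)`. -/
theorem IsGen.hasDerivAt {f g : L2} (h : IsGen f g) (t : ℝ) :
    HasDerivAt (fun t => rotL t f) (rotL t g) t := by
  have h1 : HasDerivAt (fun s => rotL (s - t) f) g t := by
    have h' : HasDerivAt (fun t => rotL t f) g (t - t) := by rw [sub_self]; exact h
    exact h'.comp_sub_const t t
  have h2 := (((rotL t).toContinuousLinearMap.restrictScalars ℝ).hasFDerivAt).comp_hasDerivAt t h1
  refine h2.congr_of_eventuallyEq (Eventually.of_forall fun s => ?_)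
  change rotL s f = rotL t (rotL (s - t) f)
  rw [← rotL_add, add_sub_cancel]

theorem IsGen.unique {f g g' : L2} (h : IsGen f g) (h' : IsGen f g') : g = g' :=
  HasDerivAt.unique h h'

theorem isGen_of_integral {f g : L2} (h : ∀ t, rotL t f = f + ∫ u in (0 : ℝ)..t, rotL u g) :
    IsGen f g := by
  have h1 : HasDerivAt (fun t => f + ∫ u in (0 : ℝ)..t, rotL u g) (rotL 0 g) 0 :=
    (intervalIntegral.integral_hasDerivAt_right ((continuous_rotL g).intervalIntegrable _ _)
      ((continuous_rotL g).stronglyMeasurableAtFilter _ _) (continuous_rotL g).continuousAt).const_add f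
  rw [rotL_zero] at h1
  refine h1.congr_of_eventuallyEq (Eventually.of_forall h)

theorem IsGen.integral {f g : L2} (h : IsGen f g) (t : ℝ) :
    ∫ u in (0 : ℝ)..t, rotL u g = rotL t f - f := by
  rw [intervalIntegral.integral_eq_sub_of_hasDerivAt (fun u _ => h.hasDerivAt u)
    ((continuous_rotL g).intervalIntegrable _ _), rotL_zero]

theorem integral_rot {f : Circle → ℂ} (hf : AEStronglyMeasurable f arc) (t : ℝ) :
    ∫ x, rot t f x ∂arc = ∫ x, f x ∂arc := by
  have hmp := measurePreserving_rot t
  conv_rhs => rw [← hmp.map_eq]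
  rw [integral_map hmp.measurable.aemeasurable (by rw [hmp.map_eq]; exact hf)]
  rfl

theorem pair_zpow_rotL (n : ℤ) (t : ℝ) (h : L2) :
    pair (memLp_zpow (-n)) (rotL t h) = (Circle.exp t ^ n : Circle) * pair (memLp_zpow (-n)) h := by
  rw [pair_apply, pair_apply, ← integral_const_mul]
  have hm : AEStronglyMeasurable (fun x => ((Circle.exp t ^ n : Circle) : ℂ) *
      (h x * ((x ^ (-n) : Circle) : ℂ))) arc :=
    ((Lp.memLp h).1.mul (memLp_zpow (-n)).1).const_mul _
  refine Eq.trans ?_ (integral_rot hm t)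
  refine integral_congr_ae ?_
  filter_upwards [coeFn_rotL t h] with x hx
  rw [hx]
  simp only [rot]
  rw [mul_zpow, zpow_neg (Circle.exp t), Circle.coe_mul, Circle.coe_inv]
  have : ((Circle.exp t ^ n : Circle) : ℂ) ≠ 0 := Circle.coe_ne_zero _
  field_simp

theorem hasDerivAt_exp_mul_I (n : ℤ) (t : ℝ) :
    HasDerivAt (fun t : ℝ => ((Circle.exp t ^ n : Circle) : ℂ))
      (Complex.I * n * (Circle.exp t ^ n : Circle)) t := by
  have e : (fun t : ℝ => ((Circle.exp t ^ n : Circle) : ℂ)) =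
      fun t : ℝ => Complex.exp (Complex.I * n * t) := by
    ext t
    rw [Circle.coe_zpow, Circle.coe_exp, ← Complex.exp_int_mul]
    ring_nf
  have h : HasDerivAt (fun t : ℝ => Complex.exp (Complex.I * n * t))
      (Complex.exp (Complex.I * n * t) * (Complex.I * n * 1)) t :=
    ((Complex.ofRealCLM.hasDerivAt (x := t)).const_mul (Complex.I * n)).cexp
  rw [← e] at h
  convert h using 1
  rw [show Complex.exp (Complex.I * n * t) = ((Circle.exp t ^ n : Circle) : ℂ) from
    (congrFun e t).symm]
  ring

theorem contDiff_zpow_exp (n : ℤ) :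
    ContDiff ℝ ∞ fun t : ℝ => ((Circle.exp t ^ n : Circle) : ℂ) := by
  have e : (fun t : ℝ => ((Circle.exp t ^ n : Circle) : ℂ)) =
      fun t : ℝ => Complex.exp (Complex.I * n * t) := by
    ext t
    rw [Circle.coe_zpow, Circle.coe_exp, ← Complex.exp_int_mul]
    ring_nf
  rw [e]
  exact (contDiff_const.mul Complex.ofRealCLM.contDiff).cexp

theorem angDeriv_zpow (n : ℤ) (x : Circle) :
    angDeriv (fun x : Circle => ((x ^ n : Circle) : ℂ)) x = Complex.I * n * (x ^ n : Circle) := by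
  have h := (hasDerivAt_exp_mul_I n 0).mul_const ((x ^ n : Circle) : ℂ)
  have e : (fun t => rot t (fun x : Circle => ((x ^ n : Circle) : ℂ)) x) =
      fun t : ℝ => ((Circle.exp t ^ n : Circle) : ℂ) * ((x ^ n : Circle) : ℂ) := by
    ext t
    rw [rot, mul_zpow, Circle.coe_mul]
  rw [angDeriv, e, h.deriv]
  simp

/-- Testing with `x⁻ⁿ` shows that the `n`-th Fourier coefficient of `g` is `in` times that of `f`.
Rotation multiplies these coefficients by `e^{int}`, so `rotL t f = f + ∫₀ᵗ rotL u g du` can be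
checked coefficient by coefficient. -/
theorem isGen_of_hasWeakDeriv {f g : L2} (h : HasWeakDeriv f g) : IsGen f g := by
  have hn : ∀ n : ℤ, pair (memLp_zpow (-n)) g = Complex.I * n * pair (memLp_zpow (-n)) f := by
    intro n
    have h1 := h (fun x : Circle => ((x ^ (-n) : Circle) : ℂ)) (contDiff_zpow_exp (-n))
    simp only [angDeriv_zpow] at h1
    rw [pair_apply, pair_apply]
    have h2 : ∫ x, f x * (Complex.I * ((-n : ℤ) : ℂ) * ((x ^ (-n) : Circle) : ℂ)) ∂arc =
        Complex.I * ((-n : ℤ) : ℂ) * ∫ x, f x * ((x ^ (-n) : Circle) : ℂ) ∂arc := by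
      rw [← integral_const_mul]
      congr 1
      ext x
      ring
    rw [h2] at h1
    rw [Int.cast_neg] at h1
    linear_combination h1
  refine isGen_of_integral fun t => ?_
  rw [← sub_eq_zero]
  refine eq_zero_of_pair_zpow fun m => ?_
  obtain ⟨n, rfl⟩ : ∃ n, m = -n := ⟨-m, (neg_neg m).symm⟩
  have hci : pair (memLp_zpow (-n)) (∫ u in (0 : ℝ)..t, rotL u g) =
      ∫ u in (0 : ℝ)..t, pair (memLp_zpow (-n)) (rotL u g) :=
    (ContinuousLinearMap.intervalIntegral_comp_comm
      ((pair (memLp_zpow (-n))).restrictScalars ℝ)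
      ((continuous_rotL g).intervalIntegrable _ _)).symm
  have hft : ∫ u in (0 : ℝ)..t, Complex.I * n * (Circle.exp u ^ n : Circle) =
      (Circle.exp t ^ n : Circle) - (Circle.exp 0 ^ n : Circle) := by
    refine intervalIntegral.integral_eq_sub_of_hasDerivAt
      (fun u _ => hasDerivAt_exp_mul_I n u) (Continuous.intervalIntegrable ?_ _ _)
    exact continuous_const.mul (contDiff_zpow_exp n).continuous
  rw [map_sub, map_add, hci]
  simp only [pair_zpow_rotL, hn]
  have e : ∀ u : ℝ, ((Circle.exp u ^ n : Circle) : ℂ) * (Complex.I * n * pair (memLp_zpow (-n)) f) =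
      Complex.I * n * (Circle.exp u ^ n : Circle) * pair (memLp_zpow (-n)) f := fun u => by ring
  simp only [e]
  rw [intervalIntegral.integral_mul_const, hft]
  simp
  ring

theorem angDeriv_exp (φ : Circle → ℂ) (s : ℝ) :
    angDeriv φ (Circle.exp s) = deriv (fun t : ℝ => φ (Circle.exp t)) s := by
  have e : (fun t => rot t φ (Circle.exp s)) = fun t => (fun t : ℝ => φ (Circle.exp t)) (t + s) := by
    ext t
    simp only [rot]
    rw [Circle.exp_add]
  rw [angDeriv, e]
  refine (deriv_comp_add_const (fun t : ℝ => φ (Circle.exp t)) s 0).trans ?_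
  rw [zero_add]

theorem exp_arg (x : Circle) : Circle.exp (Complex.arg x) = x := Circle.exp_arg x

theorem comp_arg (φ : Circle → ℂ) : φ = fun x : Circle => φ (Circle.exp (Complex.arg x)) := by
  ext x
  rw [exp_arg]

/-- Test functions are given only through their lift to `ℝ`; the argument is a measurable section of
`Circle.exp`. -/
theorem measurable_of_comp_exp {φ : Circle → ℂ} (h : Measurable fun t : ℝ => φ (Circle.exp t)) :
    Measurable φ := by
  rw [comp_arg φ]
  exact h.comp (Complex.measurable_arg.comp (by fun_prop))

theorem exists_bound_of_comp_exp {φ : Circle → ℂ} (h : Continuous fun t : ℝ => φ (Circle.exp t)) :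
    ∃ C, ∀ x, ‖φ x‖ ≤ C := by
  obtain ⟨C, hC⟩ := (isCompact_Icc (a := -Real.pi) (b := Real.pi)).exists_bound_of_continuousOn
    h.continuousOn
  refine ⟨C, fun x => ?_⟩
  have := hC (Complex.arg x) ⟨(Complex.neg_pi_lt_arg _).le, Complex.arg_le_pi _⟩
  rwa [exp_arg] at this

/-- By invariance the pairing of `rotL t f` with `φ` is that of `f` with `φ` rotated by `-t`.
Differentiating at `t = 0` on either side gives the two integrals, the second with a minus sign. -/
theorem hasWeakDeriv_of_isGen {f g : L2} (h : IsGen f g) : HasWeakDeriv f g := by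
  intro φ hφ
  have hd : ∀ s, HasDerivAt (fun t : ℝ => φ (Circle.exp t)) (angDeriv φ (Circle.exp s)) s :=
    fun s => by
      rw [angDeriv_exp]
      exact (hφ.differentiable (by simp) s).hasDerivAt
  have hc' : Continuous fun t : ℝ => angDeriv φ (Circle.exp t) := by
    simp only [angDeriv_exp]
    exact hφ.continuous_deriv (by simp)
  obtain ⟨C, hC⟩ := exists_bound_of_comp_exp hφ.continuous
  obtain ⟨C', hC'⟩ := exists_bound_of_comp_exp hc'
  have hm := measurable_of_comp_exp hφ.continuous.measurable
  have hm' := measurable_of_comp_exp hc'.measurable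
  have hφ2 : MemLp φ 2 arc := MemLp.of_bound hm.aestronglyMeasurable C (Eventually.of_forall hC)
  have hfi : Integrable f arc := (Lp.memLp f).integrable (by norm_num)
  have h1 : HasDerivAt (fun t => pair hφ2 (rotL t f)) (pair hφ2 g) 0 :=
    (((pair hφ2).restrictScalars ℝ).hasFDerivAt).comp_hasDerivAt 0 h
  have hp : ∀ t, pair hφ2 (rotL t f) = ∫ x, f x * rot (-t) φ x ∂arc := fun t => by
    rw [pair_apply]
    have hmt : AEStronglyMeasurable (fun x => f x * rot (-t) φ x) arc :=
      (Lp.memLp f).1.mul (hm.comp (measurePreserving_rot (-t)).measurable).aestronglyMeasurable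
    rw [← integral_rot hmt t]
    refine integral_congr_ae ?_
    filter_upwards [coeFn_rotL t f] with x hx
    rw [hx]
    simp only [rot]
    rw [← mul_assoc, ← Circle.exp_add, neg_add_cancel, Circle.exp_zero, one_mul]
  have hdx : ∀ (x : Circle) (t : ℝ),
      HasDerivAt (fun t => f x * rot (-t) φ x) (-(f x * angDeriv φ (Circle.exp (-t) * x))) t := by
    intro x t
    have e : ∀ t, rot (-t) φ x = (fun t : ℝ => φ (Circle.exp t)) (Complex.arg x - t) := fun t => by
      simp only [rot]
      rw [sub_eq_neg_add, Circle.exp_add, exp_arg]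
    have h3 := (hd (Complex.arg x - t)).comp_const_sub (Complex.arg x) t
    rw [sub_eq_neg_add, Circle.exp_add, exp_arg] at h3
    have h4 := h3.const_mul (f x)
    rw [mul_neg] at h4
    refine h4.congr_of_eventuallyEq (Eventually.of_forall fun t => ?_)
    exact congrArg (f x * ·) (e t)
  have h2 := (hasDerivAt_integral_of_dominated_loc_of_deriv_le (μ := arc) (x₀ := (0 : ℝ))
    (F := fun t x => f x * rot (-t) φ x)
    (F' := fun t x => -(f x * angDeriv φ (Circle.exp (-t) * x))) (s := Set.univ)
    (bound := fun x => ‖f x‖ * C') univ_mem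
    (Eventually.of_forall fun t => (Lp.memLp f).1.mul
      (hm.comp (measurePreserving_rot (-t)).measurable).aestronglyMeasurable)
    (hfi.mul_bdd (c := C) (hm.comp (measurePreserving_rot (-0)).measurable).aestronglyMeasurable
      (Eventually.of_forall fun x => hC _))
    ((Lp.memLp f).1.mul
      (hm'.comp (measurePreserving_rot (-0)).measurable).aestronglyMeasurable).neg
    (Eventually.of_forall fun x t _ => by
      rw [norm_neg, norm_mul]
      exact mul_le_mul_of_nonneg_left (hC' _) (norm_nonneg _))
    (hfi.norm.mul_const _) (Eventually.of_forall fun x t _ => hdx x t)).2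
  have h3 := h1.unique (h2.congr_of_eventuallyEq (Eventually.of_forall hp))
  simp only [neg_zero, Circle.exp_zero, one_mul, integral_neg, pair_apply] at h3
  rw [h3, neg_neg]

theorem HasWeakDeriv.congr {f f' g g' : Circle → ℂ} (h : HasWeakDeriv f g) (hf : f =ᵐ[arc] f')
    (hg : g =ᵐ[arc] g') : HasWeakDeriv f' g' := fun φ hφ => by
  have h1 : ∫ x, f x * angDeriv φ x ∂arc = ∫ x, f' x * angDeriv φ x ∂arc :=
    integral_congr_ae (hf.mono fun x hx => by simp only [hx])
  have h2 : ∫ x, g x * φ x ∂arc = ∫ x, g' x * φ x ∂arc :=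
    integral_congr_ae (hg.mono fun x hx => by simp only [hx])
  rw [← h1, ← h2]
  exact h φ hφ

/-! ### The norm of `𝓗^s` in terms of derivatives in `L²(S¹)`. -/

/-- Successive derivatives along the rotation group in `L²(S¹)`, up to order `k`. -/
def IsGenSeq (f : L2) (k : ℕ) (D : ℕ → L2) : Prop :=
  D 0 = f ∧ ∀ m < k, IsGen (D m) (D (m + 1))

theorem IsGenSeq.unique {f : L2} {k : ℕ} {D D' : ℕ → L2} (h : IsGenSeq f k D)
    (h' : IsGenSeq f k D') : ∀ m ≤ k, D m = D' m := by
  intro m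
  induction m with
  | zero => exact fun _ => h.1.trans h'.1.symm
  | succ m ih =>
    intro hm
    have h1 := h.2 m hm
    rw [ih (Nat.le_of_succ_le hm)] at h1
    exact h1.unique (h'.2 m hm)

theorem IsDerivSeq.exists_isGenSeq {f : Circle → ℂ} {k : ℕ} {D : ℕ → Circle → ℂ}
    (h : IsDerivSeq f k D) (hf : MemLp f 2 arc) :
    ∃ E, IsGenSeq (hf.toLp f) k E ∧ ∀ m ≤ k, D m =ᵐ[arc] E m := by
  classical
  let E : ℕ → L2 := fun m => if hm : m ≤ k then (h.memLp m hm).toLp _ else 0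
  have hE : ∀ m ≤ k, D m =ᵐ[arc] E m := fun m hm => by
    simp only [E, dif_pos hm]
    exact (h.memLp m hm).coeFn_toLp.symm
  refine ⟨E, ⟨?_, fun m hm => ?_⟩, hE⟩
  · simp only [E, dif_pos (Nat.zero_le k)]
    exact (MemLp.toLp_eq_toLp_iff _ _).2 h.zero
  · exact isGen_of_hasWeakDeriv ((h.succ m hm).congr (hE m hm.le) (hE (m + 1) hm))

theorem IsGenSeq.isDerivSeq {f : Circle → ℂ} {hf : MemLp f 2 arc} {k : ℕ} {E : ℕ → L2}
    (h : IsGenSeq (hf.toLp f) k E) : IsDerivSeq f k fun m => E m where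
  zero := by
    rw [h.1]
    exact hf.coeFn_toLp
  memLp m _ := Lp.memLp _
  succ m hm := hasWeakDeriv_of_isGen (h.2 m hm)

theorem IsDerivSeq.memLp_self {f : Circle → ℂ} {k : ℕ} {D : ℕ → Circle → ℂ}
    (h : IsDerivSeq f k D) : MemLp f 2 arc := (h.memLp 0 (Nat.zero_le k)).ae_eq h.zero

theorem holderSeminorm_congr {α : ℝ} {g g' : Circle → ℂ} (h : g =ᵐ[arc] g') :
    holderSeminorm α g = holderSeminorm α g' := by
  unfold holderSeminorm
  refine iSup_congr fun t => iSup_congr fun _ => ?_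
  rw [eLpNorm_congr_ae ((rot_congr h t).sub h)]

theorem eLpNorm_rot_sub (t : ℝ) (g : L2) :
    eLpNorm (rot t g - (g : Circle → ℂ)) 2 arc = ENNReal.ofReal ‖rotL t g - g‖ := by
  rw [Lp.norm_def, ENNReal.ofReal_toReal (Lp.eLpNorm_ne_top _)]
  refine eLpNorm_congr_ae ?_
  filter_upwards [coeFn_rotL t g, Lp.coeFn_sub (rotL t g) g] with x hx hx'
  rw [hx', Pi.sub_apply, Pi.sub_apply, hx]

theorem holderSeminorm_le {α c : ℝ} {g : L2}
    (h : ∀ t, 0 < |t| → |t| ≤ 1 → ‖rotL t g - g‖ ≤ c * |t| ^ α) :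
    holderSeminorm α g ≤ ENNReal.ofReal c := by
  refine iSup_le fun t => iSup_le fun ht => ENNReal.div_le_of_le_mul ?_
  rw [eLpNorm_rot_sub, ← ENNReal.ofReal_mul' (Real.rpow_nonneg (abs_nonneg t) _)]
  exact ENNReal.ofReal_le_ofReal (h t ht.1 ht.2)

theorem norm_rotL_sub_le {α : ℝ} {g : L2} (hg : holderSeminorm α g ≠ ⊤) {t : ℝ} (ht : |t| ≤ 1) :
    ‖rotL t g - g‖ ≤ (holderSeminorm α g).toReal * |t| ^ α := by
  rcases (abs_nonneg t).eq_or_lt with h0 | h0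
  · rw [abs_eq_zero.1 h0.symm, rotL_zero, sub_self, norm_zero]
    exact mul_nonneg ENNReal.toReal_nonneg (Real.rpow_nonneg (abs_nonneg _) _)
  · have hp : 0 < |t| ^ α := Real.rpow_pos_of_pos h0 _
    have h1 : eLpNorm (rot t g - (g : Circle → ℂ)) 2 arc / ENNReal.ofReal (|t| ^ α) ≤ holderSeminorm α g :=
      le_iSup₂_of_le (f := fun (t : ℝ) (_ : 0 < |t| ∧ |t| ≤ 1) =>
        eLpNorm (rot t g - (g : Circle → ℂ)) 2 arc / ENNReal.ofReal (|t| ^ α)) t ⟨h0, ht⟩ le_rfl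
    rw [ENNReal.div_le_iff (by simpa using hp) ENNReal.ofReal_ne_top, eLpNorm_rot_sub,
      ← ENNReal.ofReal_toReal hg, ← ENNReal.ofReal_mul ENNReal.toReal_nonneg,
      ENNReal.ofReal_le_ofReal_iff (by positivity)] at h1
    exact h1

/-- Derivatives along the group are unique, so every admissible sequence in the infimum gives the
same value. -/
theorem hNorm_eq {s : ℝ} {f : Circle → ℂ} {hf : MemLp f 2 arc} {E : ℕ → L2}
    (h : IsGenSeq (hf.toLp f) (order s) E) :
    hNorm s f = eLpNorm f 2 arc + if s = 0 then 0
      else ∑ m ∈ Finset.range (order s + 1), holderSeminorm (s - order s) (E m) := by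
  refine le_antisymm (iInf₂_le (fun m => (E m : Circle → ℂ)) h.isDerivSeq)
    (le_iInf₂ fun D hD => ?_)
  obtain ⟨E', hE', hDE⟩ := hD.exists_isGenSeq hf
  refine le_of_eq ?_
  congr 2
  refine Finset.sum_congr rfl fun m hm => ?_
  have hm' : m ≤ order s := Nat.lt_succ_iff.1 (Finset.mem_range.1 hm)
  rw [holderSeminorm_congr (hDE m hm'), h.unique hE' m hm']

theorem MemH.exists_isGenSeq {s : ℝ} {f : Circle → ℂ} (h : MemH s f) :
    ∃ (hf : MemLp f 2 arc) (E : ℕ → L2), IsGenSeq (hf.toLp f) (order s) E := by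
  obtain ⟨D, hD⟩ := iInf_lt_iff.1 h
  obtain ⟨hD, -⟩ := iInf_lt_iff.1 hD
  obtain ⟨E, hE, -⟩ := hD.exists_isGenSeq hD.memLp_self
  exact ⟨hD.memLp_self, E, hE⟩

/-- The average of `rotL u g` over `[0, 1]` is `rotL 1 h - h`, of norm at most `2‖h‖`, and it
differs from `g` by at most `N`. -/
theorem IsGen.norm_le {h g : L2} (hg : IsGen h g) {N : ℝ}
    (hN : ∀ t ∈ Set.Icc (0 : ℝ) 1, ‖rotL t g - g‖ ≤ N) : ‖g‖ ≤ 2 * ‖h‖ + N := by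
  have h1 := hg.integral 1
  have h2 : ∫ u in (0 : ℝ)..1, (rotL u g - g) = rotL 1 h - h - g := by
    rw [intervalIntegral.integral_sub ((continuous_rotL g).intervalIntegrable _ _)
      (by simp), h1]
    simp
  have h3 : ‖rotL 1 h - h - g‖ ≤ N := by
    rw [← h2]
    have := intervalIntegral.norm_integral_le_of_norm_le_const (a := (0 : ℝ)) (b := 1) (C := N)
      (f := fun u => rotL u g - g) fun u hu => hN u (by
        rw [Set.uIoc_of_le zero_le_one] at hu
        exact ⟨hu.1.le, hu.2⟩)
    simpa using this
  calc ‖g‖ = ‖(rotL 1 h - h) - (rotL 1 h - h - g)‖ := by rw [sub_sub_cancel]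
    _ ≤ ‖rotL 1 h - h‖ + ‖rotL 1 h - h - g‖ := norm_sub_le _ _
    _ ≤ (‖rotL 1 h‖ + ‖h‖) + N := add_le_add (norm_sub_le _ _) h3
    _ = 2 * ‖h‖ + N := by rw [LinearIsometry.norm_map]; ring

theorem IsGenSeq.norm_le {f : L2} {k : ℕ} {D : ℕ → L2} (h : IsGenSeq f k D) {N : ℝ}
    (hf : ‖f‖ ≤ N) (hN : ∀ m ≤ k, ∀ t ∈ Set.Icc (0 : ℝ) 1, ‖rotL t (D m) - D m‖ ≤ N) :
    ∀ m ≤ k, ‖D m‖ ≤ 3 ^ m * N := by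
  have hN0 : 0 ≤ N := (norm_nonneg f).trans hf
  intro m
  induction m with
  | zero =>
    intro _
    rw [h.1]
    simpa using hf
  | succ m ih =>
    intro hm
    have h1 := (h.2 m hm).norm_le (hN (m + 1) hm)
    have h2 := ih (Nat.le_of_succ_le hm)
    -- This closes the induction: `2 · 3^m N + N ≤ 3^(m+1) N`.
    have h3 : N ≤ 3 ^ m * N := le_mul_of_one_le_left hN0 (one_le_pow₀ (by norm_num))
    rw [pow_succ]
    linarith

/-! ### Leibniz rule and Hölder estimates for the restricted convolution. -/

theorem IsGen.sum {ι : Type*} {S : Finset ι} {f g : ι → L2} (h : ∀ i ∈ S, IsGen (f i) (g i)) :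
    IsGen (∑ i ∈ S, f i) (∑ i ∈ S, g i) := by
  have h1 := HasDerivAt.fun_sum h
  refine h1.congr_of_eventuallyEq (Eventually.of_forall fun t => ?_)
  simp only [map_sum]

/-- The operator commutes with rotations, so the orbit of its value is its value on the five orbits;
the chain rule for a bounded multilinear map applies. -/
theorem isGen_restrL {a b : Fin 5 → L2} (h : ∀ i, IsGen (a i) (b i)) :
    IsGen (restrL a) (∑ j, restrL (Function.update a j (b j))) := by
  have h1 : HasDerivAt (fun t i => rotL t (a i)) b 0 := hasDerivAt_pi.2 h
  have h2 := ((restrL.hasFDerivAt fun i => rotL 0 (a i)).restrictScalars ℝ).comp_hasDerivAt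
    (0 : ℝ) h1
  have e : (fun i => rotL 0 (a i)) = a := funext fun i => rotL_zero _
  rw [e] at h2
  have h3 : HasDerivAt (fun t => restrL fun i => rotL t (a i)) (restrL.linearDeriv a b) 0 := h2
  rw [ContinuousMultilinearMap.linearDeriv_apply] at h3
  exact h3.congr_of_eventuallyEq (Eventually.of_forall fun t => rotL_restrL t a)

/-- The iterated Leibniz rule: the `m`-th derivative of the restricted convolution of the
functions `D i (β i)`. -/
def leibniz (D : Fin 5 → ℕ → L2) : ℕ → (Fin 5 → ℕ) → L2
  | 0, β => restrL fun i => D i (β i)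
  | m + 1, β => ∑ j, leibniz D m (Function.update β j (β j + 1))

theorem update_add_le {β : Fin 5 → ℕ} {m k : ℕ} (h : ∀ i, β i + (m + 1) ≤ k) (j i : Fin 5) :
    Function.update β j (β j + 1) i + m ≤ k := by
  by_cases hij : i = j
  · subst hij
    rw [Function.update_self]
    have := h i
    omega
  · rw [Function.update_of_ne hij]
    have := h i
    omega

/-- Induction on `m` with `β` free, as each step raises one entry of `β`. The condition on `β` keeps
all orders within `k`, even if every derivative falls on the same factor. -/
theorem isGen_leibniz {D : Fin 5 → ℕ → L2} {k : ℕ}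
    (hD : ∀ i, ∀ m < k, IsGen (D i m) (D i (m + 1))) (m : ℕ) :
    ∀ β : Fin 5 → ℕ, (∀ i, β i + (m + 1) ≤ k) → IsGen (leibniz D m β) (leibniz D (m + 1) β) := by
  induction m with
  | zero =>
    intro β hβ
    have h := isGen_restrL (a := fun i => D i (β i)) (b := fun i => D i (β i + 1))
      fun i => hD i (β i) (by have := hβ i; omega)
    have e : ∑ j, restrL (Function.update (fun i => D i (β i)) j (D j (β j + 1))) =
        leibniz D 1 β := by
      simp only [leibniz]
      refine Finset.sum_congr rfl fun j _ => congrArg restrL (funext fun i => ?_)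
      by_cases hij : i = j
      · subst hij
        rw [Function.update_self, Function.update_self]
      · rw [Function.update_of_ne hij, Function.update_of_ne hij]
    rw [e] at h
    exact h
  | succ m ih =>
    intro β hβ
    rw [leibniz, leibniz]
    exact IsGen.sum fun j _ => ih _ fun i => update_add_le hβ j i

/-- Telescoping: the difference is a sum of five terms, each with one factor `rotL t (a i) - a i`
and the others bounded by `A`, since rotations are isometries. -/
theorem norm_rotL_restrL_sub_le {a : Fin 5 → L2} {A : Fin 5 → ℝ} {x t : ℝ}
    (ha : ∀ i, ‖a i‖ ≤ A i) (hd : ∀ i, ‖rotL t (a i) - a i‖ ≤ A i * x) :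
    ‖rotL t (restrL a) - restrL a‖ ≤ 5 * ‖restrL‖ * (∏ i, A i) * x := by
  rw [rotL_restrL]
  refine (restrL.norm_image_sub_le' _ _).trans ?_
  have hA : ∀ i, 0 ≤ A i := fun i => (norm_nonneg _).trans (ha i)
  have h1 : ∀ i : Fin 5, (∏ j, if j = i then ‖rotL t (a i) - a i‖ else max ‖rotL t (a j)‖ ‖a j‖)
      ≤ (∏ j, A j) * x := fun i => by
    have h2 : (∏ j, A j) * x = ∏ j, if j = i then A j * x else A j := by
      rw [← Finset.mul_prod_erase _ _ (Finset.mem_univ i),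
        ← Finset.mul_prod_erase _ (fun j => if j = i then A j * x else A j) (Finset.mem_univ i),
        if_pos rfl, Finset.prod_congr rfl fun j hj => if_neg (Finset.ne_of_mem_erase hj)]
      ring
    rw [h2]
    refine Finset.prod_le_prod (fun j _ => ?_) fun j _ => ?_
    · split_ifs
      · exact norm_nonneg _
      · exact (norm_nonneg _).trans (le_max_right _ _)
    · split_ifs with hji
      · subst hji
        exact hd j
      · rw [LinearIsometry.norm_map, max_self]
        exact ha j
  calc _ ≤ ‖restrL‖ * ∑ _i : Fin 5, (∏ j, A j) * x :=
        mul_le_mul_of_nonneg_left (Finset.sum_le_sum fun i _ => h1 i) (norm_nonneg _)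
    _ = _ := by
        rw [Finset.sum_const, Finset.card_univ, Fintype.card_fin, nsmul_eq_mul]
        push_cast
        ring

theorem norm_rotL_leibniz_sub_le {D : Fin 5 → ℕ → L2} {k : ℕ} {A : Fin 5 → ℝ} {x t : ℝ}
    (ha : ∀ i, ∀ m ≤ k, ‖D i m‖ ≤ A i)
    (hd : ∀ i, ∀ m ≤ k, ‖rotL t (D i m) - D i m‖ ≤ A i * x) (m : ℕ) :
    ∀ β : Fin 5 → ℕ, (∀ i, β i + m ≤ k) →
      ‖rotL t (leibniz D m β) - leibniz D m β‖ ≤ 5 ^ m * (5 * ‖restrL‖ * (∏ i, A i) * x) := by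
  induction m with
  | zero =>
    intro β hβ
    rw [leibniz, pow_zero, one_mul]
    exact norm_rotL_restrL_sub_le (fun i => ha i _ (hβ i)) fun i => hd i _ (hβ i)
  | succ m ih =>
    intro β hβ
    rw [leibniz, map_sum, ← Finset.sum_sub_distrib]
    refine (norm_sum_le_of_le _ fun j _ => ih _ fun i => update_add_le hβ j i).trans_eq ?_
    rw [Finset.sum_const, Finset.card_univ, Fintype.card_fin, nsmul_eq_mul]
    push_cast
    ring

theorem order_lt {s : ℝ} (hs : 0 < s) : 0 < s - order s ∧ s - order s ≤ 1 := by
  have h1 : 1 ≤ ⌈s⌉₊ := Nat.one_le_ceil_iff.2 hs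
  have h2 : ((order s : ℕ) : ℝ) = ⌈s⌉₊ - 1 := by
    rw [order, Nat.cast_sub h1, Nat.cast_one]
  have h3 := Nat.le_ceil s
  have h4 := Nat.ceil_lt_add_one hs.le
  constructor <;> linarith

/-! ### The estimate in `𝓗^s`. -/

theorem isRestriction_restrL {f : Fin 5 → Circle → ℂ} (hf : ∀ i, MemLp (f i) 2 arc) :
    IsRestriction (conv5 f) (restrL fun i => (hf i).toLp (f i)) :=
  isRestriction_of_isMeanLimit hf (Lp.memLp _)
    ((isMeanLimit_restr _).congr (fun i => (hf i).coeFn_toLp) (ae_eq_refl _))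

theorem eLpNorm_le_hNorm {s : ℝ} {f : Circle → ℂ} : eLpNorm f 2 arc ≤ hNorm s f :=
  le_iInf₂ fun _ _ => le_self_add

theorem norm_toLp_le {s : ℝ} {f : Circle → ℂ} (hf : MemLp f 2 arc) (h : MemH s f) :
    ‖hf.toLp f‖ ≤ (hNorm s f).toReal := by
  rw [Lp.norm_toLp]
  exact ENNReal.toReal_mono h.ne eLpNorm_le_hNorm

theorem norm_rotL_sub_le_hNorm {s : ℝ} (hs : 0 < s) {f : Circle → ℂ} {hf : MemLp f 2 arc}
    {E : ℕ → L2} (hE : IsGenSeq (hf.toLp f) (order s) E) (h : MemH s f) {m : ℕ}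
    (hm : m ≤ order s) {t : ℝ} (ht : |t| ≤ 1) :
    ‖rotL t (E m) - E m‖ ≤ (hNorm s f).toReal * |t| ^ (s - order s) := by
  have h1 : holderSeminorm (s - order s) (E m) ≤ hNorm s f := by
    rw [hNorm_eq hE, if_neg hs.ne']
    exact (Finset.single_le_sum (f := fun m => holderSeminorm (s - order s) (E m))
      (fun _ _ => zero_le) (Finset.mem_range.2 (Nat.lt_succ_of_le hm))).trans le_add_self
  exact (norm_rotL_sub_le (ne_top_of_le_ne_top h.ne h1) ht).trans
    (mul_le_mul_of_nonneg_right (ENNReal.toReal_mono h.ne h1)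
      (Real.rpow_nonneg (abs_nonneg _) _))

theorem hNorm_restrL_le {s : ℝ} (hs : 0 < s) {f : Fin 5 → Circle → ℂ}
    (hf : ∀ i, MemLp (f i) 2 arc) {E : Fin 5 → ℕ → L2}
    (hE : ∀ i, IsGenSeq ((hf i).toLp (f i)) (order s) (E i)) (h : ∀ i, MemH s (f i)) :
    hNorm s (restrL fun i => (hf i).toLp (f i)) ≤
      ENNReal.ofReal (‖restrL‖ * (1 + ∑ m ∈ Finset.range (order s + 1),
        5 ^ m * (5 * (3 ^ order s) ^ 5)) * ∏ i, (hNorm s (f i)).toReal) := by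
  obtain ⟨hα0, hα1⟩ := order_lt hs
  set k := order s
  set α := s - k
  set N : Fin 5 → ℝ := fun i => (hNorm s (f i)).toReal with hNd
  have hN0 : ∀ i, 0 ≤ N i := fun i => ENNReal.toReal_nonneg
  have hn : ∀ i, ‖(hf i).toLp (f i)‖ ≤ N i := fun i => norm_toLp_le (hf i) (h i)
  have hd : ∀ i, ∀ m ≤ k, ∀ t, |t| ≤ 1 → ‖rotL t (E i m) - E i m‖ ≤ N i * |t| ^ α :=
    fun i m hm t ht => norm_rotL_sub_le_hNorm hs (hE i) (h i) hm ht
  -- The Hölder bound is at most `N i` for `|t| ≤ 1`, because the exponent is positive. One constant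
  -- `3 ^ k * N i` then serves for the norms and the differences of all derivatives of `f i`.
  have hb : ∀ i, ∀ m ≤ k, ‖E i m‖ ≤ 3 ^ k * N i := fun i m hm => by
    refine ((hE i).norm_le (hn i) (fun m hm t ht => ?_) m hm).trans
      (mul_le_mul_of_nonneg_right (pow_le_pow_right₀ (by norm_num) hm) (hN0 i))
    have ht' : |t| ≤ 1 := by rw [abs_of_nonneg ht.1]; exact ht.2
    exact (hd i m hm t ht').trans
      (mul_le_of_le_one_right (hN0 i) (Real.rpow_le_one (abs_nonneg _) ht' hα0.le))
  set F : L2 := restrL fun i => (hf i).toLp (f i) with hF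
  have hF0 : leibniz E 0 (fun _ => 0) = F := by
    rw [leibniz, hF]
    congr 1
    funext i
    exact (hE i).1
  have hgen : IsGenSeq ((Lp.memLp F).toLp F) k fun m => leibniz E m fun _ => 0 :=
    ⟨hF0.trans (Lp.toLp_coeFn F _).symm,
      fun m hm => isGen_leibniz (fun i => (hE i).2) m _ fun i => by omega⟩
  have hP : 0 ≤ ∏ i, N i := Finset.prod_nonneg fun i _ => hN0 i
  have hFn : eLpNorm F 2 arc ≤ ENNReal.ofReal (‖restrL‖ * ∏ i, N i) := by
    rw [← ENNReal.ofReal_toReal (Lp.eLpNorm_ne_top F)]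
    refine ENNReal.ofReal_le_ofReal ((restrL.le_opNorm _).trans ?_)
    exact mul_le_mul_of_nonneg_left (Finset.prod_le_prod (fun i _ => norm_nonneg _)
      fun i _ => hn i) (norm_nonneg _)
  have hG : ∀ m ∈ Finset.range (k + 1), holderSeminorm α (leibniz E m fun _ => 0) ≤
      ENNReal.ofReal (‖restrL‖ * (5 ^ m * (5 * (3 ^ k) ^ 5)) * ∏ i, N i) := fun m hm => by
    refine holderSeminorm_le fun t ht0 ht => ?_
    have h3 : ∏ i, 3 ^ k * N i = (3 ^ k) ^ 5 * ∏ i, N i := by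
      rw [Finset.prod_mul_distrib, Finset.prod_const, Finset.card_univ, Fintype.card_fin]
    have hx : 0 ≤ |t| ^ α := Real.rpow_nonneg (abs_nonneg _) _
    have h4 := norm_rotL_leibniz_sub_le (A := fun i => 3 ^ k * N i) hb (t := t)
      (fun i m hm => (hd i m hm t ht).trans (mul_le_mul_of_nonneg_right
        (le_mul_of_one_le_left (hN0 i) (one_le_pow₀ (by norm_num))) hx)) m (fun _ => 0)
      fun i => by
        have := Finset.mem_range.1 hm
        omega
    rw [h3] at h4
    refine h4.trans_eq ?_
    ring
  rw [hNorm_eq hgen, if_neg hs.ne']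
  refine (add_le_add hFn (Finset.sum_le_sum hG)).trans ?_
  rw [← ENNReal.ofReal_sum_of_nonneg (fun m _ => by positivity),
    ← ENNReal.ofReal_add (by positivity) (Finset.sum_nonneg fun m _ => by positivity)]
  refine ENNReal.ofReal_le_ofReal (le_of_eq ?_)
  rw [← Finset.sum_mul, ← Finset.mul_sum]
  ring

theorem hNorm_zero {f : Circle → ℂ} (hf : MemLp f 2 arc) : hNorm 0 f = eLpNorm f 2 arc := by
  have h : IsGenSeq (hf.toLp f) (order 0) fun _ => hf.toLp f :=
    -- Truncated subtraction makes `order 0 = 0`, so no derivative is required.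
    ⟨rfl, fun m hm => by simp [order] at hm⟩
  rw [hNorm_eq h, if_pos rfl, add_zero]

end CircleConv

end

theorem lemma3 (s : ℝ) (hs : 0 ≤ s) :
    ∃ C : ℝ≥0, ∀ f : Fin 5 → Circle → ℂ, (∀ i, CircleConv.MemH s (f i)) →
      ∃ F : Circle → ℂ, CircleConv.IsRestriction (CircleConv.conv5 f) F ∧
        CircleConv.MemH s F ∧
        CircleConv.hNorm s F ≤ C * ∏ i, CircleConv.hNorm s (f i) := by
  suffices h : ∃ C : ℝ≥0, ∀ f : Fin 5 → Circle → ℂ, (∀ i, CircleConv.MemH s (f i)) →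
      ∃ F : Circle → ℂ, CircleConv.IsRestriction (CircleConv.conv5 f) F ∧
        CircleConv.hNorm s F ≤ C * ∏ i, CircleConv.hNorm s (f i) by
    obtain ⟨C, hC⟩ := h
    refine ⟨C, fun f hf => ?_⟩
    obtain ⟨F, hF, hle⟩ := hC f hf
    exact ⟨F, hF, hle.trans_lt (ENNReal.mul_lt_top ENNReal.coe_lt_top
      (ENNReal.prod_lt_top fun i _ => hf i)), hle⟩
  rcases hs.eq_or_lt with rfl | hs
  -- For `s = 0` the norm is the plain `L²` norm, and the uniform bound for mean densities passes to
  -- the limit.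
  · refine ⟨CircleConv.meanConst.toNNReal, fun f hf => ?_⟩
    choose hL E hE using fun i => (hf i).exists_isGenSeq
    refine ⟨_, CircleConv.isRestriction_restrL hL, ?_⟩
    rw [CircleConv.hNorm_zero (Lp.memLp _), ENNReal.coe_toNNReal CircleConv.meanConst_ne_top]
    simp only [fun i => CircleConv.hNorm_zero (hL i)]
    exact ((CircleConv.isMeanLimit_restr _).congr (fun i => (hL i).coeFn_toLp)
      (ae_eq_refl _)).eLpNorm_le hL (Lp.memLp _)
  · obtain ⟨c, hc⟩ : ∃ c : ℝ, c = ‖CircleConv.restrL‖ * (1 + ∑ m ∈ Finset.range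
      (CircleConv.order s + 1), 5 ^ m * (5 * (3 ^ CircleConv.order s) ^ 5)) := ⟨_, rfl⟩
    have hc0 : 0 ≤ c := by rw [hc]; positivity
    refine ⟨c.toNNReal, fun f hf => ?_⟩
    choose hL E hE using fun i => (hf i).exists_isGenSeq
    refine ⟨_, CircleConv.isRestriction_restrL hL, ?_⟩
    refine (CircleConv.hNorm_restrL_le hs hL hE hf).trans_eq ?_
    rw [← hc, ENNReal.ofReal_mul hc0, ENNReal.ofReal_prod_of_nonneg
      (fun i _ => ENNReal.toReal_nonneg)]
    simp only [fun i => ENNReal.ofReal_toReal (hf i).ne]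
    rfl
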